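/- Consider the isotropic two-dimensional long-range Ising model: configurations $\sigma\in\Omega=\{-1,+1\}^{\mathbb Z^2}$ (product topology and product $\sigma$-algebra $\mathcal F$), formal Hamiltonian $H(\sigma)=-\sum_{\{i,j\}}J\,|i-j|^{-\alpha}\sigma_i\sigma_j$ (sum over unordered pairs of distinct sites, $|\cdot|$ the Euclidean norm), with $J>0$ and $\alpha>2$. At inverse temperature $\beta>0$ let $\gamma=\gamma^{J,\alpha,\beta}$ be its Gibbs specification, $$\gamma_\Lambda(\sigma_\Lambda\mid\omega)=\frac1{Z_\Lambda(\omega)}\exp\Big(\beta\sum_{\{i,j\}\cap\Lambda\ne\emptyset}J|i-j|^{-\alpha}\eta_i\eta_j\Big),\qquad \eta=\sigma_\Lambda\omega_{\Lambda^c},\quad \Lambda\subset\mathbb Z^2\text{ finite},$$ and let $\mathcal G(\gamma)$ be the set of probability measures $\mu$ on $\Omega$ with $\mu[A\mid\mathcal F_{\Lambda^c}]=\gamma_\Lambda(A\mid\cdot)$ $\mu$-a.s. for all finite $\Lambda$ and all $A\in\mathcal F$ ($\mathcal F_{\Delta}$ is the $\sigma$-algebra generated by the spins in $\Delta$). The plus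 phase $\mu^+$ is the weak limit of $\gamma_\Lambda(\cdot\mid+)$ as $\Lambda\uparrow\mathbb Z^2$, where $+$ is the all-plus boundary condition. Decimation is the map $T:\Omega\to\Omega$, $(T\omega)_i=\omega_{2i}$, and $T\mu=\mu\circ T^{-1}$. A function $f:\Omega\to\mathbb R$ is local if it is $\mathcal F_\Lambda$-measurable for some finite $\Lambda$, and quasilocal if $\sup\{|f(\sigma)-f(\omega)|:\sigma_\Lambda=\omega_\Lambda\}\to0$ as $\Lambda\uparrow\mathbb Z^2$. A specification (a proper, consistent family of probability kernels $\gamma_\Lambda$ from $\mathcal F_{\Lambda^c}$ to $\mathcal F$, indexed by the finite $\Lambda\subset\mathbb Z^2$) is quasilocal if $\gamma_\Lambda f$ is quasilocal for every finite $\Lambda$ and every local $f$; it is non-null if $\gamma_\Lambda(A\mid\omega)>0$ for all $\omega$ whenever $A\in\mathcal F_\Lambda$ has positive probability under the uniform product measure. A probability measure on $\Omega$ is quasilocal if it is consistent with some quasilocal specification, and Gibbs if it is consistent with some non-null quasilocal specification. **Theorem.** For every $J>0$ and $\alpha>2$ there is $\beta_0=\beta_0(J,\alpha)\in(0,\infty)$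 such that for all $\beta>\beta_0$: the plus phase $\mu^+$ exists and belongs to $\mathcal G(\gamma)$, and its decimation $\nu^+=T\mu^+$ is non-quasilocal, hence not a Gibbs measure; moreover, for every $\mu\in\mathcal G(\gamma)$, the decimated measure $T\mu$ is non-quasilocal, hence not a Gibbs measure. -/

import Mathlib

open MeasureTheory Filter Topology

noncomputable section

namespace LongRangeIsing

/-- Sites of the square lattice `ℤ²`. -/
abbrev Site : Type := ℤ × ℤ

/-- Configurations of Ising spins on `ℤ²`.  The single-spin space `{-1, +1}` is encoded by `Bool`
(`true` is `+1`, `false` is `-1`), with its discrete topology, σ-algebra and order;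
`Config` carries the product structures. -/
abbrev Config : Type := Site → Bool

/-- The numerical value `±1` of a spin. -/
def spin (b : Bool) : ℝ := if b then 1 else -1

/-- The configuration with all spins equal to `+1`. -/
def allPlus : Config := fun _ => true

/-- Euclidean distance on `ℤ²`. -/
def siteDist (i j : Site) : ℝ :=
  Real.sqrt (((i.1 : ℝ) - j.1) ^ 2 + ((i.2 : ℝ) - j.2) ^ 2)

/-! ### Specifications, quasilocality and Gibbs measures -/

/-- A local function: measurable with respect to the spins in some finite set of sites. -/
def IsLocal (f : Config → ℝ) : Prop :=
  ∃ Λ : Finset Site, Measurable[cylinderEvents (Λ : Set Site)] f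

/-- A quasilocal function: the oscillation of `f` over pairs of configurations that agree on `Λ`
tends to `0` as `Λ` increases to `ℤ²`. -/
def IsQuasilocalFun (f : Config → ℝ) : Prop :=
  ∀ ε : ℝ, 0 < ε → ∃ Λ : Finset Site, ∀ σ ω : Config,
    (∀ i ∈ Λ, σ i = ω i) → |f σ - f ω| ≤ ε

/-- `γ Λ ω` is the measure `γ_Λ(· | ω)`. The laws of a specification: probability measures,
measurability with respect to the outside, properness, consistency. -/
structure IsSpecification (γ : Finset Site → Config → Measure Config) : Prop where
  isProbabilityMeasure : ∀ Λ ω, IsProbabilityMeasure (γ Λ ω)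
  measurable_outside : ∀ (Λ : Finset Site) (A : Set Config), MeasurableSet A →
    Measurable[cylinderEvents ((Λ : Set Site)ᶜ)] fun ω => γ Λ ω A
  proper : ∀ (Λ : Finset Site) (B : Set Config),
    MeasurableSet[cylinderEvents ((Λ : Set Site)ᶜ)] B →
      ∀ ω, γ Λ ω B = B.indicator (fun _ => 1) ω
  consistent : ∀ Λ Λ' : Finset Site, Λ ⊆ Λ' → ∀ A : Set Config, MeasurableSet A →
    ∀ ω, ∫⁻ η, γ Λ η A ∂(γ Λ' ω) = γ Λ' ω A

/-- `μ` is consistent with `γ` (the DLR equations, `μ ∈ 𝒢(γ)`): `μ` is a probability measure and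
`γ_Λ(A | ·)` is a version of the conditional probability of `A` given the spins outside `Λ`. -/
structure IsDLR (γ : Finset Site → Config → Measure Config) (μ : Measure Config) : Prop where
  isProbabilityMeasure : IsProbabilityMeasure μ
  condExp_eq : ∀ (Λ : Finset Site) (A : Set Config), MeasurableSet A →
    μ[A.indicator (fun _ => (1 : ℝ)) | cylinderEvents ((Λ : Set Site)ᶜ)]
      =ᵐ[μ] fun ω => (γ Λ ω).real A

/-- A family of kernels is quasilocal when `γ_Λ f` is quasilocal for every local `f`. -/
def IsQuasilocalSpec (γ : Finset Site → Config → Measure Config) : Prop :=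
  ∀ (Λ : Finset Site) (f : Config → ℝ), IsLocal f → IsQuasilocalFun fun ω => ∫ σ, f σ ∂(γ Λ ω)

/-- The single-spin a priori measure `½ δ₋₁ + ½ δ₊₁`. -/
def spinPrior : Measure Bool :=
  (2⁻¹ : ENNReal) • Measure.dirac false + (2⁻¹ : ENNReal) • Measure.dirac true

instance : IsProbabilityMeasure spinPrior :=
  ⟨by simp [spinPrior, ENNReal.inv_two_add_inv_two]⟩

/-- The a priori product measure on configurations. -/
def prior : Measure Config := Measure.infinitePi fun _ : Site => spinPrior

/-- Non-nullness of a family of kernels. -/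
def IsNonNull (γ : Finset Site → Config → Measure Config) : Prop :=
  ∀ (Λ : Finset Site) (A : Set Config), MeasurableSet[cylinderEvents (Λ : Set Site)] A →
    0 < prior A → ∀ ω, 0 < γ Λ ω A

/-- A quasilocal measure: one that is specified by a quasilocal specification. -/
def IsQuasilocalMeasure (μ : Measure Config) : Prop :=
  ∃ γ : Finset Site → Config → Measure Config,
    IsSpecification γ ∧ IsQuasilocalSpec γ ∧ IsDLR γ μ

/-- A Gibbs measure: one that is specified by a non-null quasilocal specification. -/
def IsGibbsMeasure (μ : Measure Config) : Prop :=
  ∃ γ : Finset Site → Config → Measure Config,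
    IsSpecification γ ∧ IsNonNull γ ∧ IsQuasilocalSpec γ ∧ IsDLR γ μ

/-! ### The isotropic long-range Ising model -/

/-- The coupling `J |i - j|^{-α}` between distinct sites. -/
def coupling (J α : ℝ) (i j : Site) : ℝ :=
  if i = j then 0 else J * siteDist i j ^ (-α)

/-- The configuration `σ_Λ ω_{Λᶜ}`. -/
def glue (Λ : Finset Site) (σ : Λ → Bool) (ω : Config) : Config :=
  fun i => if h : i ∈ Λ then σ ⟨i, h⟩ else ω i

/-- The Hamiltonian `- ∑ J(i,j) η_i η_j` in the volume `Λ`, over all unordered pairs `{i, j}` that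
meet `Λ`: pairs inside `Λ` (each occurs twice in the double sum, hence the factor `1/2`), and pairs
with one site in `Λ` and the other outside. -/
def hamiltonian (J α : ℝ) (Λ : Finset Site) (η : Config) : ℝ :=
  -((1 / 2) * ∑ i ∈ Λ, ∑ j ∈ Λ, coupling J α i j * spin (η i) * spin (η j))
    - ∑ i ∈ Λ, ∑' j : {j : Site // j ∉ Λ}, coupling J α i j * spin (η i) * spin (η j)

/-- The Boltzmann weight of `σ` in `Λ` with boundary condition `ω`. -/
def boltzmann (J α β : ℝ) (Λ : Finset Site) (ω : Config) (σ : Λ → Bool) : ℝ :=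
  Real.exp (-β * hamiltonian J α Λ (glue Λ σ ω))

/-- The partition function in `Λ` with boundary condition `ω`. -/
def partitionFunction (J α β : ℝ) (Λ : Finset Site) (ω : Config) : ℝ :=
  ∑ σ : Λ → Bool, boltzmann J α β Λ ω σ

/-- The Gibbs specification of the model at inverse temperature `β`. (The normalization of the
uniform a priori measure on `{-1, +1}^Λ` cancels against the partition function.) -/
def isingSpec (J α β : ℝ) (Λ : Finset Site) (ω : Config) : Measure Config :=
  ∑ σ : Λ → Bool,
    ENNReal.ofReal (boltzmann J α β Λ ω σ / partitionFunction J α β Λ ω) •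
      Measure.dirac (glue Λ σ ω)

/-- `μ` is the plus phase: the infinite-volume limit of the finite-volume Gibbs measures with the
all-plus boundary condition, tested on quasilocal functions. -/
structure IsPlusPhase (J α β : ℝ) (μ : Measure Config) : Prop where
  isProbabilityMeasure : IsProbabilityMeasure μ
  tendsto : ∀ f : Config → ℝ, IsQuasilocalFun f →
    Tendsto (fun Λ : Finset Site => ∫ σ, f σ ∂(isingSpec J α β Λ allPlus)) atTop
      (𝓝 (∫ σ, f σ ∂μ))

/-! ### Decimation -/

/-- Decimation of spacing two: `(T ω)_i = ω_{2i}`. -/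
def decimate (ω : Config) : Config := fun i => ω (2 * i.1, 2 * i.2)

/-- The decimated measure `T μ`, the image of `μ` under decimation. -/
def decimated (μ : Measure Config) : Measure Config := μ.map decimate

end LongRangeIsing

end

/-! Call a site even if both coordinates are even, internal otherwise. The decimated measure fails
to be quasilocal because, for one particular configuration of the even spins, the internal spins
undergo a phase transition, and even spins arbitrarily far from the origin can then select the
phase.

That configuration is the alternating one. It exerts no field on internal sites: reflection in a
lattice line through a site with an odd coordinate reverses it (`tsum_coupling_mul_altValue`).
Griffiths' inequality compares the internal spins with a nearest-neighbour Ising model on the sites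
with two odd coordinates, of coupling `J * 2 ^ (-α)`. Peierls' argument for that model
(`half_le_gibbsMean_of_peierls`) gives magnetization at least 1/2 under plus and at most -1/2 under
minus boundary conditions, uniformly in the box (`half_le_gibbsMean_reference`).

The selection of the phase must withstand any configuration outside a finite box, although the
outside acts directly on every spin of the box. It is achieved by a dilute periodic set of reversed
even spins, one per block: `pattMinus` turns some plus spins into minus, `pattPlus` some minus spins
into plus. The observable in block `k` is the expected factor by which the Boltzmann weight changes
when the even spin at the block centre is reversed; the factor decreases in the internal spins.
Jensen's inequality (`gibbsMean_le_gibbsMean_tilt`) bounds the effect of exchanging the boundary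
condition on the sum of these observables by twice the energy difference, at the price of a tilt by
a small multiple of the sum. The energy difference is small compared to the volume, since the
couplings are summable (`exists_sum_outerCoupling_le`), and by Holley's inequality the field of the
dilute spins absorbs the tilt. Hence `pattMinus` with plus boundary is, on average over blocks and
up to a small error, at least as negative as the alternating minus phase, and symmetrically for
`pattPlus`. Some block of a large box therefore keeps half of the gap between the phases
(`exists_block`).

The odds formula `plusProb_insert` and monotonicity turn this into a gap of conditional
probabilities that is uniform in the outside (`plusProb_separated`). Moving the block centre to the
origin yields patterns that agree on a prescribed square and yet force a fixed gap
(`exists_selecting_patterns`). Their cylinders have positive mass, so a kernel at the origin that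
specifies the decimated measure takes separated values on configurations that agree near the origin,
against quasilocality (`not_isQuasilocalMeasure_decimated`). The Gibbs property would imply
quasilocality.

The plus phase is obtained from compactness together with monotonicity in the volume, and the DLR
equations pass to the limit (`exists_isPlusPhase`). -/

noncomputable section

namespace LongRangeIsing

/-! ### Finite Gibbs ensembles -/

section Ensemble

set_option linter.unusedSectionVars false

variable {ι : Type*} [Fintype ι] [DecidableEq ι]

/-- The partition function of the log-weight `G` on a finite set of spins. -/
def gibbsZ (G : (ι → Bool) → ℝ) : ℝ := ∑ σ, Real.exp (G σ)

/-- The Gibbs expectation of `f` for the log-weight `G`. -/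
def gibbsMean (G f : (ι → Bool) → ℝ) : ℝ := (∑ σ, f σ * Real.exp (G σ)) / gibbsZ G

/-- Minus the energy of a finite Ising system with pair couplings `K` and fields `h`. -/
def pairEnergy (K : ι → ι → ℝ) (h : ι → ℝ) (σ : ι → Bool) : ℝ :=
  (1 / 2) * ∑ x, ∑ y, K x y * spin (σ x) * spin (σ y) + ∑ x, h x * spin (σ x)

lemma gibbsZ_pos (G : (ι → Bool) → ℝ) : 0 < gibbsZ G :=
  Finset.sum_pos (fun _ _ => Real.exp_pos _) Finset.univ_nonempty

lemma gibbsMean_const (G : (ι → Bool) → ℝ) (c : ℝ) : gibbsMean G (fun _ => c) = c := by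
  rw [gibbsMean, ← Finset.mul_sum, ← gibbsZ, mul_div_assoc, div_self (gibbsZ_pos G).ne', mul_one]

lemma gibbsMean_add (G f g : (ι → Bool) → ℝ) :
    gibbsMean G (fun σ => f σ + g σ) = gibbsMean G f + gibbsMean G g := by
  simp only [gibbsMean, add_mul, Finset.sum_add_distrib, add_div]

lemma gibbsMean_const_mul (G f : (ι → Bool) → ℝ) (c : ℝ) :
    gibbsMean G (fun σ => c * f σ) = c * gibbsMean G f := by
  simp only [gibbsMean, mul_assoc, ← Finset.mul_sum, mul_div_assoc]

lemma gibbsMean_neg (G f : (ι → Bool) → ℝ) :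
    gibbsMean G (fun σ => -f σ) = -gibbsMean G f := by
  simpa using gibbsMean_const_mul G f (-1)

lemma gibbsMean_sum {κ : Type*} (s : Finset κ) (G : (ι → Bool) → ℝ) (f : κ → (ι → Bool) → ℝ) :
    gibbsMean G (fun σ => ∑ k ∈ s, f k σ) = ∑ k ∈ s, gibbsMean G (f k) := by
  simp only [gibbsMean, Finset.sum_mul]
  rw [Finset.sum_comm, Finset.sum_div]

lemma gibbsMean_mono (G : (ι → Bool) → ℝ) {f g : (ι → Bool) → ℝ} (h : ∀ σ, f σ ≤ g σ) :
    gibbsMean G f ≤ gibbsMean G g := by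
  unfold gibbsMean
  have := gibbsZ_pos G
  gcongr
  exact h _

/-- **Holley's inequality** for expectations of increasing functions. -/
lemma gibbsMean_le_of_holley {G₁ G₂ f : (ι → Bool) → ℝ}
    (hG : ∀ a b, G₁ a + G₂ b ≤ G₁ (a ⊓ b) + G₂ (a ⊔ b)) (hf : Monotone f) :
    gibbsMean G₁ f ≤ gibbsMean G₂ f := by
  -- The four functions theorem needs nonnegative functions; subtracting the minimum of `f` shifts
  -- both means equally.
  set m := f ⊥ with hm
  have h0 : ∀ σ, 0 ≤ f σ - m := fun σ => sub_nonneg.2 (hf bot_le)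
  have key := four_functions_theorem_univ (fun σ => (f σ - m) * Real.exp (G₁ σ))
    (fun σ => Real.exp (G₂ σ)) (fun σ => Real.exp (G₁ σ))
    (fun σ => (f σ - m) * Real.exp (G₂ σ))
    (fun σ => mul_nonneg (h0 σ) (Real.exp_pos _).le) (fun σ => (Real.exp_pos _).le)
    (fun σ => (Real.exp_pos _).le) (fun σ => mul_nonneg (h0 σ) (Real.exp_pos _).le) (by
      intro a b
      have h1 : Real.exp (G₁ a) * Real.exp (G₂ b)
          ≤ Real.exp (G₁ (a ⊓ b)) * Real.exp (G₂ (a ⊔ b)) := by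
        rw [← Real.exp_add, ← Real.exp_add]; exact Real.exp_le_exp.2 (hG a b)
      have h2 : f a - m ≤ f (a ⊔ b) - m := sub_le_sub_right (hf le_sup_left) _
      calc (f a - m) * Real.exp (G₁ a) * Real.exp (G₂ b)
          = (f a - m) * (Real.exp (G₁ a) * Real.exp (G₂ b)) := by ring
        _ ≤ (f (a ⊔ b) - m) * (Real.exp (G₁ (a ⊓ b)) * Real.exp (G₂ (a ⊔ b))) :=
            mul_le_mul h2 h1 (by positivity) (h0 _)
        _ = _ := by ring)
  have h3 : gibbsMean G₁ (fun σ => f σ - m) ≤ gibbsMean G₂ (fun σ => f σ - m) := by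
    rw [gibbsMean, gibbsMean, div_le_div_iff₀ (gibbsZ_pos _) (gibbsZ_pos _)]
    simpa [gibbsZ, mul_comm] using key
  have e : ∀ G, gibbsMean G (fun σ => f σ - m) = gibbsMean G f - m := fun G => by
    simp only [sub_eq_add_neg]
    rw [gibbsMean_add, gibbsMean_const]
  rw [e, e] at h3
  linarith

lemma spin_mul_spin_supermodular (a b c d : Bool) :
    spin a * spin b + spin c * spin d
      ≤ spin (a ⊓ c) * spin (b ⊓ d) + spin (a ⊔ c) * spin (b ⊔ d) := by
  cases a <;> cases b <;> cases c <;> cases d <;> norm_num [spin]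

lemma spin_inf_add_spin_sup (a b : Bool) : spin (a ⊓ b) + spin (a ⊔ b) = spin a + spin b := by
  cases a <;> cases b <;> norm_num [spin]

lemma spin_mono : Monotone spin := by
  intro a b h
  cases a <;> cases b <;> first | exact absurd h (by decide) | norm_num [spin]

lemma abs_spin (b : Bool) : |spin b| = 1 := by cases b <;> simp [spin]

lemma spin_mul_self (b : Bool) : spin b * spin b = 1 := by cases b <;> simp [spin]

lemma spin_not (b : Bool) : spin (!b) = -spin b := by cases b <;> norm_num [spin]

/-- The pair part is supermodular and the field part is exact, because the spins of `a ⊓ b` and `a ⊔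
b` add up to those of `a` and `b`. The last sum is kept, since it is the room into which a tilt of
the measure will have to fit. -/
lemma pairEnergy_add_le_sub {K : ι → ι → ℝ} (hK : ∀ x y, 0 ≤ K x y) (h₁ h₂ : ι → ℝ)
    (a b : ι → Bool) :
    pairEnergy K h₁ a + pairEnergy K h₂ b ≤ pairEnergy K h₁ (a ⊓ b) + pairEnergy K h₂ (a ⊔ b)
      - ∑ x, (h₂ x - h₁ x) * (spin (a x) - spin ((a ⊓ b) x)) := by
  have e1 : ∑ x, ∑ y, K x y * spin (a x) * spin (a y) + ∑ x, ∑ y, K x y * spin (b x) * spin (b y)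
      ≤ ∑ x, ∑ y, K x y * spin ((a ⊓ b) x) * spin ((a ⊓ b) y)
        + ∑ x, ∑ y, K x y * spin ((a ⊔ b) x) * spin ((a ⊔ b) y) := by
    simp only [← Finset.sum_add_distrib]
    refine Finset.sum_le_sum fun x _ => Finset.sum_le_sum fun y _ => ?_
    have := mul_le_mul_of_nonneg_left
      (spin_mul_spin_supermodular (a x) (a y) (b x) (b y)) (hK x y)
    simp only [Pi.inf_apply, Pi.sup_apply]
    linarith
  have e2 : ∑ x, h₁ x * spin (a x) + ∑ x, h₂ x * spin (b x)
      = ∑ x, h₁ x * spin ((a ⊓ b) x) + ∑ x, h₂ x * spin ((a ⊔ b) x)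
        - ∑ x, (h₂ x - h₁ x) * (spin (a x) - spin ((a ⊓ b) x)) := by
    simp only [← Finset.sum_add_distrib, ← Finset.sum_sub_distrib]
    refine Finset.sum_congr rfl fun x _ => ?_
    have := spin_inf_add_spin_sup (a x) (b x)
    simp only [Pi.inf_apply, Pi.sup_apply]
    have h4 : spin (a x ⊔ b x) = spin (a x) + spin (b x) - spin (a x ⊓ b x) := by linarith
    rw [h4]; ring
  unfold pairEnergy
  linarith

/-- Expectations of increasing functions increase with the field. -/
lemma gibbsMean_pairEnergy_mono {K : ι → ι → ℝ} (hK : ∀ x y, 0 ≤ K x y) {h₁ h₂ : ι → ℝ}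
    (hh : ∀ x, h₁ x ≤ h₂ x) {f : (ι → Bool) → ℝ} (hf : Monotone f) :
    gibbsMean (pairEnergy K h₁) f ≤ gibbsMean (pairEnergy K h₂) f := by
  refine gibbsMean_le_of_holley (fun a b => ?_) hf
  refine (pairEnergy_add_le_sub hK h₁ h₂ a b).trans (sub_le_self _ ?_)
  refine Finset.sum_nonneg fun x _ => mul_nonneg (sub_nonneg.2 (hh x)) (sub_nonneg.2 ?_)
  exact spin_mono inf_le_left

/-- A tilt by `F` is dominated by the fields `t` when `F` is Lipschitz with constants `t`. -/
lemma gibbsMean_tilt_le {K : ι → ι → ℝ} (hK : ∀ x y, 0 ≤ K x y) {w v t : ι → ℝ}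
    (hw : ∀ x, w x + t x ≤ v x) {F : (ι → Bool) → ℝ}
    (hF : ∀ a b, b ≤ a → F a - F b ≤ ∑ x, t x * (spin (a x) - spin (b x)))
    {f : (ι → Bool) → ℝ} (hf : Monotone f) :
    gibbsMean (fun σ => pairEnergy K w σ + F σ) f ≤ gibbsMean (pairEnergy K v) f := by
  refine gibbsMean_le_of_holley (fun a b => ?_) hf
  have h1 := pairEnergy_add_le_sub hK w v a b
  have h2 := hF a (a ⊓ b) inf_le_left
  have h3 : ∑ x, t x * (spin (a x) - spin ((a ⊓ b) x))
      ≤ ∑ x, (v x - w x) * (spin (a x) - spin ((a ⊓ b) x)) := by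
    refine Finset.sum_le_sum fun x _ => mul_le_mul_of_nonneg_right (by linarith [hw x]) ?_
    exact sub_nonneg.2 (spin_mono inf_le_left)
  linarith

/-- The mirror image of `gibbsMean_tilt_le`. -/
lemma le_gibbsMean_tilt {K : ι → ι → ℝ} (hK : ∀ x y, 0 ≤ K x y) {w v t : ι → ℝ}
    (hw : ∀ x, v x + t x ≤ w x) {F : (ι → Bool) → ℝ}
    (hF : ∀ a b, b ≤ a → F b - F a ≤ ∑ x, t x * (spin (a x) - spin (b x)))
    {f : (ι → Bool) → ℝ} (hf : Monotone f) :
    gibbsMean (pairEnergy K v) f ≤ gibbsMean (fun σ => pairEnergy K w σ + F σ) f := by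
  refine gibbsMean_le_of_holley (fun a b => ?_) hf
  have h1 := pairEnergy_add_le_sub hK v w a b
  have h2 := hF (a ⊔ b) b le_sup_right
  have e : ∀ x, spin ((a ⊔ b) x) - spin (b x) = spin (a x) - spin ((a ⊓ b) x) := fun x => by
    have := spin_inf_add_spin_sup (a x) (b x)
    simp only [Pi.inf_apply, Pi.sup_apply]
    linarith
  simp only [e] at h2
  have h3 : ∑ x, t x * (spin (a x) - spin ((a ⊓ b) x))
      ≤ ∑ x, (w x - v x) * (spin (a x) - spin ((a ⊓ b) x)) := by
    refine Finset.sum_le_sum fun x _ => mul_le_mul_of_nonneg_right (by linarith [hw x]) ?_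
    exact sub_nonneg.2 (spin_mono inf_le_left)
  linarith

/-- Jensen's inequality for the exponential: the ratio of partition functions is the mean of `exp
F`. -/
lemma gibbsMean_le_log_ratio (G F : (ι → Bool) → ℝ) :
    gibbsMean G F ≤ Real.log (gibbsZ (fun σ => G σ + F σ)) - Real.log (gibbsZ G) := by
  have hZ := gibbsZ_pos G
  rw [← Real.log_div (gibbsZ_pos _).ne' hZ.ne', Real.le_log_iff_exp_le
    (div_pos (gibbsZ_pos _) hZ)]
  have h := convexOn_exp.map_sum_le (t := Finset.univ) (w := fun σ => Real.exp (G σ) / gibbsZ G)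
    (p := F) (fun σ _ => (div_pos (Real.exp_pos _) hZ).le)
    (by rw [← Finset.sum_div, ← gibbsZ, div_self hZ.ne']) (fun _ _ => Set.mem_univ _)
  simp only [smul_eq_mul] at h
  have e1 : gibbsMean G F = ∑ σ, Real.exp (G σ) / gibbsZ G * F σ := by
    rw [gibbsMean, Finset.sum_div]
    exact Finset.sum_congr rfl fun σ _ => by ring
  have e2 : gibbsZ (fun σ => G σ + F σ) / gibbsZ G
      = ∑ σ, Real.exp (G σ) / gibbsZ G * Real.exp (F σ) := by
    rw [gibbsZ, Finset.sum_div]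
    exact Finset.sum_congr rfl fun σ _ => by rw [Real.exp_add]; ring
  rw [e1, e2]
  exact h

lemma log_gibbsZ_le {G G' : (ι → Bool) → ℝ} {C : ℝ} (h : ∀ σ, G σ ≤ G' σ + C) :
    Real.log (gibbsZ G) ≤ Real.log (gibbsZ G') + C := by
  rw [Real.log_le_iff_le_exp (gibbsZ_pos G), Real.exp_add, Real.exp_log (gibbsZ_pos G'), gibbsZ,
    gibbsZ, Finset.sum_mul]
  refine Finset.sum_le_sum fun σ _ => ?_
  rw [← Real.exp_add]
  exact Real.exp_le_exp.2 (h σ)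

/-- Two log-weights that differ by at most `C` have comparable expectations of `F`, after tilting
one of them by `F`. -/
lemma gibbsMean_le_gibbsMean_tilt {G G' : (ι → Bool) → ℝ} {C : ℝ} (h : ∀ σ, |G σ - G' σ| ≤ C)
    (F : (ι → Bool) → ℝ) :
    gibbsMean G F ≤ gibbsMean (fun σ => G' σ + F σ) F + 2 * C := by
  -- Jensen's inequality is used twice, for `G` with the tilt `F` and for `G' + F` with the tilt
  -- `-F`. Replacing `G` by `G'` in the two partition functions costs `C` each time.
  have h1 := gibbsMean_le_log_ratio G F
  have h2 := gibbsMean_le_log_ratio (fun σ => G' σ + F σ) (fun σ => -F σ)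
  rw [gibbsMean_neg] at h2
  simp only [add_neg_cancel_right] at h2
  have h3 : Real.log (gibbsZ fun σ => G σ + F σ) ≤ Real.log (gibbsZ fun σ => G' σ + F σ) + C :=
    log_gibbsZ_le fun σ => by have := abs_le.1 (h σ); linarith
  have h4 : Real.log (gibbsZ G') ≤ Real.log (gibbsZ G) + C :=
    log_gibbsZ_le fun σ => by have := abs_le.1 (h σ); linarith
  linarith

/-! ### Griffiths inequalities -/

/-- The monomial `∏ σ_x ^ n_x`. -/
def spinMonomial (n : ι → ℕ) (σ : ι → Bool) : ℝ := ∏ x, spin (σ x) ^ n x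

/-- The cone of nonnegative combinations of spin monomials. -/
def griffithsCone (ι : Type*) [Fintype ι] : AddSubmonoid ((ι → Bool) → ℝ) :=
  AddSubmonoid.closure {f | ∃ (c : ℝ) (n : ι → ℕ), 0 ≤ c ∧ f = fun σ => c * spinMonomial n σ}

lemma spinMonomial_add (n m : ι → ℕ) (σ : ι → Bool) :
    spinMonomial (n + m) σ = spinMonomial n σ * spinMonomial m σ := by
  simp [spinMonomial, pow_add, Finset.prod_mul_distrib]

lemma spinMonomial_single (x : ι) (σ : ι → Bool) : spinMonomial (Pi.single x 1) σ = spin (σ x) := by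
  rw [spinMonomial, Finset.prod_eq_single x]
  · simp
  · intro y _ hy; simp [hy]
  · simp

lemma spinMonomial_mem (c : ℝ) (hc : 0 ≤ c) (n : ι → ℕ) :
    (fun σ => c * spinMonomial n σ) ∈ griffithsCone ι :=
  AddSubmonoid.subset_closure ⟨c, n, hc, rfl⟩

lemma const_mem_griffithsCone {c : ℝ} (hc : 0 ≤ c) :
    (fun _ => c : (ι → Bool) → ℝ) ∈ griffithsCone ι := by
  convert spinMonomial_mem (ι := ι) c hc 0 using 2
  simp [spinMonomial]

lemma spin_mem_griffithsCone (x : ι) : (fun σ : ι → Bool => spin (σ x)) ∈ griffithsCone ι := by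
  convert spinMonomial_mem 1 zero_le_one (Pi.single x 1) using 2
  rw [spinMonomial_single, one_mul]

lemma mul_mem_griffithsCone {f g : (ι → Bool) → ℝ} (hf : f ∈ griffithsCone ι)
    (hg : g ∈ griffithsCone ι) : (fun σ => f σ * g σ) ∈ griffithsCone ι := by
  induction hf using AddSubmonoid.closure_induction with
  | mem f hf =>
    obtain ⟨c, n, hc, rfl⟩ := hf
    induction hg using AddSubmonoid.closure_induction with
    | mem g hg =>
      obtain ⟨d, m, hd, rfl⟩ := hg
      convert spinMonomial_mem (c * d) (mul_nonneg hc hd) (n + m) using 2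
      rw [spinMonomial_add]; ring
    | zero => simpa using const_mem_griffithsCone (ι := ι) le_rfl
    | add g₁ g₂ _ _ h₁ h₂ =>
      simp only [Pi.add_apply, mul_add]
      exact (griffithsCone ι).add_mem h₁ h₂
  | zero => simpa using const_mem_griffithsCone (ι := ι) le_rfl
  | add f₁ f₂ _ _ h₁ h₂ =>
    simp only [Pi.add_apply, add_mul]
    exact (griffithsCone ι).add_mem h₁ h₂

/-- A monomial takes only the values 1 and -1, so its exponential is affine in it, with coefficients
that keep it in the cone. -/
lemma exp_monomial (c : ℝ) (n : ι → ℕ) (σ : ι → Bool) :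
    Real.exp (c * spinMonomial n σ) = Real.cosh c + Real.sinh c * spinMonomial n σ := by
  have h : spinMonomial n σ = 1 ∨ spinMonomial n σ = -1 := by
    rw [← sq_eq_one_iff, spinMonomial, ← Finset.prod_pow]
    refine Finset.prod_eq_one fun x _ => ?_
    rw [← pow_mul, mul_comm, pow_mul, sq, spin_mul_self, one_pow]
  rcases h with h | h <;> rw [h]
  · rw [mul_one, mul_one, Real.cosh_add_sinh]
  · rw [mul_neg_one, mul_neg_one, ← sub_eq_add_neg, Real.cosh_sub_sinh]

lemma exp_mem_griffithsCone {f : (ι → Bool) → ℝ} (hf : f ∈ griffithsCone ι) :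
    (fun σ => Real.exp (f σ)) ∈ griffithsCone ι := by
  induction hf using AddSubmonoid.closure_induction with
  | mem f hf =>
    obtain ⟨c, n, hc, rfl⟩ := hf
    simp only [exp_monomial]
    exact (griffithsCone ι).add_mem (const_mem_griffithsCone (Real.cosh_pos c).le)
      (spinMonomial_mem _ (Real.sinh_nonneg_iff.2 hc) n)
  | zero => simpa using const_mem_griffithsCone (ι := ι) zero_le_one
  | add f₁ f₂ _ _ h₁ h₂ => simpa [Real.exp_add] using mul_mem_griffithsCone h₁ h₂

/-- The first Griffiths inequality for the uniform measure. -/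
lemma sum_nonneg_of_mem_griffithsCone {f : (ι → Bool) → ℝ} (hf : f ∈ griffithsCone ι) :
    0 ≤ ∑ σ, f σ := by
  induction hf using AddSubmonoid.closure_induction with
  | mem f hf =>
    obtain ⟨c, n, hc, rfl⟩ := hf
    rw [← Finset.mul_sum]
    refine mul_nonneg hc ?_
    have : ∑ σ : ι → Bool, spinMonomial n σ = ∏ x, ∑ b : Bool, spin b ^ n x := by
      simp only [spinMonomial]
      rw [Finset.prod_univ_sum, Fintype.piFinset_univ]
    rw [this]
    refine Finset.prod_nonneg fun x _ => ?_
    rcases Nat.even_or_odd (n x) with h | h <;> simp [spin, h.neg_one_pow]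
  | zero => simp
  | add f₁ f₂ _ _ h₁ h₂ => simpa [Finset.sum_add_distrib] using add_nonneg h₁ h₂

/-- Pointwise product of spin configurations. -/
def spinMul (ρ σ : ι → Bool) : ι → Bool := fun x => !(xor (ρ x) (σ x))

lemma spin_spinMul (ρ σ : ι → Bool) (x : ι) :
    spin (spinMul ρ σ x) = spin (ρ x) * spin (σ x) := by
  unfold spinMul
  cases ρ x <;> cases σ x <;> simp [spin]

lemma spinMonomial_spinMul (n : ι → ℕ) (ρ σ : ι → Bool) :
    spinMonomial n (spinMul ρ σ) = spinMonomial n ρ * spinMonomial n σ := by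
  simp [spinMonomial, spin_spinMul, mul_pow, Finset.prod_mul_distrib]

lemma abs_spinMonomial_le (n : ι → ℕ) (σ : ι → Bool) : |spinMonomial n σ| ≤ 1 := by
  rw [spinMonomial, Finset.abs_prod]
  simp [abs_pow, abs_spin]

/-- Monomials are multiplicative under `spinMul`, so each coefficient is multiplied by one plus a
sign, which is nonnegative. -/
lemma add_spinMul_mem_griffithsCone {f : (ι → Bool) → ℝ} (hf : f ∈ griffithsCone ι)
    (ρ : ι → Bool) : (fun σ => f σ + f (spinMul ρ σ)) ∈ griffithsCone ι := by
  induction hf using AddSubmonoid.closure_induction with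
  | mem f hf =>
    obtain ⟨c, n, hc, rfl⟩ := hf
    have h := (abs_le.1 (abs_spinMonomial_le n ρ)).1
    convert spinMonomial_mem (c * (1 + spinMonomial n ρ))
      (mul_nonneg hc (by linarith)) n using 2
    simp only [spinMonomial_spinMul]; ring
  | zero => simpa using const_mem_griffithsCone (ι := ι) le_rfl
  | add f₁ f₂ _ _ h₁ h₂ =>
    convert (griffithsCone ι).add_mem h₁ h₂ using 1
    funext σ; simp only [Pi.add_apply]; ring

lemma sub_spinMul_mem_griffithsCone {f : (ι → Bool) → ℝ} (hf : f ∈ griffithsCone ι)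
    (ρ : ι → Bool) : (fun σ => f σ - f (spinMul ρ σ)) ∈ griffithsCone ι := by
  induction hf using AddSubmonoid.closure_induction with
  | mem f hf =>
    obtain ⟨c, n, hc, rfl⟩ := hf
    have h := (abs_le.1 (abs_spinMonomial_le n ρ)).2
    convert spinMonomial_mem (c * (1 - spinMonomial n ρ))
      (mul_nonneg hc (by linarith)) n using 2
    simp only [spinMonomial_spinMul]; ring
  | zero => simpa using const_mem_griffithsCone (ι := ι) le_rfl
  | add f₁ f₂ _ _ h₁ h₂ =>
    convert (griffithsCone ι).add_mem h₁ h₂ using 1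
    funext σ; simp only [Pi.add_apply]; ring

/-- The second Griffiths inequality, in Ginibre's form. -/
lemma gibbsMean_mul_le {H f g : (ι → Bool) → ℝ} (hH : H ∈ griffithsCone ι)
    (hf : f ∈ griffithsCone ι) (hg : g ∈ griffithsCone ι) :
    gibbsMean H f * gibbsMean H g ≤ gibbsMean H (fun σ => f σ * g σ) := by
  have key : 0 ≤ ∑ σ, ∑ τ, (f σ - f τ) * (g σ - g τ) * Real.exp (H σ + H τ) := by
    -- Ginibre's change of variables `τ = ρσ` in the duplicated system: for fixed `ρ` every factor
    -- lies in the cone as a function of `σ`.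
    have e : ∑ σ, ∑ τ, (f σ - f τ) * (g σ - g τ) * Real.exp (H σ + H τ)
        = ∑ ρ, ∑ σ, (f σ - f (spinMul ρ σ)) * (g σ - g (spinMul ρ σ))
            * Real.exp (H σ + H (spinMul ρ σ)) := by
      rw [Finset.sum_comm (s := Finset.univ) (t := Finset.univ)
        (f := fun ρ σ => (f σ - f (spinMul ρ σ)) * (g σ - g (spinMul ρ σ))
            * Real.exp (H σ + H (spinMul ρ σ)))]
      refine Finset.sum_congr rfl fun σ _ => ?_
      refine (Function.Bijective.sum_comp (e := fun ρ => spinMul ρ σ) ?_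
        (fun τ => (f σ - f τ) * (g σ - g τ) * Real.exp (H σ + H τ))).symm
      refine Function.Involutive.bijective fun ρ => ?_
      funext x
      unfold spinMul
      cases ρ x <;> cases σ x <;> rfl
    rw [e]
    refine Finset.sum_nonneg fun ρ _ => sum_nonneg_of_mem_griffithsCone ?_
    exact mul_mem_griffithsCone (mul_mem_griffithsCone (sub_spinMul_mem_griffithsCone hf ρ)
      (sub_spinMul_mem_griffithsCone hg ρ))
      (exp_mem_griffithsCone (add_spinMul_mem_griffithsCone hH ρ))
  have expand : ∑ σ, ∑ τ, (f σ - f τ) * (g σ - g τ) * Real.exp (H σ + H τ)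
      = 2 * ((∑ σ, f σ * g σ * Real.exp (H σ)) * (∑ τ, Real.exp (H τ))
        - (∑ σ, f σ * Real.exp (H σ)) * (∑ τ, g τ * Real.exp (H τ))) := by
    have e1 : ∀ σ τ, (f σ - f τ) * (g σ - g τ) * Real.exp (H σ + H τ)
        = f σ * g σ * Real.exp (H σ) * Real.exp (H τ)
          + Real.exp (H σ) * (f τ * g τ * Real.exp (H τ))
          - f σ * Real.exp (H σ) * (g τ * Real.exp (H τ))
          - g σ * Real.exp (H σ) * (f τ * Real.exp (H τ)) := fun σ τ => by
      rw [Real.exp_add]; ring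
    simp only [e1, Finset.sum_add_distrib, Finset.sum_sub_distrib, ← Finset.sum_mul_sum]
    ring
  rw [expand] at key
  have hZ := gibbsZ_pos H
  rw [gibbsMean, gibbsMean, gibbsMean, div_mul_div_comm, div_le_div_iff₀ (by positivity) hZ]
  have : (∑ σ, f σ * Real.exp (H σ)) * (∑ τ, g τ * Real.exp (H τ))
      ≤ (∑ σ, f σ * g σ * Real.exp (H σ)) * gibbsZ H := by
    unfold gibbsZ; linarith
  nlinarith [mul_le_mul_of_nonneg_right this hZ.le]

/-- Correlations increase when ferromagnetic interactions are added. -/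
lemma gibbsMean_le_of_sub_mem {H H' f : (ι → Bool) → ℝ} (hH : H ∈ griffithsCone ι)
    (hH' : (fun σ => H' σ - H σ) ∈ griffithsCone ι) (hf : f ∈ griffithsCone ι) :
    gibbsMean H f ≤ gibbsMean H' f := by
  -- The mean under `H'` is the mean under `H` reweighted by `exp (H' - H)`, which lies in the cone.
  have h := gibbsMean_mul_le hH hf (exp_mem_griffithsCone hH')
  have e : ∀ σ, Real.exp (H' σ - H σ) * Real.exp (H σ) = Real.exp (H' σ) := fun σ => by
    rw [← Real.exp_add, sub_add_cancel]
  have hZ := gibbsZ_pos H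
  have hZ' := gibbsZ_pos H'
  rw [gibbsMean, gibbsMean, gibbsMean] at h
  simp only [mul_assoc, e] at h
  rw [← gibbsZ, div_mul_div_comm, div_le_div_iff₀ (by positivity) hZ] at h
  rw [gibbsMean, gibbsMean, div_le_div_iff₀ hZ hZ']
  nlinarith

lemma pairEnergy_mem_griffithsCone {K : ι → ι → ℝ} {h : ι → ℝ} (hK : ∀ x y, 0 ≤ K x y)
    (hh : ∀ x, 0 ≤ h x) : pairEnergy K h ∈ griffithsCone ι := by
  have e : pairEnergy K h = (fun σ => (1 / 2 : ℝ) * (∑ x, ∑ y, fun σ : ι → Bool =>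
      K x y * (spin (σ x) * spin (σ y))) σ) + ∑ x, fun σ : ι → Bool => h x * spin (σ x) := by
    funext σ
    simp [pairEnergy, mul_assoc]
  rw [e]
  refine (griffithsCone ι).add_mem (mul_mem_griffithsCone
    (const_mem_griffithsCone (by norm_num)) ?_) ?_
  · refine AddSubmonoid.sum_mem _ fun x _ => AddSubmonoid.sum_mem _ fun y _ => ?_
    exact mul_mem_griffithsCone (const_mem_griffithsCone (hK x y))
      (mul_mem_griffithsCone (spin_mem_griffithsCone x) (spin_mem_griffithsCone y))
  · refine AddSubmonoid.sum_mem _ fun x _ => ?_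
    exact mul_mem_griffithsCone (const_mem_griffithsCone (hh x)) (spin_mem_griffithsCone x)

/-- The magnetization is increasing in nonnegative couplings and fields. -/
lemma gibbsMean_spin_le_of_le {K K' : ι → ι → ℝ} {h h' : ι → ℝ} (hK : ∀ x y, 0 ≤ K x y)
    (hh : ∀ x, 0 ≤ h x) (hKK' : ∀ x y, K x y ≤ K' x y) (hhh' : ∀ x, h x ≤ h' x) (c : ι) :
    gibbsMean (pairEnergy K h) (fun σ => spin (σ c))
      ≤ gibbsMean (pairEnergy K' h') (fun σ => spin (σ c)) := by
  refine gibbsMean_le_of_sub_mem (pairEnergy_mem_griffithsCone hK hh) ?_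
    (spin_mem_griffithsCone c)
  convert pairEnergy_mem_griffithsCone (K := fun x y => K' x y - K x y)
    (h := fun x => h' x - h x) (fun x y => sub_nonneg.2 (hKK' x y))
    (fun x => sub_nonneg.2 (hhh' x)) using 1
  funext σ
  simp only [pairEnergy, sub_mul, Finset.sum_sub_distrib]
  ring

/-- Reversal of all spins and fields. -/
lemma gibbsMean_pairEnergy_neg (K : ι → ι → ℝ) (h : ι → ℝ) (c : ι) :
    gibbsMean (pairEnergy K fun x => -h x) (fun σ => spin (σ c))
      = -gibbsMean (pairEnergy K h) (fun σ => spin (σ c)) := by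
  have hb : Function.Bijective fun (σ : ι → Bool) x => !(σ x) :=
    Function.Involutive.bijective fun σ => by funext x; simp
  have e : ∀ σ : ι → Bool, pairEnergy K (fun x => -h x) (fun x => !(σ x)) = pairEnergy K h σ := by
    intro σ; simp [pairEnergy, spin_not]
  rw [gibbsMean, gibbsMean, gibbsZ, gibbsZ, ← hb.sum_comp, ← hb.sum_comp
    (g := fun σ => Real.exp (pairEnergy K (fun x => -h x) σ))]
  simp only [e, spin_not, neg_mul, Finset.sum_neg_distrib, neg_div]

end Ensemble

/-! ### Closed trails in even graphs -/

section Trails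

variable {V : Type*} [DecidableEq V]

/-- Every vertex is incident to an even number of edges of `E`. -/
def EvenEdgeSet (E : Finset (Sym2 V)) : Prop := ∀ x, Even (E.filter (x ∈ ·)).card

lemma EvenEdgeSet.sdiff {E F : Finset (Sym2 V)} (hE : EvenEdgeSet E) (hF : EvenEdgeSet F)
    (hFE : F ⊆ E) : EvenEdgeSet (E \ F) := by
  intro x
  have h : (E \ F).filter (x ∈ ·) = E.filter (x ∈ ·) \ F.filter (x ∈ ·) := by
    ext e; simp only [Finset.mem_filter, Finset.mem_sdiff]; tauto
  have hsub : F.filter (x ∈ ·) ⊆ E.filter (x ∈ ·) := Finset.filter_subset_filter _ hFE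
  rw [h, Finset.card_sdiff_of_subset hsub, Nat.even_sub (Finset.card_le_card hsub)]
  simp [hE x, hF x]

lemma card_filter_toFinset_eq_countP {l : List (Sym2 V)} (hl : l.Nodup) (x : V) :
    (l.toFinset.filter (x ∈ ·)).card = l.countP (fun e => decide (x ∈ e)) := by
  have h : l.toFinset.filter (x ∈ ·) = (l.filter fun e => decide (x ∈ e)).toFinset := by
    ext e; simp
  rw [h, List.toFinset_card_of_nodup (hl.filter _), List.countP_eq_length_filter]

lemma evenEdgeSet_of_isTrail {G : SimpleGraph V} {u : V} {p : G.Walk u u} (hp : p.IsTrail) :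
    EvenEdgeSet p.edges.toFinset := by
  intro x
  rw [card_filter_toFinset_eq_countP hp.edges_nodup, hp.even_countP_edges_iff]
  intro h; exact absurd rfl h

/-- A nonempty even edge set contains a nonempty closed trail. -/
lemma EvenEdgeSet.exists_isTrail {G : SimpleGraph V} {E : Finset (Sym2 V)}
    (hE : EvenEdgeSet E) (hG : ∀ e ∈ E, e ∈ G.edgeSet) (hne : E.Nonempty) :
    ∃ (u : V) (p : G.Walk u u), p.IsTrail ∧ 0 < p.length ∧ ∀ e ∈ p.edges, e ∈ E := by
  obtain ⟨e, he⟩ := hne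
  induction e with | _ u v
  have huv : G.Adj u v := hG _ he
  -- The lengths of the trails in `E` that end at `u`. A longest one turns out to be closed.
  let P : ℕ → Prop := fun n => ∃ (w : V) (p : G.Walk w u), p.IsTrail ∧ p.length = n ∧
    ∀ e ∈ p.edges, e ∈ E
  have hb : ∀ n, P n → n ≤ E.card := by
    rintro n ⟨w, p, hp, rfl, hpE⟩
    rw [← p.length_edges, ← List.toFinset_card_of_nodup hp.edges_nodup]
    exact Finset.card_le_card fun e he => hpE e (List.mem_toFinset.1 he)
  have h1 : P 1 := ⟨v, huv.symm.toWalk, by simp [SimpleGraph.Walk.isTrail_def], by simp,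
    by simpa [Sym2.eq_swap] using he⟩
  classical
  have hm := Nat.findGreatest_spec (P := P) (hb 1 h1) h1
  have hm1 : 1 ≤ Nat.findGreatest P E.card := Nat.le_findGreatest (hb 1 h1) h1
  obtain ⟨w, p, hp, hlen, hpE⟩ := hm
  by_cases hwu : w = u
  · subst hwu
    exact ⟨w, p, hp, by omega, hpE⟩
  · exfalso
    -- An open trail uses an odd number of edges at its first vertex `w`. The degree of `w` in `E`
    -- is even, so an unused edge remains and extends the trail.
    have hodd : ¬ Even (p.edges.toFinset.filter (w ∈ ·)).card := by
      rw [card_filter_toFinset_eq_countP hp.edges_nodup, hp.even_countP_edges_iff]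
      intro h; exact (h hwu).1 rfl
    have : ∃ e ∈ E, w ∈ e ∧ e ∉ p.edges := by
      by_contra! hcon
      apply hodd
      have : p.edges.toFinset.filter (w ∈ ·) = E.filter (w ∈ ·) := by
        ext e
        simp only [Finset.mem_filter, List.mem_toFinset]
        exact ⟨fun h => ⟨hpE e h.1, h.2⟩, fun h => ⟨hcon e h.1 h.2, h.2⟩⟩
      rw [this]; exact hE w
    obtain ⟨e, heE, hwe, hep⟩ := this
    obtain ⟨z, rfl⟩ := Sym2.mem_iff_exists.1 hwe
    have hwz : G.Adj w z := hG _ heE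
    have hP : P (Nat.findGreatest P E.card + 1) := by
      refine ⟨z, .cons hwz.symm p, ?_, by simp [hlen], ?_⟩
      · rw [SimpleGraph.Walk.isTrail_cons]
        exact ⟨hp, by rwa [Sym2.eq_swap]⟩
      · intro e he
        rw [SimpleGraph.Walk.edges_cons, List.mem_cons] at he
        rcases he with rfl | he
        · rwa [Sym2.eq_swap]
        · exact hpE e he
    have := Nat.le_findGreatest (hb _ hP) hP
    omega

end Trails

/-! ### The square lattice and its dual -/

/-- The dual edge that separates the sites `p` and `p + (1, 0)`.  The dual vertex labelled `p` is
the corner to the upper right of the site `p`. -/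
def vEdge (p : Site) : Sym2 Site := s(p, (p.1, p.2 - 1))

/-- The dual edge that separates the sites `p` and `p + (0, 1)`. -/
def hEdge (p : Site) : Sym2 Site := s(p, (p.1 - 1, p.2))

/-- The nearest-neighbour graph on the square lattice. -/
def gridGraph : SimpleGraph Site where
  Adj p q := q = (p.1 + 1, p.2) ∨ q = (p.1 - 1, p.2) ∨ q = (p.1, p.2 + 1) ∨ q = (p.1, p.2 - 1)
  symm := ⟨by
    rintro ⟨a, b⟩ ⟨c, d⟩ h
    simp only [Prod.mk.injEq] at h ⊢
    omega⟩
  loopless := ⟨by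
    rintro ⟨a, b⟩ h
    simp only [Prod.mk.injEq] at h
    omega⟩

lemma mem_gridGraph_edgeSet_iff (e : Sym2 Site) :
    e ∈ gridGraph.edgeSet ↔ (∃ p, e = vEdge p) ∨ ∃ p, e = hEdge p := by
  induction e with | _ p q
  obtain ⟨a, b⟩ := p
  obtain ⟨c, d⟩ := q
  simp only [SimpleGraph.mem_edgeSet, gridGraph, vEdge, hEdge, Sym2.eq_iff, Prod.mk.injEq,
    Prod.exists]
  constructor
  · rintro (⟨rfl, rfl⟩ | ⟨rfl, rfl⟩ | ⟨rfl, rfl⟩ | ⟨rfl, rfl⟩)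
    · exact Or.inr ⟨a + 1, d, by simp⟩
    · exact Or.inr ⟨a, d, by simp⟩
    · exact Or.inl ⟨c, b + 1, by simp⟩
    · exact Or.inl ⟨c, b, by simp⟩
  · rintro (⟨x, y, h⟩ | ⟨x, y, h⟩) <;> omega

lemma vEdge_injective : Function.Injective vEdge := by
  rintro ⟨a, b⟩ ⟨c, d⟩ h
  simp only [vEdge, Sym2.eq_iff, Prod.mk.injEq] at h ⊢
  omega

lemma hEdge_injective : Function.Injective hEdge := by
  rintro ⟨a, b⟩ ⟨c, d⟩ h
  simp only [hEdge, Sym2.eq_iff, Prod.mk.injEq] at h ⊢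
  omega

lemma vEdge_ne_hEdge (p q : Site) : vEdge p ≠ hEdge q := by
  obtain ⟨a, b⟩ := p
  obtain ⟨c, d⟩ := q
  intro h
  simp only [vEdge, hEdge, Sym2.eq_iff, Prod.mk.injEq] at h
  omega

/-- Indicator of `e ∈ E`, modulo two. -/
def edgeInd (E : Finset (Sym2 Site)) (e : Sym2 Site) : ZMod 2 := if e ∈ E then 1 else 0

lemma mem_iff_of_mem_gridGraph {e : Sym2 Site} (he : e ∈ gridGraph.edgeSet) (a b : ℤ) :
    (a, b) ∈ e ↔ e = vEdge (a, b) ∨ e = vEdge (a, b + 1) ∨ e = hEdge (a, b)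
      ∨ e = hEdge (a + 1, b) := by
  rcases (mem_gridGraph_edgeSet_iff e).1 he with ⟨⟨c, d⟩, rfl⟩ | ⟨⟨c, d⟩, rfl⟩
  · simp only [vEdge_injective.eq_iff, vEdge_ne_hEdge, or_false]
    simp only [vEdge, Sym2.mem_iff, Prod.mk.injEq]
    omega
  · simp only [hEdge_injective.eq_iff, (vEdge_ne_hEdge _ _).symm, false_or]
    simp only [hEdge, Sym2.mem_iff, Prod.mk.injEq]
    omega

/-- Evenness at a dual vertex becomes a linear relation over `ZMod 2` between the four edges around
it. -/
lemma card_filter_mem_eq {E : Finset (Sym2 Site)} (hE : ∀ e ∈ E, e ∈ gridGraph.edgeSet) (a b : ℤ) :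
    ((E.filter ((a, b) ∈ ·)).card : ZMod 2) = edgeInd E (vEdge (a, b)) + edgeInd E (vEdge (a, b + 1))
      + edgeInd E (hEdge (a, b)) + edgeInd E (hEdge (a + 1, b)) := by
  have h : E.filter ((a, b) ∈ ·)
      = ({vEdge (a, b), vEdge (a, b + 1), hEdge (a, b), hEdge (a + 1, b)} :
          Finset (Sym2 Site)).filter (· ∈ E) := by
    ext e
    simp only [Finset.mem_filter, Finset.mem_insert, Finset.mem_singleton]
    constructor
    · rintro ⟨h1, h2⟩; exact ⟨(mem_iff_of_mem_gridGraph (hE e h1) a b).1 h2, h1⟩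
    · rintro ⟨h1, h2⟩; exact ⟨h2, (mem_iff_of_mem_gridGraph (hE e h2) a b).2 h1⟩
  rw [h, Finset.card_filter]
  rw [Finset.sum_insert, Finset.sum_insert, Finset.sum_insert, Finset.sum_singleton]
  · simp [edgeInd, add_assoc]
  · simp [hEdge_injective.eq_iff]
  · simp [vEdge_ne_hEdge]
  · simp [vEdge_ne_hEdge, vEdge_injective.eq_iff]

open scoped Classical in
/-- Parity of the number of edges of `E` that cross the ray from `c` to the right. -/
def rayParity (E : Finset (Sym2 Site)) (c : Site) : ZMod 2 :=
  ((E.filter fun e => ∃ j : ℕ, e = vEdge (c.1 + j, c.2)).card : ZMod 2)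

lemma rayParity_eq_zero {E : Finset (Sym2 Site)} {c : Site}
    (h : ∀ j : ℕ, vEdge (c.1 + j, c.2) ∉ E) : rayParity E c = 0 := by
  classical
  rw [rayParity, Finset.filter_eq_empty_iff.2, Finset.card_empty, Nat.cast_zero]
  rintro e he ⟨j, rfl⟩
  exact h j he

lemma rayParity_sdiff {E F : Finset (Sym2 Site)} (hFE : F ⊆ E) (c : Site) :
    rayParity (E \ F) c = rayParity E c - rayParity F c := by
  classical
  set P : Sym2 Site → Prop := fun e => ∃ j : ℕ, e = vEdge (c.1 + j, c.2) with hP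
  have h : (E \ F).filter P = E.filter P \ F.filter P := by
    ext e; simp only [Finset.mem_filter, Finset.mem_sdiff]; tauto
  have hsub : F.filter P ⊆ E.filter P := Finset.filter_subset_filter _ hFE
  rw [rayParity, rayParity, rayParity]
  convert congrArg (Nat.cast (R := ZMod 2)) (Finset.card_sdiff_of_subset hsub) using 1
  · rw [← h]
  · rw [Nat.cast_sub (Finset.card_le_card hsub)]

/-- The rays from two horizontally adjacent sites differ in a single dual edge. -/
lemma rayParity_step (E : Finset (Sym2 Site)) (a b : ℤ) :
    rayParity E (a, b) = edgeInd E (vEdge (a, b)) + rayParity E (a + 1, b) := by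
  classical
  have h : (E.filter fun e => ∃ j : ℕ, e = vEdge (a + j, b))
      = (E.filter fun e => e = vEdge (a, b)) ∪ (E.filter fun e => ∃ j : ℕ, e = vEdge (a + 1 + j, b)) := by
    ext e
    simp only [Finset.mem_filter, Finset.mem_union, ← and_or_left]
    refine and_congr_right fun _ => ⟨?_, ?_⟩
    · rintro ⟨j, rfl⟩
      cases j with
      | zero => left; simp
      | succ j => right; exact ⟨j, by push_cast; congr 2; ring⟩
    · rintro (rfl | ⟨j, rfl⟩)
      · exact ⟨0, by simp⟩
      · exact ⟨j + 1, by push_cast; congr 2; ring⟩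
  have hd : Disjoint (E.filter fun e => e = vEdge (a, b))
      (E.filter fun e => ∃ j : ℕ, e = vEdge (a + 1 + j, b)) := by
    rw [Finset.disjoint_filter]
    rintro e _ rfl ⟨j, hj⟩
    have := congrArg Prod.fst (vEdge_injective hj)
    simp only at this
    omega
  rw [rayParity, rayParity]
  simp only
  rw [h, Finset.card_union_of_disjoint hd, Nat.cast_add, Finset.filter_eq']
  congr 1
  unfold edgeInd
  split_ifs <;> simp

lemma exists_bound (E : Finset (Sym2 Site)) :
    ∃ N : ℕ, ∀ e ∈ E, ∀ p ∈ e, |p.1| < N ∧ |p.2| < N := by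
  classical
  let S : Finset Site := E.biUnion fun e => e.toFinset
  refine ⟨(∑ p ∈ S, (p.1.natAbs + p.2.natAbs)) + 1, fun e he p hp => ?_⟩
  have hpS : p ∈ S := Finset.mem_biUnion.2 ⟨e, he, Sym2.mem_toFinset.2 hp⟩
  have := Finset.single_le_sum (f := fun p : Site => p.1.natAbs + p.2.natAbs)
    (fun _ _ => Nat.zero_le _) hpS
  constructor <;> rw [Int.abs_eq_natAbs] <;> exact_mod_cast by omega

/-- Far to the right all terms vanish. Moving one column to the left changes the identity by the
degree of a dual vertex, which is zero modulo two. Together with `rayParity_step` this makes the ray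
parity the indicator of an interior with boundary `E`. -/
lemma rayParity_vertical {E : Finset (Sym2 Site)} (hE : ∀ e ∈ E, e ∈ gridGraph.edgeSet)
    (hev : EvenEdgeSet E) (a b : ℤ) :
    rayParity E (a, b) + rayParity E (a, b + 1) = edgeInd E (hEdge (a, b)) := by
  obtain ⟨N, hN⟩ := exists_bound E
  have far : ∀ a : ℤ, N ≤ a → ∀ b, rayParity E (a, b) + rayParity E (a, b + 1)
      = edgeInd E (hEdge (a, b)) := by
    intro a ha b
    have h1 : ∀ b, rayParity E (a, b) = 0 := fun b => rayParity_eq_zero fun j hj => by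
      have := (hN _ hj (a + j, b) (by simp [vEdge])).1
      rw [abs_lt] at this; omega
    have h2 : hEdge (a, b) ∉ E := fun h => by
      have := (hN _ h (a, b) (by simp [hEdge])).1
      rw [abs_lt] at this; omega
    simp [h1, edgeInd, h2]
  have main : ∀ k : ℕ, ∀ a : ℤ, N - k ≤ a → ∀ b, rayParity E (a, b) + rayParity E (a, b + 1)
      = edgeInd E (hEdge (a, b)) := by
    intro k
    induction k with
    | zero => intro a ha b; exact far a (by simpa using ha) b
    | succ k ih =>
      intro a ha b
      have h1 := ih (a + 1) (by push_cast at ha; omega) b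
      have h2 := card_filter_mem_eq hE a b
      rw [(ZMod.natCast_eq_zero_iff_even).2 (hev (a, b))] at h2
      rw [rayParity_step E a b, rayParity_step E a (b + 1)]
      have two : ∀ x : ZMod 2, x + x = 0 := by decide
      linear_combination h1 - h2 - two (edgeInd E (hEdge (a, b)))
  exact main (N - a).toNat a (by omega) b

/-- An even edge set with odd ray parity contains a closed trail with odd ray parity. -/
lemma EvenEdgeSet.exists_isTrail_rayParity {E : Finset (Sym2 Site)} (hE : EvenEdgeSet E)
    (hG : ∀ e ∈ E, e ∈ gridGraph.edgeSet) {c : Site} (hc : rayParity E c = 1) :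
    ∃ (u : Site) (p : gridGraph.Walk u u), p.IsTrail ∧ p.edges.toFinset ⊆ E
      ∧ rayParity p.edges.toFinset c = 1 := by
  induction hn : E.card using Nat.strong_induction_on generalizing E with
  | _ n ih =>
  have hne : E.Nonempty := by
    rw [Finset.nonempty_iff_ne_empty]
    rintro rfl
    simp [rayParity] at hc
  obtain ⟨u, p, hp, hl, hpE⟩ := hE.exists_isTrail hG hne
  have hsub : p.edges.toFinset ⊆ E := fun e he => hpE e (List.mem_toFinset.1 he)
  -- If the trail has even parity, removing it leaves a smaller even set of the same odd parity.
  by_cases h1 : rayParity p.edges.toFinset c = 1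
  · exact ⟨u, p, hp, hsub, h1⟩
  · have h0 : rayParity p.edges.toFinset c = 0 := by
      generalize rayParity p.edges.toFinset c = z at h1
      revert z; decide
    have hcard : 0 < p.edges.toFinset.card := by
      rw [List.toFinset_card_of_nodup hp.edges_nodup, p.length_edges]; exact hl
    obtain ⟨v, q, hq, hqE, hqc⟩ := ih (E \ p.edges.toFinset).card
      (by rw [Finset.card_sdiff_of_subset hsub, ← hn]
          have := Finset.card_le_card hsub; omega)
      (hE.sdiff (evenEdgeSet_of_isTrail hp) hsub)
      (fun e he => hG e (Finset.mem_sdiff.1 he).1)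
      (by rw [rayParity_sdiff hsub, hc, h0, sub_zero]) rfl
    exact ⟨v, q, hq, hqE.trans Finset.sdiff_subset, hqc⟩

/-- The edge sets of the walks of length `n` from `q` in the square lattice. -/
def walkEdgeSets : ℕ → Site → Finset (Finset (Sym2 Site))
  | 0, _ => {∅}
  | n + 1, q =>
    (walkEdgeSets n (q.1 + 1, q.2)).image (insert s(q, (q.1 + 1, q.2)))
    ∪ (walkEdgeSets n (q.1 - 1, q.2)).image (insert s(q, (q.1 - 1, q.2)))
    ∪ ((walkEdgeSets n (q.1, q.2 + 1)).image (insert s(q, (q.1, q.2 + 1)))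
    ∪ (walkEdgeSets n (q.1, q.2 - 1)).image (insert s(q, (q.1, q.2 - 1))))

lemma card_walkEdgeSets_le (n : ℕ) (q : Site) : (walkEdgeSets n q).card ≤ 4 ^ n := by
  induction n generalizing q with
  | zero => simp [walkEdgeSets]
  | succ n ih =>
    rw [walkEdgeSets]
    have h1 := Finset.card_union_le ((walkEdgeSets n (q.1 + 1, q.2)).image
      (insert s(q, (q.1 + 1, q.2)))
      ∪ (walkEdgeSets n (q.1 - 1, q.2)).image (insert s(q, (q.1 - 1, q.2))))
      ((walkEdgeSets n (q.1, q.2 + 1)).image (insert s(q, (q.1, q.2 + 1)))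
      ∪ (walkEdgeSets n (q.1, q.2 - 1)).image (insert s(q, (q.1, q.2 - 1))))
    have h2 := Finset.card_union_le ((walkEdgeSets n (q.1 + 1, q.2)).image
      (insert s(q, (q.1 + 1, q.2))))
      ((walkEdgeSets n (q.1 - 1, q.2)).image (insert s(q, (q.1 - 1, q.2))))
    have h3 := Finset.card_union_le ((walkEdgeSets n (q.1, q.2 + 1)).image
      (insert s(q, (q.1, q.2 + 1))))
      ((walkEdgeSets n (q.1, q.2 - 1)).image (insert s(q, (q.1, q.2 - 1))))
    have h4 : ∀ (r : Site) e, ((walkEdgeSets n r).image (insert e)).card ≤ 4 ^ n :=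
      fun r e => Finset.card_image_le.trans (ih r)
    have := h4 (q.1 + 1, q.2) s(q, (q.1 + 1, q.2))
    have := h4 (q.1 - 1, q.2) s(q, (q.1 - 1, q.2))
    have := h4 (q.1, q.2 + 1) s(q, (q.1, q.2 + 1))
    have := h4 (q.1, q.2 - 1) s(q, (q.1, q.2 - 1))
    rw [pow_succ]
    omega

lemma edges_mem_walkEdgeSets {q r : Site} (p : gridGraph.Walk q r) :
    p.edges.toFinset ∈ walkEdgeSets p.length q := by
  induction p with
  | nil => simp [walkEdgeSets]
  | @cons u v w h p ih =>
    simp only [SimpleGraph.Walk.edges_cons, List.toFinset_cons, SimpleGraph.Walk.length_cons,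
      walkEdgeSets, Finset.mem_union, Finset.mem_image]
    rcases h with rfl | rfl | rfl | rfl
    · exact Or.inl (Or.inl ⟨_, ih, rfl⟩)
    · exact Or.inl (Or.inr ⟨_, ih, rfl⟩)
    · exact Or.inr (Or.inl ⟨_, ih, rfl⟩)
    · exact Or.inr (Or.inr ⟨_, ih, rfl⟩)

lemma le_fst_of_mem_support {q r : Site} (p : gridGraph.Walk q r) :
    ∀ z ∈ p.support, q.1 - p.length ≤ z.1 := by
  induction p with
  | nil => simp
  | @cons u v w h p ih =>
    intro z hz
    rw [SimpleGraph.Walk.support_cons, List.mem_cons] at hz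
    rcases hz with rfl | hz
    · simp only [SimpleGraph.Walk.length_cons]; push_cast; omega
    · have := ih z hz
      simp only [SimpleGraph.Walk.length_cons]
      push_cast
      rcases h with rfl | rfl | rfl | rfl <;> simp only at this <;> omega

/-- A closed trail around `c` may be started at a crossing of the ray from `c` that is closer than
its length. -/
lemma exists_mem_walkEdgeSets {u : Site} {p : gridGraph.Walk u u} (hp : p.IsTrail) {c : Site}
    (hc : rayParity p.edges.toFinset c = 1) :
    ∃ j < p.length, p.edges.toFinset ∈ walkEdgeSets p.length (c.1 + (j : ℕ), c.2) := by
  have hgrid : ∀ e ∈ p.edges.toFinset, e ∈ gridGraph.edgeSet := fun e he =>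
    p.edges_subset_edgeSet (List.mem_toFinset.1 he)
  have h1 : ∃ j : ℕ, vEdge (c.1 + j, c.2) ∈ p.edges.toFinset := by
    by_contra! hcon
    rw [rayParity_eq_zero hcon] at hc
    exact zero_ne_one hc
  obtain ⟨j, hj⟩ := h1
  have hsupp : ((c.1 + j, c.2) : Site) ∈ p.support :=
    p.fst_mem_support_of_mem_edges (List.mem_toFinset.1 hj)
  set p' := p.rotate _ hsupp with hp'
  have hlen : p'.length = p.length := by
    rw [← SimpleGraph.Walk.length_edges, ← SimpleGraph.Walk.length_edges]
    exact (p.rotate_edges _ hsupp).perm.length_eq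
  have hedges : p'.edges.toFinset = p.edges.toFinset := by
    ext e
    simp only [List.mem_toFinset]
    exact (p.rotate_edges _ hsupp).perm.mem_iff
  have hmem := edges_mem_walkEdgeSets p'
  rw [hlen, hedges] at hmem
  refine ⟨j, ?_, hmem⟩
  -- A closed trail through column `c.1 + j` that is no longer than `j` cannot reach column `c.1 -
  -- 1`. It then contains no dual edge that separates two successive sites of the column of `c`, so
  -- the ray parity stays 1 all the way up this column, although it vanishes above the trail.
  by_contra! hjn
  have hno : ∀ b : ℤ, hEdge (c.1, b) ∉ p.edges.toFinset := by
    intro b hb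
    rw [← hedges, List.mem_toFinset] at hb
    have h2 : ((c.1 - 1, b) : Site) ∈ p'.support := by
      refine p'.snd_mem_support_of_mem_edges (t := (c.1, b)) ?_
      exact hb
    have := le_fst_of_mem_support p' _ h2
    rw [hlen] at this
    simp only at this
    omega
  obtain ⟨N, hN⟩ := exists_bound p.edges.toFinset
  have hup : ∀ t : ℕ, rayParity p.edges.toFinset (c.1, c.2 + t) = 1 := by
    intro t
    induction t with
    | zero => simpa using hc
    | succ t ih =>
      have := rayParity_vertical hgrid (evenEdgeSet_of_isTrail hp) c.1 (c.2 + t)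
      rw [edgeInd, if_neg (hno _), ih] at this
      push_cast
      rw [← add_assoc]
      generalize rayParity p.edges.toFinset (c.1, c.2 + t + 1) = z at this
      revert this; revert z; decide
  have htop := hup (N + c.2.natAbs)
  rw [rayParity_eq_zero] at htop
  · exact zero_ne_one htop
  · intro i hi
    have := (hN _ hi (c.1 + i, c.2 + ((N + c.2.natAbs : ℕ) : ℤ)) (by simp [vEdge])).2
    simp only at this
    rw [Nat.cast_add, abs_lt] at this
    omega

/-! ### The Peierls argument -/

/-- The box `[0, M)²`. -/
def InBox (M : ℕ) (p : Site) : Prop := (0 ≤ p.1 ∧ p.1 < M) ∧ 0 ≤ p.2 ∧ p.2 < M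

/-- The dual edges that separate unequal spins of a configuration that is constant off the box. -/
def domainWall (M : ℕ) (s : Config) : Finset (Sym2 Site) :=
  ((Finset.Icc (-1 : ℤ) M ×ˢ Finset.Icc (-1 : ℤ) M).filter
      fun p => s p ≠ s (p.1 + 1, p.2)).image vEdge ∪
  ((Finset.Icc (-1 : ℤ) M ×ˢ Finset.Icc (-1 : ℤ) M).filter
      fun p => s p ≠ s (p.1, p.2 + 1)).image hEdge

variable {M : ℕ} {s : Config}

lemma domainWall_subset_gridGraph (e : Sym2 Site) (he : e ∈ domainWall M s) :
    e ∈ gridGraph.edgeSet := by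
  rw [mem_gridGraph_edgeSet_iff]
  rw [domainWall, Finset.mem_union, Finset.mem_image, Finset.mem_image] at he
  rcases he with ⟨p, _, rfl⟩ | ⟨p, _, rfl⟩
  · exact Or.inl ⟨p, rfl⟩
  · exact Or.inr ⟨p, rfl⟩

/-- The margin from `-1` to `M` loses no edge: a pair of unequal neighbours has a member in the box.
-/
lemma vEdge_mem_domainWall (hs : ∀ p, ¬ InBox M p → s p = true) (a b : ℤ) :
    vEdge (a, b) ∈ domainWall M s ↔ s (a, b) ≠ s (a + 1, b) := by
  simp only [domainWall, Finset.mem_union, Finset.mem_image, Finset.mem_filter,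
    Finset.mem_product, Finset.mem_Icc, vEdge_injective.eq_iff, (vEdge_ne_hEdge _ _).symm,
    and_false, exists_false, or_false, exists_eq_right, and_iff_right_iff_imp]
  intro h
  by_contra hcon
  apply h
  rw [hs, hs]
  · unfold InBox; simp only; omega
  · unfold InBox; simp only; omega

lemma hEdge_mem_domainWall (hs : ∀ p, ¬ InBox M p → s p = true) (a b : ℤ) :
    hEdge (a, b) ∈ domainWall M s ↔ s (a, b) ≠ s (a, b + 1) := by
  simp only [domainWall, Finset.mem_union, Finset.mem_image, Finset.mem_filter,
    Finset.mem_product, Finset.mem_Icc, hEdge_injective.eq_iff, vEdge_ne_hEdge,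
    and_false, exists_false, false_or, exists_eq_right, and_iff_right_iff_imp]
  intro h
  by_contra hcon
  apply h
  rw [hs, hs]
  · unfold InBox; simp only; omega
  · unfold InBox; simp only; omega

/-- The value of a spin modulo two. -/
def spinParity (b : Bool) : ZMod 2 := if b then 0 else 1

lemma ite_ne_eq_spinParity (b c : Bool) :
    (if b ≠ c then 1 else 0 : ZMod 2) = spinParity b + spinParity c := by
  revert b c; decide

/-- On a circuit around a dual vertex each of the four spins is met twice, so the number of sign
changes is even. -/
lemma evenEdgeSet_domainWall (hs : ∀ p, ¬ InBox M p → s p = true) :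
    EvenEdgeSet (domainWall M s) := by
  rintro ⟨a, b⟩
  rw [← ZMod.natCast_eq_zero_iff_even, card_filter_mem_eq domainWall_subset_gridGraph]
  simp only [edgeInd, vEdge_mem_domainWall hs, hEdge_mem_domainWall hs, ite_ne_eq_spinParity]
  generalize s (a, b) = w
  generalize s (a + 1, b) = x
  generalize s (a, b + 1) = y
  generalize s (a + 1, b + 1) = z
  revert w x y z; decide

/-- Along the ray the spin ends at plus, and every crossing of the wall is one sign change. -/
lemma rayParity_domainWall (hs : ∀ p, ¬ InBox M p → s p = true) (a b : ℤ) :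
    rayParity (domainWall M s) (a, b) = spinParity (s (a, b)) := by
  have main : ∀ k : ℕ, ∀ a : ℤ, M - k ≤ a →
      rayParity (domainWall M s) (a, b) = spinParity (s (a, b)) := by
    intro k
    induction k with
    | zero =>
      intro a ha
      rw [rayParity_eq_zero, hs]
      · rfl
      · unfold InBox; simp only; push_cast at ha; omega
      · intro j
        rw [vEdge_mem_domainWall hs, hs, hs]
        · simp
        · unfold InBox; simp only; push_cast at ha; omega
        · unfold InBox; simp only; push_cast at ha; omega
    | succ k ih =>
      intro a ha
      rw [rayParity_step, ih (a + 1) (by push_cast at ha; omega), edgeInd]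
      simp only [vEdge_mem_domainWall hs, ite_ne_eq_spinParity]
      generalize s (a, b) = x
      generalize s (a + 1, b) = y
      revert x y; decide
  exact main (M - a).toNat a (by omega)

/-- The set enclosed by an even edge set. -/
def enclosed (γ : Finset (Sym2 Site)) : Config := fun p => decide (rayParity γ p = 1)

/-- Above, below and to the right of the box the ray meets no wall. To the left of it the parity is
constant along the column, which leads up to a row above the box. -/
lemma enclosed_eq_false (hs : ∀ p, ¬ InBox M p → s p = true) {γ : Finset (Sym2 Site)}
    (hγ : EvenEdgeSet γ) (hsub : γ ⊆ domainWall M s) (p : Site) (hp : ¬ InBox M p) :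
    enclosed γ p = false := by
  obtain ⟨a, b⟩ := p
  have hgrid : ∀ e ∈ γ, e ∈ gridGraph.edgeSet := fun e he =>
    domainWall_subset_gridGraph e (hsub he)
  have hrow : ∀ a b : ℤ, (b < 0 ∨ (M : ℤ) ≤ b ∨ (M : ℤ) ≤ a) → rayParity γ (a, b) = 0 := by
    intro a b h
    refine rayParity_eq_zero fun j hj => ?_
    have := (vEdge_mem_domainWall hs _ _).1 (hsub hj)
    apply this
    rw [hs, hs]
    · unfold InBox; simp only; omega
    · unfold InBox; simp only; omega
  suffices h : rayParity γ (a, b) = 0 by simp [enclosed, h]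
  by_cases hout : b < 0 ∨ (M : ℤ) ≤ b ∨ (M : ℤ) ≤ a
  · exact hrow a b hout
  · have ha : a < 0 := by unfold InBox at hp; simp only at hp; omega
    have hcol : ∀ k : ℕ, ∀ b : ℤ, M - k ≤ b → rayParity γ (a, b) = 0 := by
      intro k
      induction k with
      | zero => intro b hb; exact hrow a b (by push_cast at hb; omega)
      | succ k ih =>
        intro b hb
        have h1 := rayParity_vertical hgrid hγ a b
        rw [ih (b + 1) (by push_cast at hb; omega), add_zero, edgeInd, if_neg] at h1
        · exact h1
        · intro hmem
          apply (hEdge_mem_domainWall hs _ _).1 (hsub hmem)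
          rw [hs, hs]
          · unfold InBox; simp only; omega
          · unfold InBox; simp only; omega
    exact hcol (M - b).toNat b (by omega)

/-- Reversing the spins enclosed by a part of the domain wall removes that part. -/
lemma domainWall_xor_enclosed (hs : ∀ p, ¬ InBox M p → s p = true) {γ : Finset (Sym2 Site)}
    (hγ : EvenEdgeSet γ) (hsub : γ ⊆ domainWall M s) :
    domainWall M (fun p => xor (s p) (enclosed γ p)) = domainWall M s \ γ := by
  have hgrid : ∀ e ∈ γ, e ∈ gridGraph.edgeSet := fun e he =>
    domainWall_subset_gridGraph e (hsub he)
  have hs' : ∀ p, ¬ InBox M p → xor (s p) (enclosed γ p) = true := fun p hp => by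
    rw [hs p hp, enclosed_eq_false hs hγ hsub p hp]; rfl
  have bool1 : ∀ (x y : Bool) (u v w : ZMod 2), u = w + v → (w = 1 → x ≠ y) →
      (xor x (decide (u = 1)) ≠ xor y (decide (v = 1)) ↔ x ≠ y ∧ w ≠ 1) := by decide
  have bool2 : ∀ (x y : Bool) (u v w : ZMod 2), u + v = w → (w = 1 → x ≠ y) →
      (xor x (decide (u = 1)) ≠ xor y (decide (v = 1)) ↔ x ≠ y ∧ w ≠ 1) := by decide
  have ind : ∀ e, edgeInd γ e = 1 ↔ e ∈ γ := fun e => by unfold edgeInd; split_ifs <;> simp [*]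
  ext e
  by_cases he : e ∈ gridGraph.edgeSet
  · rcases (mem_gridGraph_edgeSet_iff e).1 he with ⟨⟨a, b⟩, rfl⟩ | ⟨⟨a, b⟩, rfl⟩
    · rw [vEdge_mem_domainWall hs', Finset.mem_sdiff, vEdge_mem_domainWall hs, ← ind]
      refine bool1 _ _ _ _ _ (rayParity_step γ a b) fun h => ?_
      exact (vEdge_mem_domainWall hs _ _).1 (hsub ((ind _).1 h))
    · rw [hEdge_mem_domainWall hs', Finset.mem_sdiff, hEdge_mem_domainWall hs, ← ind]
      refine bool2 _ _ _ _ _ (rayParity_vertical hgrid hγ a b) fun h => ?_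
      exact (hEdge_mem_domainWall hs _ _).1 (hsub ((ind _).1 h))
  · refine iff_of_false (fun h => he (domainWall_subset_gridGraph e h)) fun h => ?_
    exact he (domainWall_subset_gridGraph e (Finset.mem_sdiff.1 h).1)

/-- Only serves to make the sum over contour lengths finite. -/
lemma card_domainWall_le (s : Config) : (domainWall M s).card ≤ 2 * (M + 2) ^ 2 := by
  have h : ∀ (P : Site → Prop) [DecidablePred P] (f : Site → Sym2 Site),
      (((Finset.Icc (-1 : ℤ) M ×ˢ Finset.Icc (-1 : ℤ) M).filter P).image f).card
        ≤ (M + 2) ^ 2 := by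
    intro P _ f
    refine Finset.card_image_le.trans ((Finset.card_filter_le _ _).trans ?_)
    rw [Finset.card_product, Int.card_Icc, sq]
    have : ((M : ℤ) + 1 - -1).toNat = M + 2 := by omega
    rw [this]
  refine (Finset.card_union_le _ _).trans ?_
  have h1 := h (fun p => s p ≠ s (p.1 + 1, p.2)) vEdge
  have h2 := h (fun p => s p ≠ s (p.1, p.2 + 1)) hEdge
  omega

/-- A configuration with a minus spin at `c` has a closed trail around `c` in its domain wall. -/
lemma exists_trail_of_minus (hs : ∀ p, ¬ InBox M p → s p = true) {c : Site} (hc : s c = false) :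
    ∃ n ∈ Finset.Icc 1 (2 * (M + 2) ^ 2), ∃ j ∈ Finset.range n,
      ∃ γ ∈ walkEdgeSets n (c.1 + (j : ℕ), c.2), EvenEdgeSet γ ∧ γ.card = n ∧ γ ⊆ domainWall M s := by
  have h1 : rayParity (domainWall M s) c = 1 := by
    have := rayParity_domainWall hs c.1 c.2
    rw [Prod.mk.eta, hc] at this
    exact this
  obtain ⟨u, p, hp, hsub, hpc⟩ := (evenEdgeSet_domainWall hs).exists_isTrail_rayParity
    domainWall_subset_gridGraph h1
  obtain ⟨j, hj, hmem⟩ := exists_mem_walkEdgeSets hp hpc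
  have hcard : p.edges.toFinset.card = p.length := by
    rw [List.toFinset_card_of_nodup hp.edges_nodup, p.length_edges]
  refine ⟨p.length, Finset.mem_Icc.2 ⟨by omega, ?_⟩, j, Finset.mem_range.2 hj, _, hmem,
    evenEdgeSet_of_isTrail hp, hcard, hsub⟩
  rw [← hcard]
  exact (Finset.card_le_card hsub).trans (card_domainWall_le s)

/-- **Peierls' estimate**: at low temperature the nearest-neighbour Ising model in a box with plus
boundary condition is magnetized, uniformly in the box. -/
theorem half_le_gibbsMean_of_peierls {ι : Type*} [Fintype ι] [DecidableEq ι] (M : ℕ)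
    (ext : (ι → Bool) → Config) (hout : ∀ σ p, ¬ InBox M p → ext σ p = true)
    (hflip : ∀ w : Config, (∀ p, ¬ InBox M p → w p = false) →
      ∃ Φ : (ι → Bool) → (ι → Bool), Function.Injective Φ ∧
        ∀ σ p, ext (Φ σ) p = xor (ext σ p) (w p))
    (G : (ι → Bool) → ℝ) (C K : ℝ) (hG : ∀ σ, G σ = C - 2 * K * (domainWall M (ext σ)).card)
    (hK : 40 * Real.exp (-2 * K) ≤ 1) (c : Site) :
    1 / 2 ≤ gibbsMean G (fun σ => spin (ext σ c)) := by
  classical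
  set Z := gibbsZ G with hZ
  have hZpos : 0 < Z := gibbsZ_pos G
  set x := Real.exp (-2 * K) with hx
  have hx0 : 0 < x := Real.exp_pos _
  -- Reversing the spins enclosed by `γ` is injective and removes exactly `γ` from the wall, so it
  -- gains a factor `x⁻¹` for each edge of `γ`.
  have hone : ∀ γ : Finset (Sym2 Site), EvenEdgeSet γ →
      ∑ σ ∈ Finset.univ.filter (fun σ => γ ⊆ domainWall M (ext σ)), Real.exp (G σ)
        ≤ x ^ γ.card * Z := by
    intro γ hγ
    by_cases hne : ∃ σ, γ ⊆ domainWall M (ext σ)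
    · obtain ⟨σ₀, hσ₀⟩ := hne
      obtain ⟨Φ, hΦ, hΦx⟩ := hflip (enclosed γ) (enclosed_eq_false (hout σ₀) hγ hσ₀)
      have hterm : ∀ σ ∈ Finset.univ.filter (fun σ => γ ⊆ domainWall M (ext σ)),
          Real.exp (G σ) = x ^ γ.card * Real.exp (G (Φ σ)) := by
        intro σ hσ
        have hsub := (Finset.mem_filter.1 hσ).2
        have e1 : ext (Φ σ) = fun p => xor (ext σ p) (enclosed γ p) := funext (hΦx σ)
        rw [hG, hG, e1, domainWall_xor_enclosed (hout σ) hγ hsub,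
          Finset.card_sdiff_of_subset hsub, Nat.cast_sub (Finset.card_le_card hsub), hx,
          ← Real.exp_nat_mul, ← Real.exp_add]
        congr 1; ring
      rw [Finset.sum_congr rfl hterm, ← Finset.mul_sum]
      refine mul_le_mul_of_nonneg_left ?_ (by positivity)
      rw [← Finset.sum_image (f := fun σ => Real.exp (G σ)) (g := Φ) (hΦ.injOn)]
      exact Finset.sum_le_sum_of_subset_of_nonneg (Finset.subset_univ _)
        fun _ _ _ => (Real.exp_pos _).le
    · rw [Finset.filter_eq_empty_iff.2 (fun σ _ h => hne ⟨σ, h⟩), Finset.sum_empty]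
      positivity
  have hbad : ∑ σ ∈ Finset.univ.filter (fun σ => ext σ c = false), Real.exp (G σ) ≤ 1 / 4 * Z := by
    -- Union bound over the length of a trail around `c`, its crossing point with the ray from `c`,
    -- and its edge set.
    have hle : ∑ σ ∈ Finset.univ.filter (fun σ => ext σ c = false), Real.exp (G σ)
        ≤ ∑ n ∈ Finset.Icc 1 (2 * (M + 2) ^ 2), ∑ j ∈ Finset.range n,
          ∑ γ ∈ (walkEdgeSets n (c.1 + (j : ℕ), c.2)).filter
            (fun γ => EvenEdgeSet γ ∧ γ.card = n),
          ∑ σ ∈ Finset.univ.filter (fun σ => γ ⊆ domainWall M (ext σ)), Real.exp (G σ) := by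
      simp only [Finset.sum_filter _ (fun σ => Real.exp (G σ))]
      have e : ∀ n j, ∑ γ ∈ (walkEdgeSets n (c.1 + (j : ℕ), c.2)).filter
            (fun γ => EvenEdgeSet γ ∧ γ.card = n), ∑ σ,
            (if γ ⊆ domainWall M (ext σ) then Real.exp (G σ) else 0)
          = ∑ σ, ∑ γ ∈ (walkEdgeSets n (c.1 + (j : ℕ), c.2)).filter
            (fun γ => EvenEdgeSet γ ∧ γ.card = n),
            (if γ ⊆ domainWall M (ext σ) then Real.exp (G σ) else 0) :=
        fun n j => Finset.sum_comm
      simp only [e]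
      simp only [Finset.sum_comm (t := (Finset.univ : Finset (ι → Bool)))]
      refine Finset.sum_le_sum fun σ _ => ?_
      have nn : ∀ γ : Finset (Sym2 Site),
          0 ≤ (if γ ⊆ domainWall M (ext σ) then Real.exp (G σ) else 0) := fun γ => by
        split_ifs <;> positivity
      split_ifs with h
      · obtain ⟨n, hn, j, hj, γ, hγ, hev, hcard, hsub⟩ := exists_trail_of_minus (hout σ) h
        refine le_trans ?_ (Finset.single_le_sum (fun n _ => Finset.sum_nonneg fun j _ =>
          Finset.sum_nonneg fun γ _ => nn γ) hn)
        refine le_trans ?_ (Finset.single_le_sum (fun j _ =>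
          Finset.sum_nonneg fun γ _ => nn γ) hj)
        refine le_trans ?_ (Finset.single_le_sum (fun γ _ => nn γ)
          (Finset.mem_filter.2 ⟨hγ, hev, hcard⟩))
        rw [if_pos hsub]
      · exact Finset.sum_nonneg fun n _ => Finset.sum_nonneg fun j _ =>
          Finset.sum_nonneg fun γ _ => nn γ
    refine hle.trans ?_
    have hn : ∀ n ∈ Finset.Icc 1 (2 * (M + 2) ^ 2), ∑ j ∈ Finset.range n,
          ∑ γ ∈ (walkEdgeSets n (c.1 + (j : ℕ), c.2)).filter
            (fun γ => EvenEdgeSet γ ∧ γ.card = n),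
          ∑ σ ∈ Finset.univ.filter (fun σ => γ ⊆ domainWall M (ext σ)), Real.exp (G σ)
        ≤ (1 / 5) ^ n * Z := by
      intro n _
      have hj : ∀ j ∈ Finset.range n, ∑ γ ∈ (walkEdgeSets n (c.1 + (j : ℕ), c.2)).filter
            (fun γ => EvenEdgeSet γ ∧ γ.card = n),
          ∑ σ ∈ Finset.univ.filter (fun σ => γ ⊆ domainWall M (ext σ)), Real.exp (G σ)
          ≤ 4 ^ n * (x ^ n * Z) := by
        intro j _
        refine (Finset.sum_le_card_nsmul _ _ (x ^ n * Z) fun γ hγ => ?_).trans ?_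
        · obtain ⟨_, hev, hcard⟩ := Finset.mem_filter.1 hγ
          rw [← hcard]; exact hone γ hev
        · rw [nsmul_eq_mul]
          refine mul_le_mul_of_nonneg_right ?_ (by positivity)
          have := (Finset.card_filter_le (walkEdgeSets n (c.1 + (j : ℕ), c.2))
            (fun γ => EvenEdgeSet γ ∧ γ.card = n)).trans (card_walkEdgeSets_le n _)
          exact_mod_cast this
      refine (Finset.sum_le_card_nsmul _ _ _ hj).trans ?_
      rw [Finset.card_range, nsmul_eq_mul]
      -- With at most `n` starting points and `4 ^ n` edge sets for each, length `n` contributes at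
      -- most `(8 * x) ^ n`. The assumption `40 * x ≤ 1` makes this `(1 / 5) ^ n`, and the geometric
      -- series from `n = 1` is bounded by 1/4.
      have h2n : (n : ℝ) ≤ 2 ^ n := by exact_mod_cast Nat.lt_two_pow_self.le
      calc (n : ℝ) * (4 ^ n * (x ^ n * Z)) ≤ 2 ^ n * (4 ^ n * (x ^ n * Z)) := by gcongr
        _ = (8 * x) ^ n * Z := by
          rw [mul_pow, show (8 : ℝ) = 2 * 4 by norm_num, mul_pow]; ring
        _ ≤ (1 / 5) ^ n * Z := by gcongr; linarith
    refine (Finset.sum_le_sum hn).trans ?_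
    rw [← Finset.sum_mul]
    refine mul_le_mul_of_nonneg_right ?_ hZpos.le
    have hsum : ∀ N : ℕ, ∑ n ∈ Finset.Icc 1 N, (1 / 5 : ℝ) ^ n ≤ 1 / 4 - 1 / 4 * (1 / 5) ^ N := by
      intro N
      induction N with
      | zero => simp
      | succ N ih =>
        rw [Finset.sum_Icc_succ_top (by omega), pow_succ]
        linarith
    refine (hsum _).trans (sub_le_self _ (by positivity))
  rw [gibbsMean, le_div_iff₀ (gibbsZ_pos G), ← hZ]
  have hsplit : ∑ σ, spin (ext σ c) * Real.exp (G σ)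
      = Z - 2 * ∑ σ ∈ Finset.univ.filter (fun σ => ext σ c = false), Real.exp (G σ) := by
    rw [hZ, gibbsZ, Finset.sum_filter, Finset.mul_sum, ← Finset.sum_sub_distrib]
    refine Finset.sum_congr rfl fun σ _ => ?_
    cases h : ext σ c
    · simp [spin]; ring
    · simp [spin]
  rw [hsplit]
  linarith

/-! ### Lattice sums -/

section Coupling

variable {J α : ℝ}

lemma siteDist_comm (i j : Site) : siteDist i j = siteDist j i := by
  unfold siteDist; congr 1; ring

lemma siteDist_nonneg (i j : Site) : 0 ≤ siteDist i j := Real.sqrt_nonneg _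

lemma siteDist_add (t i j : Site) : siteDist (i + t) (j + t) = siteDist i j := by
  unfold siteDist
  congr 1
  simp only [Prod.fst_add, Prod.snd_add, Int.cast_add]
  ring

lemma one_le_siteDist {i j : Site} (h : i ≠ j) : 1 ≤ siteDist i j := by
  rw [siteDist, Real.one_le_sqrt]
  have h1 : (1 : ℤ) ≤ (i.1 - j.1) ^ 2 + (i.2 - j.2) ^ 2 := by
    by_contra hlt
    have h2 : (i.1 - j.1) ^ 2 = 0 := by nlinarith [sq_nonneg (i.1 - j.1), sq_nonneg (i.2 - j.2)]
    have h3 : (i.2 - j.2) ^ 2 = 0 := by nlinarith [sq_nonneg (i.1 - j.1), sq_nonneg (i.2 - j.2)]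
    exact h (Prod.ext (sub_eq_zero.1 (pow_eq_zero_iff two_ne_zero |>.1 h2))
      (sub_eq_zero.1 (pow_eq_zero_iff two_ne_zero |>.1 h3)))
  exact_mod_cast h1

lemma siteDist_triangle (i j k : Site) : siteDist i k ≤ siteDist i j + siteDist j k := by
  have h : ∀ a b : Site, siteDist a b = ‖(⟨(a.1 : ℝ) - b.1, (a.2 : ℝ) - b.2⟩ : ℂ)‖ := fun a b => by
    rw [siteDist, Complex.norm_def, Complex.normSq_mk]
    congr 1; ring
  rw [h, h, h]
  refine le_trans (le_of_eq ?_) (norm_add_le _ _)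
  congr 1
  apply Complex.ext <;> simp

lemma coupling_self (i : Site) : coupling J α i i = 0 := if_pos rfl

lemma coupling_comm (i j : Site) : coupling J α i j = coupling J α j i := by
  unfold coupling
  rw [siteDist_comm]
  simp only [eq_comm]

lemma coupling_nonneg (hJ : 0 ≤ J) (i j : Site) : 0 ≤ coupling J α i j := by
  unfold coupling
  split_ifs
  · exact le_rfl
  · exact mul_nonneg hJ (Real.rpow_nonneg (siteDist_nonneg i j) _)

lemma coupling_pos (hJ : 0 < J) {i j : Site} (h : i ≠ j) : 0 < coupling J α i j := by
  rw [coupling, if_neg h]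
  exact mul_pos hJ (Real.rpow_pos_of_pos (zero_lt_one.trans_le (one_le_siteDist h)) _)

lemma coupling_add (t i j : Site) : coupling J α (i + t) (j + t) = coupling J α i j := by
  simp only [coupling, siteDist_add, add_left_inj]

/-- The Euclidean distance dominates the sup norm, for which summability over the plane for
exponents above 2 is known from Eisenstein series. -/
lemma summable_coupling_zero (hJ : 0 ≤ J) (hα : 2 < α) : Summable (coupling J α 0) := by
  have h := (EisensteinSeries.summable_one_div_norm_rpow hα).mul_left J
  rw [← (finTwoArrowEquiv ℤ).symm.summable_iff] at h
  refine h.of_nonneg_of_le (fun y => coupling_nonneg hJ 0 y) fun y => ?_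
  unfold coupling
  split_ifs with h0
  · exact mul_nonneg hJ (Real.rpow_nonneg (norm_nonneg _) _)
  · refine mul_le_mul_of_nonneg_left ?_ hJ
    have hn : (0 : ℝ) < ‖(finTwoArrowEquiv ℤ).symm y‖ := by
      rw [norm_pos_iff]
      intro h1
      apply h0
      have h2 := congrFun h1 0
      have h3 := congrFun h1 1
      simp at h2 h3
      exact (Prod.ext h2 h3).symm
    refine Real.rpow_le_rpow_of_nonpos hn ?_ (by linarith)
    rw [pi_norm_le_iff_of_nonneg (siteDist_nonneg _ _)]
    intro i
    have key : ∀ a b : ℝ, |a| ≤ Real.sqrt (a ^ 2 + b ^ 2) := fun a b =>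
      Real.abs_le_sqrt (by nlinarith [sq_nonneg b])
    fin_cases i
    · have := key y.1 y.2
      simpa [siteDist, Int.norm_eq_abs] using this
    · have := key y.2 y.1
      rw [add_comm] at this
      simpa [siteDist, Int.norm_eq_abs] using this

lemma coupling_eq_zero_sub (x y : Site) : coupling J α x y = coupling J α 0 (y - x) := by
  have := coupling_add (J := J) (α := α) x 0 (y - x)
  simpa using this

lemma summable_coupling (hJ : 0 ≤ J) (hα : 2 < α) (x : Site) : Summable (coupling J α x) := by
  have h := (Equiv.subRight x).summable_iff.2 (summable_coupling_zero hJ hα)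
  refine h.congr fun y => ?_
  simp only [Function.comp, Equiv.subRight_apply]
  exact (coupling_eq_zero_sub x y).symm

variable (J α) in
/-- The sum of all couplings at a site. -/
def totalCoupling : ℝ := ∑' y, coupling J α 0 y

lemma tsum_coupling (x : Site) : ∑' y, coupling J α x y = totalCoupling J α := by
  rw [totalCoupling, ← (Equiv.subRight x).tsum_eq (coupling J α 0)]
  exact tsum_congr fun y => coupling_eq_zero_sub x y

lemma totalCoupling_nonneg (hJ : 0 ≤ J) : 0 ≤ totalCoupling J α :=
  tsum_nonneg fun y => coupling_nonneg hJ 0 y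

lemma summable_coupling_mul (hJ : 0 ≤ J) (hα : 2 < α) (x : Site) {g : Site → ℝ} {C : ℝ}
    (hg : ∀ y, |g y| ≤ C) : Summable fun y => coupling J α x y * g y := by
  refine Summable.of_norm_bounded ((summable_coupling hJ hα x).mul_right C) fun y => ?_
  rw [Real.norm_eq_abs, abs_mul, abs_of_nonneg (coupling_nonneg hJ x y)]
  exact mul_le_mul_of_nonneg_left (hg y) (coupling_nonneg hJ x y)

lemma sum_coupling_le (hJ : 0 ≤ J) (hα : 2 < α) (x : Site) (S : Finset Site) :
    ∑ y ∈ S, coupling J α x y ≤ totalCoupling J α := by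
  rw [← tsum_coupling x]
  exact (summable_coupling hJ hα x).sum_le_tsum S fun y _ => coupling_nonneg hJ x y

end Coupling

/-! ### Fields and Hamiltonians -/

section Field

variable {J α : ℝ}

/-- The spin configuration off `V`, as numbers. -/
def offSpin (V : Finset Site) (η : Config) (y : Site) : ℝ := if y ∈ V then 0 else spin (η y)

variable (J α) in
/-- The field at `x` of the spins of `η` outside `V`. -/
def fieldAt (V : Finset Site) (η : Config) (x : Site) : ℝ :=
  ∑' y, coupling J α x y * offSpin V η y

lemma abs_offSpin_le (V : Finset Site) (η : Config) (y : Site) : |offSpin V η y| ≤ 1 := by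
  unfold offSpin
  split_ifs
  · simp
  · rw [abs_spin]

lemma summable_fieldAt (hJ : 0 ≤ J) (hα : 2 < α) (V : Finset Site) (η : Config) (x : Site) :
    Summable fun y => coupling J α x y * offSpin V η y :=
  summable_coupling_mul hJ hα x (abs_offSpin_le V η)

lemma tsum_subtype_eq_fieldAt (V : Finset Site) (η : Config) (x : Site) :
    ∑' y : {y : Site // y ∉ V}, coupling J α x y * spin (η y) = fieldAt J α V η x := by
  rw [fieldAt, ← tsum_subtype_eq_of_support_subset (s := {y | y ∉ V})]
  · refine tsum_congr fun y => ?_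
    rw [offSpin, if_neg y.2]
  · intro y hy
    by_contra h
    simp only [Set.mem_ofPred_eq, not_not] at h
    simp [offSpin, h] at hy

lemma abs_fieldAt_le (hJ : 0 ≤ J) (hα : 2 < α) (V : Finset Site) (η : Config) (x : Site) :
    |fieldAt J α V η x| ≤ totalCoupling J α := by
  rw [← tsum_coupling x, ← Real.norm_eq_abs]
  refine tsum_of_norm_bounded (summable_coupling hJ hα x).hasSum fun y => ?_
  rw [Real.norm_eq_abs, abs_mul, abs_of_nonneg (coupling_nonneg hJ x y)]
  exact mul_le_of_le_one_right (coupling_nonneg hJ x y) (abs_offSpin_le V η y)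

lemma fieldAt_mono (hJ : 0 ≤ J) (hα : 2 < α) {V : Finset Site} {η η' : Config}
    (h : ∀ y ∉ V, η y ≤ η' y) (x : Site) : fieldAt J α V η x ≤ fieldAt J α V η' x := by
  refine (summable_fieldAt hJ hα V η x).tsum_le_tsum (fun y => ?_) (summable_fieldAt hJ hα V η' x)
  refine mul_le_mul_of_nonneg_left ?_ (coupling_nonneg hJ x y)
  unfold offSpin
  split_ifs with hy
  · exact le_rfl
  · exact spin_mono (h y hy)

lemma fieldAt_congr {V : Finset Site} {η η' : Config} (h : ∀ y ∉ V, η y = η' y) (x : Site) :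
    fieldAt J α V η x = fieldAt J α V η' x := by
  refine tsum_congr fun y => ?_
  unfold offSpin
  split_ifs with hy
  · rfl
  · rw [h y hy]

lemma fieldAt_insert (hJ : 0 ≤ J) (hα : 2 < α) {V : Finset Site} {a : Site} (ha : a ∉ V)
    (η : Config) (x : Site) :
    fieldAt J α V η x = coupling J α x a * spin (η a) + fieldAt J α (insert a V) η x := by
  have e : ∀ y, coupling J α x y * offSpin V η y
      = (if y = a then coupling J α x a * spin (η a) else 0)
        + coupling J α x y * offSpin (insert a V) η y := by
    intro y
    by_cases hy : y = a
    · subst hy; simp [offSpin, ha]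
    · simp [offSpin, hy]
  rw [fieldAt, tsum_congr e, Summable.tsum_add _ (summable_fieldAt hJ hα _ η x), tsum_ite_eq,
    fieldAt]
  exact (hasSum_ite_eq a _).summable

lemma hamiltonian_eq (Λ : Finset Site) (η : Config) :
    hamiltonian J α Λ η = -((1 / 2) * ∑ i ∈ Λ, ∑ j ∈ Λ, coupling J α i j * spin (η i) * spin (η j))
      - ∑ i ∈ Λ, spin (η i) * fieldAt J α Λ η i := by
  unfold hamiltonian
  congr 1
  refine Finset.sum_congr rfl fun i _ => ?_
  rw [← tsum_subtype_eq_fieldAt, ← tsum_mul_left]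
  exact tsum_congr fun j => by ring

/-- The pairs between `a` and `V` are already counted in the volume `V`, as pairs with the outside.
The new ones join `a` to the outside of the enlarged volume. -/
lemma hamiltonian_insert (hJ : 0 ≤ J) (hα : 2 < α) {V : Finset Site} {a : Site} (ha : a ∉ V)
    (η : Config) : hamiltonian J α (insert a V) η
      = hamiltonian J α V η - spin (η a) * fieldAt J α (insert a V) η a := by
  rw [hamiltonian_eq, hamiltonian_eq]
  have e1 : ∑ i ∈ insert a V, ∑ j ∈ insert a V, coupling J α i j * spin (η i) * spin (η j)
      = ∑ i ∈ V, ∑ j ∈ V, coupling J α i j * spin (η i) * spin (η j)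
        + 2 * ∑ i ∈ V, coupling J α i a * spin (η i) * spin (η a) := by
    rw [Finset.sum_insert ha, Finset.sum_insert ha, coupling_self]
    simp only [Finset.sum_insert ha, Finset.sum_add_distrib]
    have : ∑ j ∈ V, coupling J α a j * spin (η a) * spin (η j)
        = ∑ i ∈ V, coupling J α i a * spin (η i) * spin (η a) :=
      Finset.sum_congr rfl fun j _ => by rw [coupling_comm]; ring
    rw [this]; ring
  have e2 : ∑ i ∈ V, spin (η i) * fieldAt J α V η i
      = ∑ i ∈ V, coupling J α i a * spin (η i) * spin (η a)
        + ∑ i ∈ V, spin (η i) * fieldAt J α (insert a V) η i := by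
    rw [← Finset.sum_add_distrib]
    refine Finset.sum_congr rfl fun i _ => ?_
    rw [fieldAt_insert hJ hα ha η i]; ring
  rw [e1, e2, Finset.sum_insert ha]
  ring

/-- Energy differences of configurations that agree off `V` do not depend on the volume. -/
lemma hamiltonian_sub_eq (hJ : 0 ≤ J) (hα : 2 < α) {V Λ : Finset Site} (hV : V ⊆ Λ) {η η' : Config}
    (h : ∀ y ∉ V, η y = η' y) :
    hamiltonian J α Λ η - hamiltonian J α Λ η' = hamiltonian J α V η - hamiltonian J α V η' := by
  obtain ⟨S, rfl, hS⟩ : ∃ S, Λ = S ∪ V ∧ Disjoint S V :=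
    ⟨Λ \ V, (Finset.sdiff_union_of_subset hV).symm, Finset.sdiff_disjoint⟩
  clear hV
  induction S using Finset.induction_on with
  | empty => simp
  | insert a S ha ih =>
    rw [Finset.disjoint_insert_left] at hS
    have haV : a ∉ S ∪ V := by simp [ha, hS.1]
    rw [Finset.insert_union, hamiltonian_insert hJ hα haV, hamiltonian_insert hJ hα haV,
      h a hS.1, fieldAt_congr (η := η) (η' := η') fun y hy => h y fun hyV => hy (by simp [hyV])]
    linarith [ih hS.2]

variable (J α) in
/-- The couplings inside `V` at inverse temperature `β`. -/
def volCoupling (β : ℝ) (V : Finset Site) (x y : V) : ℝ := β * coupling J α x y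

variable (J α) in
/-- The log-weight of the Gibbs distribution in `V` with boundary condition `η`. -/
def volEnergy (β : ℝ) (V : Finset Site) (η : Config) : (V → Bool) → ℝ :=
  pairEnergy (volCoupling J α β V) fun x : V => β * fieldAt J α V η x

lemma glue_of_mem {Λ : Finset Site} (σ : Λ → Bool) (ω : Config) {i : Site} (h : i ∈ Λ) :
    glue Λ σ ω i = σ ⟨i, h⟩ := dif_pos h

lemma glue_of_notMem {Λ : Finset Site} (σ : Λ → Bool) (ω : Config) {i : Site} (h : i ∉ Λ) :
    glue Λ σ ω i = ω i := dif_neg h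

@[simp]
lemma glue_coe {Λ : Finset Site} (σ : Λ → Bool) (ω : Config) (i : Λ) : glue Λ σ ω i = σ i :=
  glue_of_mem σ ω i.2

lemma neg_mul_hamiltonian_glue (β : ℝ) (V : Finset Site) (η : Config) (σ : V → Bool) :
    -β * hamiltonian J α V (glue V σ η) = volEnergy J α β V η σ := by
  rw [hamiltonian_eq, volEnergy, pairEnergy]
  simp only [volCoupling]
  rw [← Finset.sum_coe_sort V, ← Finset.sum_coe_sort V]
  have h1 : ∀ i : V, ∑ j ∈ V, coupling J α i j * spin (glue V σ η i) * spin (glue V σ η j)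
      = ∑ j : V, coupling J α i j * spin (σ i) * spin (σ j) := fun i => by
    rw [← Finset.sum_coe_sort V]
    simp
  have h2 : ∀ i : V, fieldAt J α V (glue V σ η) i = fieldAt J α V η i := fun i =>
    fieldAt_congr (fun y hy => glue_of_notMem σ η hy) _
  simp only [h1]
  simp only [h2, glue_coe, mul_assoc, ← Finset.mul_sum]
  simp only [mul_comm (fieldAt J α V η _)]
  ring

lemma boltzmann_eq (β : ℝ) (V : Finset Site) (η : Config) (σ : V → Bool) :
    boltzmann J α β V η σ = Real.exp (volEnergy J α β V η σ) := by
  rw [boltzmann, neg_mul_hamiltonian_glue]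

lemma partitionFunction_eq (β : ℝ) (V : Finset Site) (η : Config) :
    partitionFunction J α β V η = gibbsZ (volEnergy J α β V η) := by
  simp only [partitionFunction, boltzmann_eq, gibbsZ]

lemma integral_isingSpec (β : ℝ) (V : Finset Site) (η : Config) (f : Config → ℝ) :
    ∫ σ, f σ ∂(isingSpec J α β V η)
      = gibbsMean (volEnergy J α β V η) (fun σ => f (glue V σ η)) := by
  unfold isingSpec
  have hi : ∀ x : Config, Integrable f (Measure.dirac x) := fun x =>
    (integrable_dirac (by simp))
  rw [integral_finsetSum_measure]
  · rw [gibbsMean, Finset.sum_div]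
    refine Finset.sum_congr rfl fun σ _ => ?_
    rw [integral_smul_measure, integral_dirac, boltzmann_eq, partitionFunction_eq,
      ENNReal.toReal_ofReal (div_nonneg (Real.exp_pos _).le (gibbsZ_pos _).le), smul_eq_mul]
    ring
  · intro σ _
    exact (hi _).smul_measure ENNReal.ofReal_ne_top

instance isProbabilityMeasure_isingSpec (β : ℝ) (V : Finset Site) (η : Config) :
    IsProbabilityMeasure (isingSpec J α β V η) := by
  constructor
  rw [isingSpec, Measure.finsetSum_apply]
  simp only [Measure.smul_apply, measure_univ, smul_eq_mul, mul_one]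
  rw [← ENNReal.ofReal_sum_of_nonneg]
  · rw [← Finset.sum_div, ← partitionFunction, div_self, ENNReal.ofReal_one]
    rw [partitionFunction_eq]
    exact (gibbsZ_pos _).ne'
  · intro σ _
    rw [boltzmann_eq, partitionFunction_eq]
    exact div_nonneg (Real.exp_pos _).le (gibbsZ_pos _).le

lemma glue_glue {V Λ : Finset Site} (hV : V ⊆ Λ) (τ : V → Bool) (σ : Λ → Bool) (ω : Config) :
    glue V τ (glue Λ σ ω) = glue Λ (fun i => glue V τ (glue Λ σ ω) i) ω := by
  funext i
  by_cases hi : i ∈ Λ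
  · rw [glue_of_mem _ ω hi]
  · rw [glue_of_notMem _ ω hi, glue_of_notMem _ _ (fun h => hi (hV h)), glue_of_notMem _ _ hi]

/-- Consistency of the finite-volume Gibbs distributions. -/
lemma gibbsMean_gibbsMean (hJ : 0 ≤ J) (hα : 2 < α) (β : ℝ) {V Λ : Finset Site} (hV : V ⊆ Λ)
    (ω : Config) (f : Config → ℝ) :
    gibbsMean (volEnergy J α β Λ ω) (fun σ => gibbsMean (volEnergy J α β V (glue Λ σ ω))
      (fun τ => f (glue V τ (glue Λ σ ω))))
      = gibbsMean (volEnergy J α β Λ ω) (fun σ => f (glue Λ σ ω)) := by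
  unfold gibbsMean
  congr 1
  set E : Config → ℝ := fun η => Real.exp (-β * hamiltonian J α Λ η) with hE
  set e : Config → ℝ := fun η => Real.exp (-β * hamiltonian J α V η) with he
  have hEe : ∀ σ : Λ → Bool, Real.exp (volEnergy J α β Λ ω σ) = E (glue Λ σ ω) := fun σ => by
    rw [hE, ← neg_mul_hamiltonian_glue]
  have hee : ∀ (η : Config) (τ : V → Bool), Real.exp (volEnergy J α β V η τ) = e (glue V τ η) :=
    fun η τ => by rw [he, ← neg_mul_hamiltonian_glue]
  have hZ : ∀ (η : Config) (τ : V → Bool), gibbsZ (volEnergy J α β V (glue V τ η))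
      = gibbsZ (volEnergy J α β V η) := fun η τ => by
    congr 1
    unfold volEnergy
    congr 1
    funext x
    rw [fieldAt_congr (fun y hy => glue_of_notMem τ η hy)]
  set z : Config → ℝ := fun η => gibbsZ (volEnergy J α β V η) with hz
  have hzpos : ∀ η, 0 < z η := fun η => gibbsZ_pos _
  -- Detailed balance: resampling the spins in `V` is reversible for the weight in `Λ`.
  have hsymm : ∀ (η : Config) (τ : V → Bool), E η * e (glue V τ η) = E (glue V τ η) * e η := by
    intro η τ
    simp only [hE, he, ← Real.exp_add]
    congr 1
    have := hamiltonian_sub_eq hJ hα hV (η := η) (η' := glue V τ η)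
      (fun y hy => (glue_of_notMem τ η hy).symm)
    linear_combination -β * this
  -- Exchanges the spins that `σ` has in `V` with the resampled ones.
  let Ψ : (Λ → Bool) × (V → Bool) → (Λ → Bool) × (V → Bool) := fun q =>
    (fun i => glue V q.2 (glue Λ q.1 ω) i, fun i => q.1 ⟨i, hV i.2⟩)
  have hΨ : Function.Involutive Ψ := by
    rintro ⟨σ, τ⟩
    ext i
    · simp only [Ψ]
      by_cases hi : (i : Site) ∈ V
      · rw [glue_of_mem _ _ hi]
      · rw [glue_of_notMem _ _ hi, glue_coe, glue_of_notMem _ _ hi, glue_coe]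
    · simp only [Ψ]
      rw [glue_of_mem _ _ i.2]
  have hback : ∀ (σ : Λ → Bool) (τ : V → Bool),
      glue V (fun i => σ ⟨i, hV i.2⟩) (glue V τ (glue Λ σ ω)) = glue Λ σ ω := by
    intro σ τ
    funext i
    by_cases hi : i ∈ V
    · rw [glue_of_mem _ _ hi, glue_of_mem _ _ (hV hi)]
    · rw [glue_of_notMem _ _ hi, glue_of_notMem _ _ hi]
  calc ∑ σ, (∑ τ, f (glue V τ (glue Λ σ ω)) * Real.exp (volEnergy J α β V (glue Λ σ ω) τ))
        / gibbsZ (volEnergy J α β V (glue Λ σ ω)) * Real.exp (volEnergy J α β Λ ω σ)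
      = ∑ q : (Λ → Bool) × (V → Bool), f (glue V q.2 (glue Λ q.1 ω))
          * (E (glue Λ q.1 ω) * e (glue V q.2 (glue Λ q.1 ω))) / z (glue Λ q.1 ω) := by
        rw [Fintype.sum_prod_type]
        refine Finset.sum_congr rfl fun σ _ => ?_
        rw [Finset.sum_div, Finset.sum_mul]
        refine Finset.sum_congr rfl fun τ _ => ?_
        rw [hEe, hee]; ring
    _ = ∑ q : (Λ → Bool) × (V → Bool), f (glue Λ q.1 ω)
          * (E (glue Λ q.1 ω) * e (glue V q.2 (glue Λ q.1 ω))) / z (glue Λ q.1 ω) := by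
        rw [← hΨ.bijective.sum_comp]
        refine Finset.sum_congr rfl fun q _ => ?_
        obtain ⟨σ, τ⟩ := q
        simp only [Ψ]
        rw [← glue_glue hV τ σ ω, hback, ← hsymm, hz]
        simp only [hZ]
    _ = ∑ σ, f (glue Λ σ ω) * Real.exp (volEnergy J α β Λ ω σ) := by
        rw [Fintype.sum_prod_type]
        refine Finset.sum_congr rfl fun σ _ => ?_
        rw [hEe]
        have : ∑ τ : V → Bool, e (glue V τ (glue Λ σ ω)) = z (glue Λ σ ω) := by
          rw [hz]; simp only [gibbsZ, hee]
        simp only [mul_div_assoc, ← Finset.mul_sum]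
        rw [← Finset.sum_div, this, div_self (hzpos _).ne', mul_one]

end Field

/-! ### The alternating configuration -/

/-- Both coordinates are even: the sites that survive the decimation. -/
def IsEvenSite (y : Site) : Prop := Even y.1 ∧ Even y.2

instance : DecidablePred IsEvenSite := fun _ => inferInstanceAs (Decidable (_ ∧ _))

/-- The alternating configuration on the even sites. -/
def altSpin (y : Site) : Bool := decide (Even (y.1 / 2 + y.2 / 2))

/-- The alternating configuration as numbers, extended by zero. -/
def altValue (y : Site) : ℝ := if IsEvenSite y then spin (altSpin y) else 0

lemma abs_altValue_le (y : Site) : |altValue y| ≤ 1 := by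
  unfold altValue
  split_ifs
  · rw [abs_spin]
  · simp

/-- In halved coordinates the reflection is `i ↦ x.1 - i`. As `x.1` is odd, it changes the parity of
`i`. -/
lemma altValue_reflect_fst {x : Site} (hx : ¬ Even x.1) (y : Site) :
    altValue (2 * x.1 - y.1, y.2) = -altValue y := by
  unfold altValue
  have h1 : IsEvenSite (2 * x.1 - y.1, y.2) ↔ IsEvenSite y := by
    unfold IsEvenSite; simp only [Int.even_iff]; omega
  simp only [h1]
  split_ifs with h
  · rw [← spin_not]
    congr 1
    obtain ⟨h2, h3⟩ := h
    unfold altSpin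
    simp only [Int.even_iff] at *
    have : (2 * x.1 - y.1) / 2 = x.1 - y.1 / 2 := by omega
    rw [this, ← decide_not]
    congr 1
    apply propext
    omega
  · simp

lemma altValue_swap (y : Site) : altValue (y.2, y.1) = altValue y := by
  have h1 : IsEvenSite (y.2, y.1) ↔ IsEvenSite y := and_comm
  have h2 : altSpin (y.2, y.1) = altSpin y := by simp only [altSpin, add_comm (y.2 / 2)]
  simp only [altValue, h1, h2]

lemma altValue_reflect_snd {x : Site} (hx : ¬ Even x.2) (y : Site) :
    altValue (y.1, 2 * x.2 - y.2) = -altValue y := by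
  rw [← altValue_swap, ← altValue_swap y]
  exact altValue_reflect_fst (x := (x.2, x.1)) hx (y.2, y.1)

/-- The alternating configuration creates no field at the other sites. -/
lemma tsum_coupling_mul_altValue {J α : ℝ} {x : Site} (hx : ¬ IsEvenSite x) :
    ∑' y, coupling J α x y * altValue y = 0 := by
  -- An isometry that fixes `x` and reverses the alternating configuration shows that the field at
  -- `x` equals its own negative.
  have key : ∀ e : Site ≃ Site, (∀ y, coupling J α x (e y) = coupling J α x y) →
      (∀ y, altValue (e y) = -altValue y) → ∑' y, coupling J α x y * altValue y = 0 := by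
    intro e h1 h2
    have h := e.tsum_eq fun y => coupling J α x y * altValue y
    simp only [h1, h2, mul_neg, tsum_neg] at h
    linarith
  unfold IsEvenSite at hx
  rw [not_and_or] at hx
  rcases hx with hx | hx
  · refine key ⟨fun y => (2 * x.1 - y.1, y.2), fun y => (2 * x.1 - y.1, y.2),
      fun y => by simp, fun y => by simp⟩ (fun y => ?_) (altValue_reflect_fst hx)
    have h1 : siteDist x (2 * x.1 - y.1, y.2) = siteDist x y := by
      unfold siteDist; congr 1; push_cast; ring
    have h2 : x = (2 * x.1 - y.1, y.2) ↔ x = y := by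
      simp only [Prod.ext_iff]; omega
    simp only [coupling, Equiv.coe_fn_mk, h1, h2]
  · refine key ⟨fun y => (y.1, 2 * x.2 - y.2), fun y => (y.1, 2 * x.2 - y.2),
      fun y => by simp, fun y => by simp⟩ (fun y => ?_) (altValue_reflect_snd hx)
    have h1 : siteDist x (y.1, 2 * x.2 - y.2) = siteDist x y := by
      unfold siteDist; congr 1; push_cast; ring
    have h2 : x = (y.1, 2 * x.2 - y.2) ↔ x = y := by
      simp only [Prod.ext_iff]; omega
    simp only [coupling, Equiv.coe_fn_mk, h1, h2]

/-! ### The reference phases -/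

/-- The box `[0, N)²`. -/
def box (N : ℕ) : Finset Site := Finset.Ico 0 (N : ℤ) ×ˢ Finset.Ico 0 (N : ℤ)

lemma mem_box {N : ℕ} {p : Site} : p ∈ box N ↔ InBox N p := by
  simp [box, InBox]

/-- The sites of `Λ` that do not survive the decimation. -/
def internal (Λ : Finset Site) : Finset Site := Λ.filter fun y => ¬ IsEvenSite y

/-- The configuration that equals `p` in `Λ` and has constant spin `b` outside. -/
def withBoundary (Λ : Finset Site) (p : Config) (b : Bool) : Config :=
  fun y => if y ∈ Λ then p y else b

/-- The embedding of `ℤ²` onto the sites with odd coordinates. -/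
def oddEmb (p : Site) : Site := (2 * p.1 + 1, 2 * p.2 + 1)

/-- The nearest-neighbour steps. -/
def steps : Finset Site := {(1, 0), (-1, 0), (0, 1), (0, -1)}

lemma oddEmb_mem_internal {M : ℕ} {p : Site} : oddEmb p ∈ internal (box (2 * M)) ↔ p ∈ box M := by
  simp only [internal, Finset.mem_filter, mem_box, InBox, oddEmb, IsEvenSite, Int.even_iff]
  push_cast
  omega

lemma oddEmb_mem_box {M : ℕ} {p : Site} : oddEmb p ∈ box (2 * M) ↔ p ∈ box M := by
  simp only [mem_box, InBox, oddEmb]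
  push_cast
  omega

lemma not_isEvenSite_oddEmb (p : Site) : ¬ IsEvenSite (oddEmb p) := by
  simp only [oddEmb, IsEvenSite, Int.even_iff]
  omega

lemma oddEmb_injective : Function.Injective oddEmb := by
  intro p q h
  simp only [oddEmb, Prod.mk.injEq] at h
  exact Prod.ext (by omega) (by omega)

/-- Neighbours on the odd sublattice are at distance 2. -/
lemma coupling_oddEmb {J α : ℝ} (p : Site) {d : Site} (hd : d ∈ steps) :
    coupling J α (oddEmb p) (oddEmb (p + d)) = J * 2 ^ (-α) := by
  have h4 : Real.sqrt 4 = 2 := by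
    rw [show (4 : ℝ) = 2 ^ 2 by norm_num, Real.sqrt_sq (by norm_num)]
  have hne : oddEmb p ≠ oddEmb (p + d) := by
    intro h
    have := oddEmb_injective h
    rw [left_eq_add] at this
    subst this
    revert hd; decide
  rw [coupling, if_neg hne]
  congr 2
  simp only [steps, Finset.mem_insert, Finset.mem_singleton] at hd
  rw [← h4, siteDist]
  congr 1
  rcases hd with rfl | rfl | rfl | rfl <;>
    · simp only [oddEmb, Prod.fst_add, Prod.snd_add]; push_cast; ring

/-- The coordinate of a site in the odd sublattice. -/
def oddInv (x : Site) : Site := (x.1 / 2, x.2 / 2)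

lemma oddInv_oddEmb (p : Site) : oddInv (oddEmb p) = p := by
  unfold oddInv oddEmb
  ext <;> simp only <;> omega

/-! ### The nearest-neighbour model on the odd sublattice -/

section NearestNeighbour

variable (M : ℕ)

/-- Nearest-neighbour couplings on the odd sublattice. -/
def oddCoupling (κ : ℝ) (x y : Site) : ℝ :=
  if oddEmb (oddInv x) = x ∧ ∃ d ∈ steps, y = oddEmb (oddInv x + d) then κ else 0

/-- The field of a plus boundary condition on the odd sublattice. -/
def oddField (κ : ℝ) (x : Site) : ℝ :=
  if oddEmb (oddInv x) = x then κ * (steps.filter fun d => oddInv x + d ∉ box M).card else 0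

variable {M}

lemma oddCoupling_nonneg {κ : ℝ} (hκ : 0 ≤ κ) (x y : Site) : 0 ≤ oddCoupling κ x y := by
  unfold oddCoupling; split_ifs <;> simp [hκ]

lemma oddField_nonneg {κ : ℝ} (hκ : 0 ≤ κ) (x : Site) : 0 ≤ oddField M κ x := by
  unfold oddField
  split_ifs
  · positivity
  · exact le_rfl

/-- A sum over edges is the sum over the end points, with weights. -/
lemma sum_edges_eq (d : Site) (B D : Finset Site) (u : Site → Site → ℝ)
    (hu : ∀ p q, u p q = u q p) (hout : ∀ p q, p ∉ B → q ∉ B → u p q = 0)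
    (hD : ∀ p, p ∈ B ∨ p + d ∈ B → p ∈ D) :
    ∑ p ∈ B, (u p (p + d) * (if p + d ∈ B then 1 / 2 else 1)
        + u p (p + -d) * (if p + -d ∈ B then 1 / 2 else 1))
      = ∑ p ∈ D, u p (p + d) := by
  have e1 : ∑ p ∈ B, u p (p + d) * (if p + d ∈ B then 1 / 2 else 1)
      = ∑ p ∈ D, if p ∈ B then u p (p + d) * (if p + d ∈ B then 1 / 2 else 1) else 0 := by
    rw [← Finset.sum_filter]
    refine Finset.sum_congr ?_ fun _ _ => rfl
    ext p
    simp only [Finset.mem_filter]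
    exact ⟨fun h => ⟨hD p (Or.inl h), h⟩, fun h => h.2⟩
  have e2 : ∑ p ∈ B, u p (p + -d) * (if p + -d ∈ B then 1 / 2 else 1)
      = ∑ p ∈ D, if p + d ∈ B then u p (p + d) * (if p ∈ B then 1 / 2 else 1) else 0 := by
    rw [← Finset.sum_filter]
    refine Finset.sum_nbij' (fun p => p + -d) (fun p => p + d) ?_ ?_ ?_ ?_ ?_
    · intro p hp
      rw [Finset.mem_filter, neg_add_cancel_right]
      exact ⟨hD _ (Or.inr (by rwa [neg_add_cancel_right])), hp⟩
    · intro p hp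
      exact (Finset.mem_filter.1 hp).2
    · intro p _; exact neg_add_cancel_right p d
    · intro p _; exact add_neg_cancel_right p d
    · intro p _
      rw [neg_add_cancel_right, hu]
  rw [Finset.sum_add_distrib, e1, e2, ← Finset.sum_add_distrib]
  refine Finset.sum_congr rfl fun p _ => ?_
  by_cases h1 : p ∈ B <;> by_cases h2 : p + d ∈ B
  · simp only [h1, h2, if_true]; ring
  · simp [h1, h2]
  · simp [h1, h2]
  · simp [h1, h2, hout p (p + d) h1 h2]

/-- The restriction of a configuration on `V` to the odd sublattice, extended by plus spins. -/
def oddRestrict (V : Finset Site) (σ : V → Bool) : Config := fun p => glue V σ allPlus (oddEmb p)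

/-- An inner bond is seen from both of its ends and carries weight 1/2. A bond that leaves the box
is seen once, and appears on the left as a field, since the outer spin is plus. -/
lemma pairEnergy_odd (κ : ℝ) (σ : internal (box (2 * M)) → Bool) :
    pairEnergy (ι := internal (box (2 * M))) (fun x y => oddCoupling κ x y)
        (fun x => oddField M κ x) σ
      = κ * ∑ p ∈ box M, ∑ d ∈ steps, spin (oddRestrict _ σ p) * spin (oddRestrict _ σ (p + d))
          * (if p + d ∈ box M then 1 / 2 else 1) := by
  set η := glue (internal (box (2 * M))) σ allPlus with hη
  have hs : ∀ p, oddRestrict (internal (box (2 * M))) σ p = η (oddEmb p) := fun p => rfl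
  have e0 : pairEnergy (fun x y : internal (box (2 * M)) => oddCoupling κ x y) (fun x : internal (box (2 * M)) => oddField M κ x) σ
      = ∑ x ∈ internal (box (2 * M)), spin (η x) * (1 / 2 * (∑ y ∈ internal (box (2 * M)), oddCoupling κ x y * spin (η y))
          + oddField M κ x) := by
    rw [pairEnergy, ← Finset.sum_coe_sort (internal (box (2 * M))), Finset.mul_sum, ← Finset.sum_add_distrib]
    refine Finset.sum_congr rfl fun x _ => ?_
    rw [← Finset.sum_coe_sort (internal (box (2 * M)))]
    simp only [hη, glue_coe, mul_add, Finset.mul_sum]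
    congr 1
    · exact Finset.sum_congr rfl fun y _ => by ring
    · ring
  have e1 : ∑ x ∈ internal (box (2 * M)), spin (η x) * (1 / 2 * (∑ y ∈ internal (box (2 * M)), oddCoupling κ x y * spin (η y))
          + oddField M κ x)
      = ∑ p ∈ box M, spin (η (oddEmb p)) * (1 / 2 * (∑ y ∈ internal (box (2 * M)), oddCoupling κ (oddEmb p) y
          * spin (η y)) + oddField M κ (oddEmb p)) := by
    rw [← Finset.sum_filter_of_ne (p := fun x => oddEmb (oddInv x) = x)]
    · refine Finset.sum_nbij' oddInv oddEmb ?_ ?_ ?_ ?_ ?_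
      · intro x hx
        obtain ⟨h1, h2⟩ := Finset.mem_filter.1 hx
        rw [← oddEmb_mem_internal, h2]; exact h1
      · intro p hp
        rw [Finset.mem_filter, oddInv_oddEmb]
        exact ⟨oddEmb_mem_internal.2 hp, rfl⟩
      · intro x hx; exact (Finset.mem_filter.1 hx).2
      · intro p _; exact oddInv_oddEmb p
      · intro x hx; rw [(Finset.mem_filter.1 hx).2]
    · intro x _ hne
      by_contra hx
      apply hne
      simp [oddCoupling, oddField, hx]
  rw [e0, e1, Finset.mul_sum]
  refine Finset.sum_congr rfl fun p _ => ?_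
  have e2 : ∑ y ∈ internal (box (2 * M)), oddCoupling κ (oddEmb p) y * spin (η y)
      = ∑ d ∈ steps, if p + d ∈ box M then κ * spin (η (oddEmb (p + d))) else 0 := by
    rw [← Finset.sum_filter]
    have e3 : ∀ y, oddCoupling κ (oddEmb p) y * spin (η y)
        = if ∃ d ∈ steps, y = oddEmb (p + d) then κ * spin (η y) else 0 := fun y => by
      simp only [oddCoupling, oddInv_oddEmb, true_and, ite_mul, zero_mul]
    simp only [e3]
    rw [← Finset.sum_filter]
    symm
    refine Finset.sum_nbij (fun d => oddEmb (p + d)) ?_ ?_ ?_ ?_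
    · intro d hd
      obtain ⟨h1, h2⟩ := Finset.mem_filter.1 hd
      exact Finset.mem_filter.2 ⟨oddEmb_mem_internal.2 h2, d, h1, rfl⟩
    · intro d _ d' _ h
      exact add_left_cancel (oddEmb_injective h)
    · intro y hy
      obtain ⟨h1, d, hd, rfl⟩ := Finset.mem_filter.1 hy
      exact ⟨d, Finset.mem_coe.2 (Finset.mem_filter.2 ⟨hd, oddEmb_mem_internal.1 h1⟩), rfl⟩
    · intro d _; rfl
  have e4 : oddField M κ (oddEmb p) = ∑ d ∈ steps, if p + d ∈ box M then 0 else κ := by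
    simp only [← ite_not (p := _ ∈ box M) (y := (0 : ℝ))]
    rw [oddField, oddInv_oddEmb, if_pos rfl, ← Finset.sum_filter, Finset.sum_const,
      nsmul_eq_mul, mul_comm]
  have e5 : ∀ q, q ∉ box M → spin (η (oddEmb q)) = 1 := fun q hq => by
    rw [hη, glue_of_notMem _ _ (fun h => hq (oddEmb_mem_internal.1 h))]
    simp [allPlus, spin]
  rw [e2, e4, Finset.mul_sum, ← Finset.sum_add_distrib, Finset.mul_sum, Finset.mul_sum]
  refine Finset.sum_congr rfl fun d _ => ?_
  rw [hs, hs]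
  split_ifs with h
  · ring
  · rw [e5 _ h]; ring

lemma card_domainWall (s : Config) :
    ((domainWall M s).card : ℝ)
      = ∑ p ∈ Finset.Icc (-1 : ℤ) M ×ˢ Finset.Icc (-1 : ℤ) M,
          ((if s p ≠ s (p + (1, 0)) then 1 else 0) + if s p ≠ s (p + (0, 1)) then 1 else 0) := by
  rw [domainWall, Finset.card_union_of_disjoint, Finset.card_image_of_injective _ vEdge_injective,
    Finset.card_image_of_injective _ hEdge_injective, Finset.card_filter, Finset.card_filter,
    Finset.sum_add_distrib]
  · push_cast
    congr 1 <;>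
    · refine Finset.sum_congr rfl fun p _ => ?_
      have h1 : p + ((1, 0) : Site) = (p.1 + 1, p.2) := by ext <;> simp
      have h2 : p + ((0, 1) : Site) = (p.1, p.2 + 1) := by ext <;> simp
      simp only [h1, h2]
  · rw [Finset.disjoint_left]
    intro e h1 h2
    obtain ⟨p, _, rfl⟩ := Finset.mem_image.1 h1
    obtain ⟨q, _, h⟩ := Finset.mem_image.1 h2
    exact vEdge_ne_hEdge _ _ h.symm

lemma oddRestrict_of_not_inBox (σ : internal (box (2 * M)) → Bool) (p : Site) (hp : ¬ InBox M p) :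
    oddRestrict _ σ p = true := by
  rw [oddRestrict, glue_of_notMem]
  · rfl
  · rwa [oddEmb_mem_internal, mem_box]

/-- This is the form of the energy required by Peierls' argument: an unsatisfied bond costs `2 * κ`
relative to the all-plus configuration, and these bonds are dual to the domain wall. -/
lemma exists_pairEnergy_odd_eq (M : ℕ) (κ : ℝ) :
    ∃ C, ∀ σ : internal (box (2 * M)) → Bool,
      pairEnergy (ι := internal (box (2 * M))) (fun x y => oddCoupling κ x y)
          (fun x => oddField M κ x) σ
        = C - 2 * κ * (domainWall M (oddRestrict _ σ)).card := by
  refine ⟨κ * ∑ p ∈ box M, ∑ d ∈ steps, (if p + d ∈ box M then 1 / 2 else 1), fun σ => ?_⟩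
  set s := oddRestrict _ σ with hs
  have hout : ∀ p, p ∉ box M → spin (s p) = 1 := fun p hp => by
    rw [hs, oddRestrict_of_not_inBox σ p (by rwa [mem_box] at hp)]; rfl
  set u : Site → Site → ℝ := fun p q => spin (s p) * spin (s q) - 1 with hu
  have husymm : ∀ p q, u p q = u q p := fun p q => by simp only [hu, mul_comm]
  have huout : ∀ p q, p ∉ box M → q ∉ box M → u p q = 0 := fun p q hp hq => by
    simp [hu, hout p hp, hout q hq]
  set D := Finset.Icc (-1 : ℤ) M ×ˢ Finset.Icc (-1 : ℤ) M with hD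
  have hD1 : ∀ p, p ∈ box M ∨ p + (1, 0) ∈ box M → p ∈ D := by
    rintro ⟨a, b⟩ h
    simp only [mem_box, InBox, hD, Finset.mem_product, Finset.mem_Icc, Prod.fst_add,
      Prod.snd_add] at h ⊢
    omega
  have hD2 : ∀ p, p ∈ box M ∨ p + (0, 1) ∈ box M → p ∈ D := by
    rintro ⟨a, b⟩ h
    simp only [mem_box, InBox, hD, Finset.mem_product, Finset.mem_Icc, Prod.fst_add,
      Prod.snd_add] at h ⊢
    omega
  have e1 := sum_edges_eq (1, 0) (box M) D u husymm huout hD1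
  have e2 := sum_edges_eq (0, 1) (box M) D u husymm huout hD2
  have hsteps : ∀ F : Site → ℝ, ∑ d ∈ steps, F d
      = (F (1, 0) + F (-(1, 0))) + (F (0, 1) + F (-(0, 1))) := by
    intro F
    rw [steps, Finset.sum_insert (by decide), Finset.sum_insert (by decide),
      Finset.sum_insert (by decide), Finset.sum_singleton]
    have h1 : (-(1, 0) : Site) = (-1, 0) := rfl
    have h2 : (-(0, 1) : Site) = (0, -1) := rfl
    rw [h1, h2]; ring
  have e3 : ∑ p ∈ box M, ∑ d ∈ steps, u p (p + d) * (if p + d ∈ box M then 1 / 2 else 1)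
      = ∑ p ∈ D, (u p (p + (1, 0)) + u p (p + (0, 1))) := by
    rw [Finset.sum_add_distrib, ← e1, ← e2, ← Finset.sum_add_distrib]
    exact Finset.sum_congr rfl fun p _ => hsteps _
  have hu2 : ∀ p q, u p q = -2 * if s p ≠ s q then 1 else 0 := by
    intro p q
    simp only [hu]
    cases s p <;> cases s q <;> norm_num [spin]
  have e4 : ∑ p ∈ D, (u p (p + (1, 0)) + u p (p + (0, 1))) = -2 * (domainWall M s).card := by
    rw [card_domainWall, Finset.mul_sum]
    refine Finset.sum_congr rfl fun p _ => ?_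
    rw [hu2, hu2]; ring
  rw [pairEnergy_odd, ← hs]
  have e5 : ∑ p ∈ box M, ∑ d ∈ steps, spin (s p) * spin (s (p + d))
        * (if p + d ∈ box M then 1 / 2 else 1)
      = ∑ p ∈ box M, ∑ d ∈ steps, (if p + d ∈ box M then 1 / 2 else 1 : ℝ)
        + ∑ p ∈ box M, ∑ d ∈ steps, u p (p + d) * (if p + d ∈ box M then 1 / 2 else 1) := by
    simp only [← Finset.sum_add_distrib]
    refine Finset.sum_congr rfl fun p _ => Finset.sum_congr rfl fun d _ => ?_
    simp only [hu]; ring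
  rw [e5, e3, e4]
  ring

/-- The nearest-neighbour model on the odd sublattice is magnetized at low temperature. -/
lemma half_le_gibbsMean_odd (M : ℕ) {κ : ℝ} (hκ : 40 * Real.exp (-2 * κ) ≤ 1) {p : Site}
    (hp : oddEmb p ∈ internal (box (2 * M))) :
    1 / 2 ≤ gibbsMean (ι := internal (box (2 * M)))
      (pairEnergy (fun x y => oddCoupling κ x y) (fun x => oddField M κ x))
      (fun σ => spin (σ ⟨oddEmb p, hp⟩)) := by
  obtain ⟨C, hC⟩ := exists_pairEnergy_odd_eq M κ
  have h := half_le_gibbsMean_of_peierls M (oddRestrict (internal (box (2 * M))))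
    oddRestrict_of_not_inBox ?_ _ C κ hC hκ p
  · simpa only [oddRestrict, glue_of_mem _ _ hp] using h
  · intro w hw
    -- Only spins of the odd sublattice are reversed. The other internal spins do not enter this
    -- energy.
    refine ⟨fun σ x => xor (σ x) (if oddEmb (oddInv x) = x then w (oddInv x) else false), ?_, ?_⟩
    · intro σ σ' h
      funext x
      have := congrFun h x
      simpa using this
    · intro σ q
      unfold oddRestrict
      by_cases hq : oddEmb q ∈ internal (box (2 * M))
      · rw [glue_of_mem _ _ hq, glue_of_mem _ _ hq]
        simp [oddInv_oddEmb]
      · rw [glue_of_notMem _ _ hq, glue_of_notMem _ _ hq, hw, Bool.xor_false]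
        rwa [oddEmb_mem_internal, mem_box] at hq

end NearestNeighbour

/-! ### Magnetized phases under the alternating configuration -/

section Reference

variable {J α : ℝ}

/-- The field of an alternating configuration inside the box and plus spins outside is at least
the field of the plus spins on the odd sublattice. -/
lemma oddField_le_tsum (hJ : 0 ≤ J) (hα : 2 < α) {ε : ℝ} (hε : |ε| ≤ 1) (M : ℕ) {x : Site}
    (hx : ¬ IsEvenSite x) :
    oddField M (J * 2 ^ (-α)) x
      ≤ ∑' y, coupling J α x y * (if y ∈ box (2 * M) then ε * altValue y else 1) := by
  -- The field of the alternating configuration on the whole lattice is zero. Subtracting it leaves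
  -- a nonnegative source outside the box and nothing inside.
  set g : Site → ℝ := fun y => if y ∈ box (2 * M) then 0 else 1 - ε * altValue y with hg
  have habs : ∀ y, |ε * altValue y| ≤ 1 := fun y => by
    rw [abs_mul]; exact mul_le_one₀ hε (abs_nonneg _) (abs_altValue_le y)
  have hg0 : ∀ y, 0 ≤ g y := fun y => by
    simp only [hg]
    split_ifs
    · exact le_rfl
    · linarith [(abs_le.1 (habs y)).2]
  have hgb : ∀ y, |g y| ≤ 2 := fun y => by
    rw [abs_of_nonneg (hg0 y)]
    simp only [hg]
    split_ifs
    · norm_num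
    · linarith [(abs_le.1 (habs y)).1]
  have hsg := summable_coupling_mul hJ hα x hgb
  have e : ∑' y, coupling J α x y * (if y ∈ box (2 * M) then ε * altValue y else 1)
      = ∑' y, coupling J α x y * g y := by
    have h0 : ∑' y, coupling J α x y * (ε * altValue y) = 0 := by
      have : ∀ y, coupling J α x y * (ε * altValue y) = ε * (coupling J α x y * altValue y) :=
        fun y => by ring
      rw [tsum_congr this, tsum_mul_left, tsum_coupling_mul_altValue hx, mul_zero]
    rw [← zero_add (∑' y, coupling J α x y * g y), ← h0,
      ← (summable_coupling_mul hJ hα x habs).tsum_add hsg]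
    refine tsum_congr fun y => ?_
    simp only [hg]
    split_ifs <;> ring
  rw [e]
  have hterm : ∀ y, 0 ≤ coupling J α x y * g y := fun y =>
    mul_nonneg (coupling_nonneg hJ x y) (hg0 y)
  unfold oddField
  split_ifs with hodd
  · set p := oddInv x with hp
    -- Of the outside only the neighbours on the odd sublattice are kept; there `altValue` is zero
    -- and the source is 1.
    have h1 := hsg.sum_le_tsum ((steps.filter fun d => p + d ∉ box M).image
      fun d => oddEmb (p + d)) (fun y _ => hterm y)
    rw [Finset.sum_image (fun d _ d' _ h => add_left_cancel (oddEmb_injective h))] at h1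
    refine le_trans (le_of_eq ?_) h1
    rw [mul_comm, ← nsmul_eq_mul, ← Finset.sum_const]
    refine Finset.sum_congr rfl fun d hd => ?_
    obtain ⟨hd1, hd2⟩ := Finset.mem_filter.1 hd
    rw [← hodd, coupling_oddEmb p hd1]
    simp only [hg, oddEmb_mem_box, if_neg hd2, altValue, if_neg (not_isEvenSite_oddEmb _)]
    ring
  · exact tsum_nonneg hterm

lemma offSpin_withBoundary {Λ : Finset Site} (p : Config) (b : Bool) (y : Site) :
    offSpin (internal Λ) (withBoundary Λ p b) y
      = if y ∈ Λ then (if IsEvenSite y then spin (p y) else 0) else spin b := by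
  unfold offSpin withBoundary internal
  by_cases h1 : y ∈ Λ <;> by_cases h2 : IsEvenSite y <;> simp [h1, h2]

lemma not_isEvenSite_of_mem_internal {Λ : Finset Site} {x : Site} (hx : x ∈ internal Λ) :
    ¬ IsEvenSite x := (Finset.mem_filter.1 hx).2

/-- With alternating even spins and plus boundary condition the other spins are magnetized. -/
lemma half_le_gibbsMean_reference (hJ : 0 < J) (hα : 2 < α) {β : ℝ} (hβ : 0 ≤ β)
    (hκ : 40 * Real.exp (-2 * (β * (J * 2 ^ (-α)))) ≤ 1) (M : ℕ) {p : Site}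
    (hp : oddEmb p ∈ internal (box (2 * M))) :
    1 / 2 ≤ gibbsMean (volEnergy J α β (internal (box (2 * M)))
        (withBoundary (box (2 * M)) altSpin true)) (fun σ => spin (σ ⟨oddEmb p, hp⟩)) ∧
    gibbsMean (volEnergy J α β (internal (box (2 * M)))
        (withBoundary (box (2 * M)) altSpin false)) (fun σ => spin (σ ⟨oddEmb p, hp⟩)) ≤ -(1 / 2) := by
  have hκ0 : 0 ≤ β * (J * 2 ^ (-α)) := by positivity
  have hodd := half_le_gibbsMean_odd M hκ hp
  -- Needed for both signs: reversing all spins carries the minus boundary condition to plus, but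
  -- also the alternating pattern to its negative, which is the case `ε = -1`.
  have key : ∀ ε : ℝ, |ε| ≤ 1 → 1 / 2 ≤ gibbsMean (pairEnergy
      (volCoupling J α β (internal (box (2 * M))))
      (fun x => β * ∑' y, coupling J α x y * (if y ∈ box (2 * M) then ε * altValue y else 1)))
      (fun σ => spin (σ ⟨oddEmb p, hp⟩)) := by
    intro ε hε
    refine hodd.trans (gibbsMean_spin_le_of_le (fun x y => oddCoupling_nonneg hκ0 _ _)
      (fun x => oddField_nonneg hκ0 _) (fun x y => ?_) (fun x => ?_) _)
    · unfold oddCoupling volCoupling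
      split_ifs with h
      · obtain ⟨h1, d, hd, h2⟩ := h
        rw [h2]
        have h3 := coupling_oddEmb (J := J) (α := α) (oddInv x) hd
        rw [h1] at h3
        rw [h3]
      · exact mul_nonneg hβ (coupling_nonneg hJ.le _ _)
    · have h1 := mul_le_mul_of_nonneg_left
        (oddField_le_tsum hJ.le hα hε M (not_isEvenSite_of_mem_internal x.2)) hβ
      refine le_trans (le_of_eq ?_) h1
      unfold oddField
      split_ifs <;> ring
  constructor
  · have h := key 1 (by simp)
    convert h using 2
    unfold volEnergy
    congr 1
    funext x
    congr 1
    refine tsum_congr fun y => ?_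
    rw [offSpin_withBoundary, altValue, one_mul]
    rfl
  · have h := key (-1) (by simp)
    have h2 := gibbsMean_pairEnergy_neg (volCoupling J α β (internal (box (2 * M))))
      (fun x => β * ∑' y, coupling J α x y * (if y ∈ box (2 * M) then -1 * altValue y else 1))
      ⟨oddEmb p, hp⟩
    have h3 : volEnergy J α β (internal (box (2 * M)))
        (withBoundary (box (2 * M)) altSpin false)
        = pairEnergy (volCoupling J α β (internal (box (2 * M)))) (fun x => -(β * ∑' y,
          coupling J α x y * (if y ∈ box (2 * M) then -1 * altValue y else 1))) := by
      unfold volEnergy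
      congr 1
      funext x
      rw [← mul_neg, ← tsum_neg]
      congr 1
      refine tsum_congr fun y => ?_
      rw [offSpin_withBoundary, altValue]
      split_ifs
      · ring
      · ring
      · simp [spin]
    rw [h3, h2]
    linarith

end Reference

/-! ### Selection of the phase by a dilute set of spins -/

section Wetting

set_option linter.unusedSectionVars false

variable {ι κ : Type*} [Fintype ι] [DecidableEq ι]

lemma abs_pairEnergy_sub_le (K : ι → ι → ℝ) (u w : ι → ℝ) (σ : ι → Bool) :
    |pairEnergy K u σ - pairEnergy K w σ| ≤ ∑ x, |u x - w x| := by
  have e : pairEnergy K u σ - pairEnergy K w σ = ∑ x, (u x - w x) * spin (σ x) := by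
    simp only [pairEnergy, sub_mul, Finset.sum_sub_distrib]; ring
  rw [e]
  refine (Finset.abs_sum_le_sum_abs _ _).trans (Finset.sum_le_sum fun x _ => ?_)
  rw [abs_mul, abs_spin, mul_one]

variable {K : ι → ι → ℝ} {u w v : ι → ℝ} {S : Finset κ} {f : κ → (ι → Bool) → ℝ} {L : κ → ι → ℝ}
  {s : ℝ}

/-- Here `u` and `w` belong to the same pattern under opposite boundary conditions, and `v` to the
reference phase. Jensen's inequality passes from `u` to `w` with a tilt that favours plus spins; the
slack between `w` and `v` exceeds the Lipschitz constants of the tilt, so the tilted measure is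
still dominated by the reference phase. -/
lemma sum_gibbsMean_sub_le_of_field_le (hK : ∀ x y, 0 ≤ K x y) (hs : 0 < s)
    (hf : ∀ k ∈ S, Antitone (f k))
    (hL : ∀ k ∈ S, ∀ a b : ι → Bool, b ≤ a →
      f k b - f k a ≤ ∑ x, L k x * (spin (a x) - spin (b x)))
    (hw : ∀ x, w x + s * ∑ k ∈ S, L k x ≤ v x) :
    ∑ k ∈ S, gibbsMean (pairEnergy K v) (f k) - ∑ k ∈ S, gibbsMean (pairEnergy K u) (f k)
      ≤ 2 * (∑ x, |u x - w x|) / s := by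
  set F : (ι → Bool) → ℝ := fun σ => s * ∑ k ∈ S, -f k σ with hF
  have h1 := gibbsMean_le_gibbsMean_tilt (abs_pairEnergy_sub_le K u w) F
  have hmean : ∀ G, gibbsMean G F = -(s * ∑ k ∈ S, gibbsMean G (f k)) := fun G => by
    rw [hF, gibbsMean_const_mul, gibbsMean_sum]
    simp only [gibbsMean_neg, Finset.sum_neg_distrib, mul_neg]
  have hFL : ∀ a b : ι → Bool, b ≤ a →
      F a - F b ≤ ∑ x, (s * ∑ k ∈ S, L k x) * (spin (a x) - spin (b x)) := by
    intro a b hab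
    have e1 : F a - F b = s * ∑ k ∈ S, (f k b - f k a) := by
      simp only [hF, Finset.sum_neg_distrib, Finset.sum_sub_distrib]; ring
    have e2 : ∑ x, (s * ∑ k ∈ S, L k x) * (spin (a x) - spin (b x))
        = s * ∑ k ∈ S, ∑ x, L k x * (spin (a x) - spin (b x)) := by
      rw [Finset.sum_comm, Finset.mul_sum]
      exact Finset.sum_congr rfl fun x _ => by rw [mul_assoc, Finset.sum_mul]
    rw [e1, e2]
    exact mul_le_mul_of_nonneg_left (Finset.sum_le_sum fun k hk => hL k hk a b hab) hs.le
  have hFm : Monotone F := by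
    intro a b hab
    refine mul_le_mul_of_nonneg_left (Finset.sum_le_sum fun k hk => ?_) hs.le
    exact neg_le_neg (hf k hk hab)
  have h2 := gibbsMean_tilt_le hK hw hFL hFm
  rw [hmean] at h1 h2
  rw [hmean] at h2
  rw [hmean] at h1
  rw [le_div_iff₀ hs]
  linarith

/-- The same argument with the order of the spins reversed; the tilt now favours minus spins. -/
lemma sum_gibbsMean_sub_le_of_le_field (hK : ∀ x y, 0 ≤ K x y) (hs : 0 < s)
    (hf : ∀ k ∈ S, Antitone (f k))
    (hL : ∀ k ∈ S, ∀ a b : ι → Bool, b ≤ a →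
      f k b - f k a ≤ ∑ x, L k x * (spin (a x) - spin (b x)))
    (hw : ∀ x, v x + s * ∑ k ∈ S, L k x ≤ w x) :
    ∑ k ∈ S, gibbsMean (pairEnergy K u) (f k) - ∑ k ∈ S, gibbsMean (pairEnergy K v) (f k)
      ≤ 2 * (∑ x, |u x - w x|) / s := by
  set F : (ι → Bool) → ℝ := fun σ => s * ∑ k ∈ S, f k σ with hF
  have h1 := gibbsMean_le_gibbsMean_tilt (abs_pairEnergy_sub_le K u w) F
  have hmean : ∀ G, gibbsMean G F = s * ∑ k ∈ S, gibbsMean G (f k) := fun G => by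
    rw [hF, gibbsMean_const_mul, gibbsMean_sum]
  have hFL : ∀ a b : ι → Bool, b ≤ a →
      F b - F a ≤ ∑ x, (s * ∑ k ∈ S, L k x) * (spin (a x) - spin (b x)) := by
    intro a b hab
    have e1 : F b - F a = s * ∑ k ∈ S, (f k b - f k a) := by
      simp only [hF, Finset.sum_sub_distrib]; ring
    have e2 : ∑ x, (s * ∑ k ∈ S, L k x) * (spin (a x) - spin (b x))
        = s * ∑ k ∈ S, ∑ x, L k x * (spin (a x) - spin (b x)) := by
      rw [Finset.sum_comm, Finset.mul_sum]
      exact Finset.sum_congr rfl fun x _ => by rw [mul_assoc, Finset.sum_mul]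
    rw [e1, e2]
    exact mul_le_mul_of_nonneg_left (Finset.sum_le_sum fun k hk => hL k hk a b hab) hs.le
  have hFm : Monotone fun σ => -F σ := by
    intro a b hab
    exact neg_le_neg (mul_le_mul_of_nonneg_left (Finset.sum_le_sum fun k hk => hf k hk hab) hs.le)
  have h2 := le_gibbsMean_tilt hK hw hFL hFm
  rw [gibbsMean_neg, gibbsMean_neg] at h2
  rw [hmean] at h1 h2
  rw [hmean] at h2
  rw [hmean] at h1
  rw [le_div_iff₀ hs]
  linarith

end Wetting

/-! ### Surface terms -/

section Surface

variable {J α : ℝ}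

variable (J α) in
/-- The total coupling of `x` to the sites outside `Λ`. -/
def outerCoupling (Λ : Finset Site) (x : Site) : ℝ :=
  ∑' y, coupling J α x y * if y ∈ Λ then 0 else 1

lemma summable_outerCoupling (hJ : 0 ≤ J) (hα : 2 < α) (Λ : Finset Site) (x : Site) :
    Summable fun y => coupling J α x y * if y ∈ Λ then 0 else 1 :=
  summable_coupling_mul (C := 1) hJ hα x fun y => by split_ifs <;> simp

lemma outerCoupling_nonneg (hJ : 0 ≤ J) (Λ : Finset Site) (x : Site) :
    0 ≤ outerCoupling J α Λ x :=
  tsum_nonneg fun y => mul_nonneg (coupling_nonneg hJ x y) (by split_ifs <;> simp)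

lemma outerCoupling_le (hJ : 0 ≤ J) (hα : 2 < α) (Λ : Finset Site) (x : Site) :
    outerCoupling J α Λ x ≤ totalCoupling J α := by
  rw [← tsum_coupling x]
  refine (summable_outerCoupling hJ hα Λ x).tsum_le_tsum (fun y => ?_) (summable_coupling hJ hα x)
  exact mul_le_of_le_one_right (coupling_nonneg hJ x y) (by split_ifs <;> simp)

/-- The coupling between a large box and its complement is small compared to its volume. -/
lemma exists_sum_outerCoupling_le (hJ : 0 ≤ J) (hα : 2 < α) {ε : ℝ} (hε : 0 < ε) :
    ∃ N₀ : ℕ, ∀ N ≥ N₀, ∑ x ∈ box N, outerCoupling J α (box N) x ≤ ε * (N : ℝ) ^ 2 := by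
  have hsum := summable_coupling_zero hJ hα
  set T := totalCoupling J α with hT
  have hT0 : 0 ≤ T := totalCoupling_nonneg hJ
  -- Up to `ε / 2` the coupling has finite range `r`. Sites deeper than `r` inside the box feel at
  -- most this tail from outside.
  obtain ⟨S, hS⟩ : ∃ S : Finset Site, ∑' y, coupling J α 0 y - ∑ y ∈ S, coupling J α 0 y ≤ ε / 2 := by
    have := hsum.hasSum.eventually (lt_mem_nhds (sub_lt_self _ (half_pos hε)))
    obtain ⟨S, hS⟩ := this.exists
    exact ⟨S, by linarith⟩
  set r : ℕ := ∑ p ∈ S, (p.1.natAbs + p.2.natAbs) with hr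
  have hrS : ∀ p ∈ S, |p.1| ≤ r ∧ |p.2| ≤ r := by
    intro p hp
    have := Finset.single_le_sum (f := fun p : Site => p.1.natAbs + p.2.natAbs)
      (fun _ _ => Nat.zero_le _) hp
    rw [Int.abs_eq_natAbs, Int.abs_eq_natAbs]
    constructor <;> exact_mod_cast by omega
  -- The four boundary strips contain at most `4 * r * N` sites, each with outer coupling at most
  -- `T`. This is at most `ε / 2 * N ^ 2` once `8 * r * T ≤ ε * N`.
  obtain ⟨N₁, hN₁⟩ := exists_nat_ge (8 * r * T / ε)
  refine ⟨N₁, fun N hN => ?_⟩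
  have hdeep : ∀ x : Site, (r : ℤ) ≤ x.1 → x.1 < N - r → (r : ℤ) ≤ x.2 → x.2 < N - r →
      outerCoupling J α (box N) x ≤ ε / 2 := by
    intro x h1 h2 h3 h4
    have e : outerCoupling J α (box N) x
        = ∑' z, coupling J α 0 z * (if z + x ∈ box N then 0 else 1) := by
      rw [outerCoupling, ← (Equiv.addRight x).tsum_eq]
      refine tsum_congr fun z => ?_
      rw [Equiv.coe_addRight, coupling_eq_zero_sub x, add_sub_cancel_right]
    have hs2 : Summable fun z => coupling J α 0 z * (if z + x ∈ box N then 0 else 1) :=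
      summable_coupling_mul (C := 1) hJ hα 0 fun y => by split_ifs <;> simp
    have hs3 : Summable fun z => if z ∈ S then coupling J α 0 z else 0 :=
      summable_of_ne_finset_zero (s := S) fun z hz => by simp [hz]
    have e3 : ∑' z, (if z ∈ S then coupling J α 0 z else 0) = ∑ z ∈ S, coupling J α 0 z := by
      rw [tsum_eq_sum (s := S) fun z hz => by simp [hz]]
      exact Finset.sum_congr rfl fun z hz => by simp [hz]
    have : ∑' z, coupling J α 0 z * (if z + x ∈ box N then 0 else 1)
        + ∑' z, (if z ∈ S then coupling J α 0 z else 0) ≤ ∑' z, coupling J α 0 z := by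
      rw [← hs2.tsum_add hs3]
      refine (hs2.add hs3).tsum_le_tsum (fun z => ?_) hsum
      by_cases hz : z ∈ S
      · have hb : z + x ∈ box N := by
          have := hrS z hz
          rw [abs_le, abs_le] at this
          rw [mem_box]
          unfold InBox
          simp only [Prod.fst_add, Prod.snd_add]
          omega
        simp [hz, hb]
      · simp only [hz, if_false, add_zero]
        exact mul_le_of_le_one_right (coupling_nonneg hJ 0 z) (by split_ifs <;> simp)
    rw [e]; linarith
  set P : Site → Prop := fun x => (r : ℤ) ≤ x.1 ∧ x.1 < N - r ∧ (r : ℤ) ≤ x.2 ∧ x.2 < N - r with hP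
  have hpt : ∀ x ∈ box N, outerCoupling J α (box N) x ≤ ε / 2 + T * (
      ((if x.1 < r then 1 else 0) + (if (N : ℤ) - r ≤ x.1 then 1 else 0))
      + ((if x.2 < r then 1 else 0) + (if (N : ℤ) - r ≤ x.2 then 1 else 0))) := by
    intro x _
    by_cases hx : P x
    · refine (hdeep x hx.1 hx.2.1 hx.2.2.1 hx.2.2.2).trans ?_
      refine le_add_of_nonneg_right (mul_nonneg hT0 ?_)
      split_ifs <;> norm_num
    · refine (outerCoupling_le hJ hα _ x).trans ?_
      rw [← hT]
      have h1 : (1 : ℝ) ≤ ((if x.1 < r then 1 else 0) + (if (N : ℤ) - r ≤ x.1 then 1 else 0))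
          + ((if x.2 < r then 1 else 0) + (if (N : ℤ) - r ≤ x.2 then 1 else 0)) := by
        simp only [hP, not_and_or, not_le, not_lt] at hx
        rcases hx with h | h | h | h <;> simp only [h, if_true] <;> split_ifs <;> norm_num
      nlinarith
  refine (Finset.sum_le_sum hpt).trans ?_
  have hcard : ∀ (Q : ℤ → Prop) [DecidablePred Q], (∀ S' : Finset ℤ, S' = (Finset.Ico 0 (N : ℤ)).filter Q →
      S'.card ≤ r) → ∑ a ∈ Finset.Ico 0 (N : ℤ), (if Q a then (1 : ℝ) else 0) ≤ r := by
    intro Q _ hQ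
    rw [Finset.sum_boole]
    exact_mod_cast hQ _ rfl
  have hlow : ∑ a ∈ Finset.Ico 0 (N : ℤ), (if a < r then (1 : ℝ) else 0) ≤ r := by
    refine hcard (fun a => a < r) fun S' hS' => ?_
    rw [hS']
    refine (Finset.card_le_card (t := Finset.Ico 0 (r : ℤ)) fun a ha => ?_).trans (by simp)
    simp only [Finset.mem_filter, Finset.mem_Ico] at ha ⊢
    omega
  have hhigh : ∑ a ∈ Finset.Ico 0 (N : ℤ), (if (N : ℤ) - r ≤ a then (1 : ℝ) else 0) ≤ r := by
    refine hcard (fun a => (N : ℤ) - r ≤ a) fun S' hS' => ?_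
    rw [hS']
    refine (Finset.card_le_card (t := Finset.Ico ((N : ℤ) - r) N) fun a ha => ?_).trans (by simp)
    simp only [Finset.mem_filter, Finset.mem_Ico] at ha ⊢
    omega
  have hsum1 : ∑ x ∈ box N, (((if x.1 < (r : ℤ) then (1 : ℝ) else 0)
      + (if (N : ℤ) - r ≤ x.1 then 1 else 0))
      + ((if x.2 < (r : ℤ) then 1 else 0) + (if (N : ℤ) - r ≤ x.2 then 1 else 0))) ≤ N * (4 * r) := by
    have hfst : ∀ g : ℤ → ℝ, ∑ x ∈ box N, g x.1 = N * ∑ a ∈ Finset.Ico 0 (N : ℤ), g a := fun g => by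
      rw [box, Finset.sum_product, Finset.mul_sum]
      simp
    have hsnd : ∀ g : ℤ → ℝ, ∑ x ∈ box N, g x.2 = N * ∑ a ∈ Finset.Ico 0 (N : ℤ), g a := fun g => by
      rw [box, Finset.sum_product]
      simp
    simp only [Finset.sum_add_distrib]
    rw [hfst fun a => if a < r then 1 else 0, hfst fun a => if (N : ℤ) - r ≤ a then 1 else 0,
      hsnd fun a => if a < r then 1 else 0, hsnd fun a => if (N : ℤ) - r ≤ a then 1 else 0]
    have hN0 : (0 : ℝ) ≤ N := Nat.cast_nonneg N
    nlinarith
  rw [Finset.sum_add_distrib, ← Finset.mul_sum]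
  have hboxcard : ∑ x ∈ box N, ε / 2 = ε / 2 * (N : ℝ) ^ 2 := by
    rw [Finset.sum_const, box, Finset.card_product, Int.card_Ico, nsmul_eq_mul]
    simp only [sub_zero, Int.toNat_natCast]
    push_cast; ring
  rw [hboxcard]
  have hNN : 8 * r * T ≤ ε * N := by
    have : 8 * r * T / ε ≤ N := hN₁.trans (by exact_mod_cast hN)
    rwa [div_le_iff₀ hε, mul_comm _ ε] at this
  have := mul_le_mul_of_nonneg_left hsum1 hT0
  have hN0 : (0 : ℝ) ≤ N := Nat.cast_nonneg N
  nlinarith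

end Surface

/-! ### The effect of one even spin on the other spins -/

section SpinEffect

variable {J α : ℝ}

variable (J α) in
/-- The interaction of the spins in `V` with a plus spin at `e`. -/
def siteInteraction (V : Finset Site) (e : Site) (σ : V → Bool) : ℝ :=
  ∑ x : V, coupling J α x e * spin (σ x)

variable (J α) in
/-- The change of the Boltzmann weight under the reversal of a plus spin at `e`. -/
def reversalFactor (β : ℝ) (V : Finset Site) (e : Site) (σ : V → Bool) : ℝ :=
  Real.exp (-(2 * β * siteInteraction J α V e σ))

lemma abs_siteInteraction_le (hJ : 0 ≤ J) (hα : 2 < α) (V : Finset Site) (e : Site)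
    (σ : V → Bool) : |siteInteraction J α V e σ| ≤ totalCoupling J α := by
  refine (Finset.abs_sum_le_sum_abs _ _).trans ?_
  refine le_trans (le_of_eq ?_) (sum_coupling_le hJ hα e V)
  rw [← Finset.sum_coe_sort V]
  refine Finset.sum_congr rfl fun x _ => ?_
  rw [abs_mul, abs_spin, mul_one, abs_of_nonneg (coupling_nonneg hJ _ _), coupling_comm]

lemma siteInteraction_sub (V : Finset Site) (e : Site) (a b : V → Bool) :
    siteInteraction J α V e a - siteInteraction J α V e b
      = ∑ x : V, coupling J α x e * (spin (a x) - spin (b x)) := by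
  simp only [siteInteraction, mul_sub, Finset.sum_sub_distrib]

lemma siteInteraction_mono (hJ : 0 ≤ J) (V : Finset Site) (e : Site) :
    Monotone (siteInteraction J α V e) := fun _ _ hab =>
  Finset.sum_le_sum fun x _ => mul_le_mul_of_nonneg_left (spin_mono (hab x)) (coupling_nonneg hJ _ _)

variable {β : ℝ}

lemma reversalFactor_antitone (hJ : 0 ≤ J) (hβ : 0 ≤ β) (V : Finset Site) (e : Site) :
    Antitone (reversalFactor J α β V e) := fun a b hab => by
  refine Real.exp_le_exp.2 (neg_le_neg ?_)
  exact mul_le_mul_of_nonneg_left (siteInteraction_mono hJ V e hab) (by positivity)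

lemma reversalFactor_le (hJ : 0 ≤ J) (hα : 2 < α) (hβ : 0 ≤ β) (V : Finset Site) (e : Site)
    (σ : V → Bool) : reversalFactor J α β V e σ ≤ Real.exp (2 * β * totalCoupling J α) := by
  refine Real.exp_le_exp.2 ?_
  have := mul_le_mul_of_nonneg_left (abs_le.1 (abs_siteInteraction_le hJ hα V e σ)).1
    (by positivity : 0 ≤ 2 * β)
  linarith

lemma le_reversalFactor (hJ : 0 ≤ J) (hα : 2 < α) (hβ : 0 ≤ β) (V : Finset Site) (e : Site)
    (σ : V → Bool) : Real.exp (-(2 * β * totalCoupling J α)) ≤ reversalFactor J α β V e σ := by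
  refine Real.exp_le_exp.2 (neg_le_neg ?_)
  exact mul_le_mul_of_nonneg_left (abs_le.1 (abs_siteInteraction_le hJ hα V e σ)).2 (by positivity)

/-- The larger factor times `1 - exp (-t)`, bounded by `t`. These are the Lipschitz constants that
enter the tilt. -/
lemma reversalFactor_sub_le (hJ : 0 ≤ J) (hα : 2 < α) (hβ : 0 ≤ β) (V : Finset Site) (e : Site)
    (a b : V → Bool) (hab : b ≤ a) :
    reversalFactor J α β V e b - reversalFactor J α β V e a
      ≤ ∑ x : V, (2 * β * Real.exp (2 * β * totalCoupling J α) * coupling J α x e)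
          * (spin (a x) - spin (b x)) := by
  have h1 : ∑ x : V, (2 * β * Real.exp (2 * β * totalCoupling J α) * coupling J α x e)
          * (spin (a x) - spin (b x))
      = Real.exp (2 * β * totalCoupling J α) * (2 * β *
          (siteInteraction J α V e a - siteInteraction J α V e b)) := by
    rw [siteInteraction_sub, Finset.mul_sum, Finset.mul_sum]
    exact Finset.sum_congr rfl fun x _ => by ring
  set A := siteInteraction J α V e a with hA
  set B := siteInteraction J α V e b with hB
  have hBA : B ≤ A := siteInteraction_mono hJ V e hab
  have h2 : reversalFactor J α β V e b - reversalFactor J α β V e a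
      = reversalFactor J α β V e b * (1 - Real.exp (-(2 * β * (A - B)))) := by
    simp only [reversalFactor, mul_sub, mul_one, ← Real.exp_add, ← hA, ← hB]
    congr 2; ring
  rw [h1, h2]
  have h3 := Real.add_one_le_exp (-(2 * β * (A - B)))
  have h4 : 0 ≤ 1 - Real.exp (-(2 * β * (A - B))) := by
    rw [sub_nonneg, Real.exp_le_one_iff, neg_nonpos]
    exact mul_nonneg (by positivity) (sub_nonneg.2 hBA)
  exact mul_le_mul (reversalFactor_le hJ hα hβ V e b) (by linarith) h4 (Real.exp_pos _).le

/-- The smaller factor times `exp t - 1`, bounded below by `t`, of which only the contribution of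
one site `c` is kept. -/
lemma le_reversalFactor_sub (hJ : 0 ≤ J) (hα : 2 < α) (hβ : 0 ≤ β) (V : Finset Site) (e : Site)
    (c : V) (a b : V → Bool) (hab : b ≤ a) :
    2 * β * Real.exp (-(2 * β * totalCoupling J α)) * coupling J α c e
        * (spin (a c) - spin (b c))
      ≤ reversalFactor J α β V e b - reversalFactor J α β V e a := by
  have h0 : coupling J α c e * (spin (a c) - spin (b c))
      ≤ siteInteraction J α V e a - siteInteraction J α V e b := by
    rw [siteInteraction_sub]
    exact Finset.single_le_sum (f := fun x : V => coupling J α x e * (spin (a x) - spin (b x)))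
      (fun x _ => mul_nonneg (coupling_nonneg hJ _ _) (sub_nonneg.2 (spin_mono (hab x))))
      (Finset.mem_univ c)
  set A := siteInteraction J α V e a with hA
  set B := siteInteraction J α V e b with hB
  have hBA : B ≤ A := siteInteraction_mono hJ V e hab
  have h2 : reversalFactor J α β V e b - reversalFactor J α β V e a
      = reversalFactor J α β V e a * (Real.exp (2 * β * (A - B)) - 1) := by
    simp only [reversalFactor, mul_sub, mul_one, ← Real.exp_add, ← hA, ← hB]
    congr 2; ring
  rw [h2]
  have h3 := Real.add_one_le_exp (2 * β * (A - B))
  have h5 : 0 ≤ 2 * β * (A - B) := mul_nonneg (by positivity) (sub_nonneg.2 hBA)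
  calc 2 * β * Real.exp (-(2 * β * totalCoupling J α)) * coupling J α c e
        * (spin (a c) - spin (b c))
      = Real.exp (-(2 * β * totalCoupling J α)) * (2 * β *
          (coupling J α c e * (spin (a c) - spin (b c)))) := by ring
    _ ≤ Real.exp (-(2 * β * totalCoupling J α)) * (2 * β * (A - B)) := by gcongr
    _ ≤ reversalFactor J α β V e a * (Real.exp (2 * β * (A - B)) - 1) :=
        mul_le_mul (le_reversalFactor hJ hα hβ V e a) (by linarith) h5 (Real.exp_pos _).le

lemma volCoupling_nonneg (hJ : 0 ≤ J) (hβ : 0 ≤ β) (V : Finset Site) (x y : V) :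
    0 ≤ volCoupling J α β V x y := mul_nonneg hβ (coupling_nonneg hJ _ _)

/-- A larger boundary condition decreases the expected reversal factor, at least in proportion to
the increase of the magnetization. -/
lemma le_gibbsMean_reversalFactor_sub (hJ : 0 ≤ J) (hα : 2 < α) (hβ : 0 ≤ β) (V : Finset Site)
    (e : Site) (c : V) {η η' : Config} (h : ∀ y ∉ V, η y ≤ η' y) :
    2 * β * Real.exp (-(2 * β * totalCoupling J α)) * coupling J α c e
        * (gibbsMean (volEnergy J α β V η') (fun σ => spin (σ c))
          - gibbsMean (volEnergy J α β V η) (fun σ => spin (σ c)))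
      ≤ gibbsMean (volEnergy J α β V η) (reversalFactor J α β V e)
        - gibbsMean (volEnergy J α β V η') (reversalFactor J α β V e) := by
  set C := 2 * β * Real.exp (-(2 * β * totalCoupling J α)) * coupling J α c e with hC
  -- The factor decreases fast enough to remain decreasing after a multiple of the spin at `c` is
  -- added; monotonicity in the field then transfers the difference of magnetizations.
  have hm : Monotone fun σ : V → Bool => -reversalFactor J α β V e σ + -(C * spin (σ c)) := by
    intro b a hab
    have := le_reversalFactor_sub hJ hα hβ V e c a b hab
    rw [← hC] at this
    simp only
    linarith
  have h1 := gibbsMean_pairEnergy_mono (volCoupling_nonneg (α := α) hJ hβ V)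
    (h₁ := fun x : V => β * fieldAt J α V η x) (h₂ := fun x : V => β * fieldAt J α V η' x)
    (fun x => mul_le_mul_of_nonneg_left (fieldAt_mono hJ hα h _) hβ) hm
  simp only [gibbsMean_add, gibbsMean_neg, gibbsMean_const_mul] at h1
  simp only [volEnergy]
  linarith

lemma gibbsMean_reversalFactor_anti (hJ : 0 ≤ J) (hα : 2 < α) (hβ : 0 ≤ β) (V : Finset Site)
    (e : Site) {η η' : Config} (h : ∀ y ∉ V, η y ≤ η' y) :
    gibbsMean (volEnergy J α β V η') (reversalFactor J α β V e)
      ≤ gibbsMean (volEnergy J α β V η) (reversalFactor J α β V e) := by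
  have hm : Monotone fun σ : V → Bool => -reversalFactor J α β V e σ := fun b a hab =>
    neg_le_neg (reversalFactor_antitone hJ hβ V e hab)
  have h1 := gibbsMean_pairEnergy_mono (volCoupling_nonneg (α := α) hJ hβ V)
    (h₁ := fun x : V => β * fieldAt J α V η x) (h₂ := fun x : V => β * fieldAt J α V η' x)
    (fun x => mul_le_mul_of_nonneg_left (fieldAt_mono hJ hα h _) hβ) hm
  simp only [gibbsMean_neg] at h1
  simp only [volEnergy]
  linarith

/-- Distances between distinct sites are at least 1, so the triangle inequality bounds the ratio of
the distances of `x` to `b` and to `a` by `1 + siteDist a b`. The case `x = b` must be excluded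
because the coupling vanishes there. -/
lemma coupling_le_mul_coupling (hJ : 0 ≤ J) (hα : 0 ≤ α) {x a b : Site} (hxb : x ≠ b) :
    coupling J α x a ≤ (1 + siteDist a b) ^ α * coupling J α x b := by
  have hD : 0 ≤ siteDist a b := siteDist_nonneg a b
  by_cases hxa : x = a
  · subst hxa
    rw [coupling_self]
    exact mul_nonneg (Real.rpow_nonneg (by linarith) _) (coupling_nonneg hJ _ _)
  · have h1 := one_le_siteDist hxa
    have h2 := one_le_siteDist hxb
    have h3 := siteDist_triangle x a b
    rw [coupling, if_neg hxa, coupling, if_neg hxb]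
    have h4 : siteDist x b ≤ (1 + siteDist a b) * siteDist x a := by nlinarith
    have h5 : ((1 + siteDist a b) * siteDist x a) ^ (-α) ≤ siteDist x b ^ (-α) :=
      Real.rpow_le_rpow_of_nonpos (by linarith) h4 (by linarith)
    rw [Real.mul_rpow (by linarith) (by linarith)] at h5
    have h6 : (1 + siteDist a b) ^ α * (1 + siteDist a b) ^ (-α) = 1 := by
      rw [← Real.rpow_add (by linarith), add_neg_cancel, Real.rpow_zero]
    calc J * siteDist x a ^ (-α)
        = (1 + siteDist a b) ^ α * (J * ((1 + siteDist a b) ^ (-α) * siteDist x a ^ (-α))) := by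
          linear_combination -J * siteDist x a ^ (-α) * h6
      _ ≤ (1 + siteDist a b) ^ α * (J * siteDist x b ^ (-α)) := by
          gcongr

/-- Turning a minus spin at `y` into plus raises the field at `x` by twice the coupling; all other
changes have the same sign. -/
lemma fieldAt_add_le (hJ : 0 ≤ J) (hα : 2 < α) {Λ S : Finset Site} {p q : Config} (b : Bool)
    (hpq : p ≤ q) (hS : ∀ y ∈ S, y ∈ Λ ∧ IsEvenSite y ∧ p y = false ∧ q y = true) (x : Site) :
    fieldAt J α (internal Λ) (withBoundary Λ p b) x + 2 * ∑ y ∈ S, coupling J α x y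
      ≤ fieldAt J α (internal Λ) (withBoundary Λ q b) x := by
  have h1 := summable_fieldAt hJ hα (internal Λ) (withBoundary Λ p b) x
  have h2 := summable_fieldAt hJ hα (internal Λ) (withBoundary Λ q b) x
  have h3 : ∀ y, 0 ≤ coupling J α x y * offSpin (internal Λ) (withBoundary Λ q b) y
      - coupling J α x y * offSpin (internal Λ) (withBoundary Λ p b) y := by
    intro y
    rw [← mul_sub]
    refine mul_nonneg (coupling_nonneg hJ x y) (sub_nonneg.2 ?_)
    rw [offSpin_withBoundary, offSpin_withBoundary]
    split_ifs
    · exact spin_mono (hpq y)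
    · exact le_rfl
    · exact le_rfl
  have h4 := (h2.sub h1).sum_le_tsum S (fun y _ => h3 y)
  rw [h2.tsum_sub h1] at h4
  have h5 : ∑ y ∈ S, (coupling J α x y * offSpin (internal Λ) (withBoundary Λ q b) y
      - coupling J α x y * offSpin (internal Λ) (withBoundary Λ p b) y)
      = 2 * ∑ y ∈ S, coupling J α x y := by
    rw [Finset.mul_sum]
    refine Finset.sum_congr rfl fun y hy => ?_
    obtain ⟨hy1, hy2, hy3, hy4⟩ := hS y hy
    rw [offSpin_withBoundary, offSpin_withBoundary, if_pos hy1, if_pos hy2, if_pos hy1,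
      if_pos hy2, hy3, hy4]
    simp only [spin]
    norm_num
    ring
  rw [h5] at h4
  unfold fieldAt
  linarith

lemma fieldAt_boundary_sub (hJ : 0 ≤ J) (hα : 2 < α) (Λ : Finset Site) (p : Config) (x : Site) :
    fieldAt J α (internal Λ) (withBoundary Λ p true) x
      - fieldAt J α (internal Λ) (withBoundary Λ p false) x = 2 * outerCoupling J α Λ x := by
  unfold fieldAt outerCoupling
  rw [← (summable_fieldAt hJ hα _ _ x).tsum_sub (summable_fieldAt hJ hα _ _ x), ← tsum_mul_left]
  refine tsum_congr fun y => ?_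
  rw [offSpin_withBoundary, offSpin_withBoundary]
  split_ifs <;> simp [spin]
  ring

end SpinEffect

/-! ### The block structure -/

section Blocks

/-- The center of the block `k`. -/
def blockCenter (m : ℕ) (k : Site) : Site := (8 * m * k.1 + 4 * m, 8 * m * k.2 + 4 * m)

/-- The site of the block `k` where a plus spin of the alternating configuration is reversed. -/
def minusSite (m : ℕ) (k : Site) : Site := (8 * m * k.1, 8 * m * k.2)

/-- The site of the block `k` where a minus spin of the alternating configuration is reversed. -/
def plusSite (m : ℕ) (k : Site) : Site := (8 * m * k.1 + 2, 8 * m * k.2)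

/-- The alternating configuration with a sparse set of plus spins reversed. -/
def pattMinus (m : ℕ) : Config := fun y =>
  if (8 * m : ℤ) ∣ y.1 ∧ (8 * m : ℤ) ∣ y.2 then false else altSpin y

/-- The alternating configuration with a sparse set of minus spins reversed. -/
def pattPlus (m : ℕ) : Config := fun y =>
  if (8 * m : ℤ) ∣ y.1 - 2 ∧ (8 * m : ℤ) ∣ y.2 then true else altSpin y

lemma pattMinus_le (m : ℕ) : pattMinus m ≤ altSpin := by
  intro y
  unfold pattMinus
  split_ifs
  · exact Bool.false_le _
  · exact le_rfl

lemma le_pattPlus (m : ℕ) : altSpin ≤ pattPlus m := by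
  intro y
  unfold pattPlus
  split_ifs
  · exact Bool.le_true _
  · exact le_rfl

lemma altSpin_minusSite (m : ℕ) (k : Site) : altSpin (minusSite m k) = true := by
  have h1 : 8 * (m : ℤ) * k.1 / 2 = 2 * (2 * m * k.1) := by
    rw [show 8 * (m : ℤ) * k.1 = 2 * (2 * (2 * m * k.1)) by ring]; omega
  have h2 : 8 * (m : ℤ) * k.2 / 2 = 2 * (2 * m * k.2) := by
    rw [show 8 * (m : ℤ) * k.2 = 2 * (2 * (2 * m * k.2)) by ring]; omega
  simp only [altSpin, minusSite, h1, h2, decide_eq_true_eq, Int.even_iff]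
  omega

lemma altSpin_plusSite (m : ℕ) (k : Site) : altSpin (plusSite m k) = false := by
  have h1 : (8 * (m : ℤ) * k.1 + 2) / 2 = 2 * (2 * m * k.1) + 1 := by
    rw [show 8 * (m : ℤ) * k.1 = 2 * (2 * (2 * m * k.1)) by ring]; omega
  have h2 : 8 * (m : ℤ) * k.2 / 2 = 2 * (2 * m * k.2) := by
    rw [show 8 * (m : ℤ) * k.2 = 2 * (2 * (2 * m * k.2)) by ring]; omega
  simp only [altSpin, plusSite, h1, h2, decide_eq_false_iff_not, Int.even_iff]
  omega

lemma blockCenter_add_one (m : ℕ) (k : Site) :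
    blockCenter m k + (1, 1) = oddEmb (4 * m * k.1 + 2 * m, 4 * m * k.2 + 2 * m) := by
  simp only [blockCenter, oddEmb, Prod.mk_add_mk, Prod.mk.injEq]
  constructor <;> ring

lemma isEvenSite_blockCenter (m : ℕ) (k : Site) : IsEvenSite (blockCenter m k) := by
  constructor
  · exact ⟨4 * m * k.1 + 2 * m, by simp only [blockCenter]; ring⟩
  · exact ⟨4 * m * k.2 + 2 * m, by simp only [blockCenter]; ring⟩

lemma isEvenSite_minusSite (m : ℕ) (k : Site) : IsEvenSite (minusSite m k) := by
  constructor
  · exact ⟨4 * m * k.1, by simp only [minusSite]; ring⟩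
  · exact ⟨4 * m * k.2, by simp only [minusSite]; ring⟩

lemma isEvenSite_plusSite (m : ℕ) (k : Site) : IsEvenSite (plusSite m k) := by
  constructor
  · exact ⟨4 * m * k.1 + 1, by simp only [plusSite]; ring⟩
  · exact ⟨4 * m * k.2, by simp only [plusSite]; ring⟩

/-- A coordinate of a site in the block with index `i`. -/
lemma block_coord_bounds {m n : ℕ} {i j : ℤ} (hi : 0 ≤ i) (hin : i < n)
    (hj : 0 ≤ j) (hjm : j < 8 * m) :
    0 ≤ 8 * m * i + j ∧ 8 * (m : ℤ) * i + j < (2 * (4 * m * n) : ℕ) := by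
  have h1 : 0 ≤ (m : ℤ) * i := by positivity
  have h2 : (m : ℤ) * (i + 1) ≤ m * n := mul_le_mul_of_nonneg_left (by omega) (by positivity)
  push_cast
  constructor <;> nlinarith

lemma block_site_mem {m n : ℕ} {k j : Site} (hk : k ∈ box n) (hj : j ∈ box (8 * m)) :
    ((8 * m * k.1 + j.1, 8 * m * k.2 + j.2) : Site) ∈ box (2 * (4 * m * n)) := by
  rw [mem_box] at *
  obtain ⟨⟨h1, h2⟩, h3, h4⟩ := hk
  obtain ⟨⟨h5, h6⟩, h7, h8⟩ := hj
  push_cast at h6 h8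
  exact ⟨block_coord_bounds h1 h2 h5 h6, block_coord_bounds h3 h4 h7 h8⟩

variable {m n : ℕ}

lemma blockCenter_mem (hm : 1 ≤ m) {k : Site} (hk : k ∈ box n) :
    blockCenter m k ∈ box (2 * (4 * m * n)) :=
  block_site_mem (j := (4 * m, 4 * m)) hk (by rw [mem_box]; unfold InBox; push_cast; omega)

lemma minusSite_mem (hm : 1 ≤ m) {k : Site} (hk : k ∈ box n) :
    minusSite m k ∈ box (2 * (4 * m * n)) := by
  have := block_site_mem (m := m) (j := (0, 0)) hk
    (by simp [mem_box, InBox]; omega)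
  simpa [minusSite] using this

lemma plusSite_mem (hm : 1 ≤ m) {k : Site} (hk : k ∈ box n) :
    plusSite m k ∈ box (2 * (4 * m * n)) := by
  have := block_site_mem (m := m) (j := (2, 0)) hk
    (by simp [mem_box, InBox]; omega)
  simpa [plusSite] using this

lemma blockCenter_injective (hm : 1 ≤ m) : Function.Injective (blockCenter m) := by
  intro k k' h
  simp only [blockCenter, Prod.mk.injEq, add_left_inj] at h
  have h8 : (8 * m : ℤ) ≠ 0 := by positivity
  exact Prod.ext (mul_left_cancel₀ h8 h.1) (mul_left_cancel₀ h8 h.2)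

lemma minusSite_injective (hm : 1 ≤ m) : Function.Injective (minusSite m) := by
  intro k k' h
  simp only [minusSite, Prod.mk.injEq] at h
  have h8 : (8 * m : ℤ) ≠ 0 := by positivity
  exact Prod.ext (mul_left_cancel₀ h8 h.1) (mul_left_cancel₀ h8 h.2)

lemma plusSite_injective (hm : 1 ≤ m) : Function.Injective (plusSite m) := by
  intro k k' h
  simp only [plusSite, Prod.mk.injEq, add_left_inj] at h
  have h8 : (8 * m : ℤ) ≠ 0 := by positivity
  exact Prod.ext (mul_left_cancel₀ h8 h.1) (mul_left_cancel₀ h8 h.2)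

lemma siteDist_blockCenter_minusSite (m : ℕ) (k : Site) :
    siteDist (blockCenter m k) (minusSite m k) = siteDist (blockCenter m 0) (minusSite m 0) := by
  simp only [siteDist, blockCenter, minusSite]
  congr 1; push_cast; simp

lemma siteDist_blockCenter_plusSite (m : ℕ) (k : Site) :
    siteDist (blockCenter m k) (plusSite m k) = siteDist (blockCenter m 0) (plusSite m 0) := by
  simp only [siteDist, blockCenter, plusSite]
  congr 1; push_cast; simp

lemma pattMinus_minusSite (m : ℕ) (k : Site) : pattMinus m (minusSite m k) = false :=
  if_pos ⟨Dvd.intro _ rfl, Dvd.intro _ rfl⟩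

lemma pattPlus_plusSite (m : ℕ) (k : Site) : pattPlus m (plusSite m k) = true :=
  if_pos ⟨by simp [plusSite], Dvd.intro _ rfl⟩

end Blocks

/-! ### Choice of a block in which the dilute spins select the phase -/

section Selection

variable {J α β : ℝ}

variable (J α β) in
/-- The gap of the expected reversal factor between the two reference phases. -/
def phaseGap : ℝ := 2 * β * Real.exp (-(2 * β * totalCoupling J α)) * coupling J α 0 (1, 1)

lemma phaseGap_pos (hJ : 0 < J) (hβ : 0 < β) : 0 < phaseGap J α β := by
  have h1 : 0 < coupling J α 0 (1, 1) := coupling_pos hJ (by decide)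
  unfold phaseGap
  positivity

variable (J α β) in
/-- The expected reversal factor at the center of the block `k`, in the box with `n × n` blocks. -/
def blockMean (m n : ℕ) (k : Site) (p : Config) (b : Bool) : ℝ :=
  gibbsMean (volEnergy J α β (internal (box (2 * (4 * m * n))))
    (withBoundary (box (2 * (4 * m * n))) p b))
    (reversalFactor J α β (internal (box (2 * (4 * m * n)))) (blockCenter m k))

lemma blockCenter_add_one_mem {m n : ℕ} (hm : 1 ≤ m) {k : Site} (hk : k ∈ box n) :
    oddEmb (4 * m * k.1 + 2 * m, 4 * m * k.2 + 2 * m) ∈ internal (box (2 * (4 * m * n))) := by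
  rw [internal, Finset.mem_filter]
  refine ⟨?_, not_isEvenSite_oddEmb _⟩
  rw [← blockCenter_add_one]
  have := block_site_mem (m := m) (j := (4 * m + 1, 4 * m + 1)) hk
    (by simp [mem_box, InBox]; omega)
  simpa only [blockCenter, Prod.mk_add_mk, add_assoc] using this

/-- The site diagonally next to the block centre lies on the odd sublattice, and its magnetization
differs by at least 1 between the two phases. -/
lemma phaseGap_le_blockMean_sub (hJ : 0 < J) (hα : 2 < α) (hβ : 0 ≤ β)
    (hκ : 40 * Real.exp (-2 * (β * (J * 2 ^ (-α)))) ≤ 1) {m n : ℕ} (hm : 1 ≤ m) {k : Site}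
    (hk : k ∈ box n) :
    phaseGap J α β ≤ blockMean J α β m n k altSpin false - blockMean J α β m n k altSpin true := by
  have hp := blockCenter_add_one_mem hm hk
  obtain ⟨h1, h2⟩ := half_le_gibbsMean_reference hJ hα hβ hκ (4 * m * n) hp
  have h3 := le_gibbsMean_reversalFactor_sub hJ.le hα hβ (internal (box (2 * (4 * m * n))))
    (blockCenter m k) ⟨_, hp⟩ (η := withBoundary (box (2 * (4 * m * n))) altSpin false)
    (η' := withBoundary (box (2 * (4 * m * n))) altSpin true) (fun y _ => by
      unfold withBoundary
      split_ifs
      · exact le_rfl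
      · exact Bool.false_le _)
  refine le_trans ?_ h3
  have hc : coupling J α (oddEmb (4 * m * k.1 + 2 * m, 4 * m * k.2 + 2 * m)) (blockCenter m k)
      = coupling J α 0 (1, 1) := by
    rw [← blockCenter_add_one, coupling_comm, coupling_eq_zero_sub, add_sub_cancel_left]
  simp only
  rw [hc, ← phaseGap]
  have h0 : 0 ≤ phaseGap J α β := by
    unfold phaseGap
    exact mul_nonneg (by positivity) (coupling_nonneg hJ.le _ _)
  nlinarith

variable (J α β) in
/-- The strength with which the dilute spins bound the reversal factors. -/
def tiltStrength (m : ℕ) : ℝ :=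
  Real.exp (-(2 * β * totalCoupling J α))
    / (1 + siteDist (blockCenter m 0) (minusSite m 0) + siteDist (blockCenter m 0) (plusSite m 0)) ^ α

lemma tiltStrength_pos (m : ℕ) : 0 < tiltStrength J α β m := by
  have h1 := siteDist_nonneg (blockCenter m 0) (minusSite m 0)
  have h2 := siteDist_nonneg (blockCenter m 0) (plusSite m 0)
  unfold tiltStrength
  positivity

/-- The definition of `tiltStrength` is made for this: its exponential cancels the Lipschitz
constant and its denominator pays for the distance from the block centre `e` to the reversed spin
`d`. -/
lemma tilt_mul_coupling_le (hJ : 0 ≤ J) (hα : 0 ≤ α) (hβ : 0 ≤ β) {m : ℕ} {x e d : Site}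
    (hxd : x ≠ d)
    (hd : siteDist e d ≤ siteDist (blockCenter m 0) (minusSite m 0)
      + siteDist (blockCenter m 0) (plusSite m 0)) :
    tiltStrength J α β m * (2 * β * Real.exp (2 * β * totalCoupling J α) * coupling J α x e)
      ≤ β * (2 * coupling J α x d) := by
  set R := (1 + siteDist (blockCenter m 0) (minusSite m 0)
    + siteDist (blockCenter m 0) (plusSite m 0)) ^ α with hR
  have h1 := siteDist_nonneg (blockCenter m 0) (minusSite m 0)
  have h2 := siteDist_nonneg (blockCenter m 0) (plusSite m 0)
  have hR0 : 0 < R := by positivity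
  have h3 : coupling J α x e ≤ R * coupling J α x d := by
    refine (coupling_le_mul_coupling hJ hα hxd).trans ?_
    refine mul_le_mul_of_nonneg_right ?_ (coupling_nonneg hJ _ _)
    exact Real.rpow_le_rpow (by linarith [siteDist_nonneg e d]) (by linarith) hα
  have h4 : tiltStrength J α β m
      * (2 * β * Real.exp (2 * β * totalCoupling J α) * coupling J α x e)
      = 2 * β * (coupling J α x e / R) := by
    have h5 : Real.exp (-(2 * β * totalCoupling J α)) * Real.exp (2 * β * totalCoupling J α) = 1 := by
      rw [← Real.exp_add, neg_add_cancel, Real.exp_zero]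
    unfold tiltStrength
    rw [← hR]
    field_simp
    linear_combination β * coupling J α x e * h5
  rw [h4]
  have h6 : coupling J α x e / R ≤ coupling J α x d := by
    rw [div_le_iff₀ hR0]; linarith
  nlinarith

/-- The energetic price of exchanging the boundary condition, a surface term. -/
lemma sum_abs_field_sub (hJ : 0 ≤ J) (hα : 2 < α) (hβ : 0 ≤ β) (Λ : Finset Site) (p : Config)
    (b : Bool) :
    ∑ x : internal Λ, |β * fieldAt J α (internal Λ) (withBoundary Λ p b) x
        - β * fieldAt J α (internal Λ) (withBoundary Λ p !b) x|
      ≤ 2 * β * ∑ x ∈ Λ, outerCoupling J α Λ x := by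
  have h : ∀ x : internal Λ, |β * fieldAt J α (internal Λ) (withBoundary Λ p b) x
        - β * fieldAt J α (internal Λ) (withBoundary Λ p !b) x|
      = 2 * β * outerCoupling J α Λ x := by
    intro x
    have h1 := fieldAt_boundary_sub hJ hα Λ p x
    have h2 := outerCoupling_nonneg (α := α) hJ Λ x
    have h3 : 0 ≤ β * (2 * outerCoupling J α Λ x) := by positivity
    rw [← mul_sub]
    cases b
    · simp only [Bool.not_false]
      rw [← neg_sub, h1, mul_neg, abs_neg, abs_of_nonneg h3]; ring
    · simp only [Bool.not_true]
      rw [h1, abs_of_nonneg h3]; ring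
  rw [Finset.sum_congr rfl fun x _ => h x, ← Finset.mul_sum,
    Finset.sum_coe_sort (internal Λ) (outerCoupling J α Λ)]
  refine mul_le_mul_of_nonneg_left ?_ (by positivity)
  exact Finset.sum_le_sum_of_subset_of_nonneg (Finset.filter_subset _ _)
    fun x _ _ => outerCoupling_nonneg hJ Λ x

/-- The wetting estimate with `pattMinus` and plus boundary as `u`, `pattMinus` and minus boundary
as `w`, and the alternating minus phase as `v`. In each block the reversed spin pays for the tilt by
the observable of that block. -/
lemma sum_blockMean_minus (hJ : 0 < J) (hα : 2 < α) (hβ : 0 ≤ β) {m n : ℕ} (hm : 1 ≤ m) :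
    ∑ k ∈ box n, blockMean J α β m n k altSpin false
        - ∑ k ∈ box n, blockMean J α β m n k (pattMinus m) true
      ≤ 4 * β / tiltStrength J α β m
        * ∑ x ∈ box (2 * (4 * m * n)), outerCoupling J α (box (2 * (4 * m * n))) x := by
  set Λ := box (2 * (4 * m * n)) with hΛ
  have hs := tiltStrength_pos (J := J) (α := α) (β := β) m
  have h := sum_gibbsMean_sub_le_of_field_le (K := volCoupling J α β (internal Λ))
    (u := fun x => β * fieldAt J α (internal Λ) (withBoundary Λ (pattMinus m) true) x)
    (w := fun x => β * fieldAt J α (internal Λ) (withBoundary Λ (pattMinus m) false) x)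
    (v := fun x => β * fieldAt J α (internal Λ) (withBoundary Λ altSpin false) x)
    (S := box n) (f := fun k => reversalFactor J α β (internal Λ) (blockCenter m k))
    (L := fun k x => 2 * β * Real.exp (2 * β * totalCoupling J α) * coupling J α x (blockCenter m k))
    (s := tiltStrength J α β m)
    (volCoupling_nonneg hJ.le hβ _) hs
    (fun k _ => reversalFactor_antitone hJ.le hβ _ _)
    (fun k _ a b hab => reversalFactor_sub_le hJ.le hα hβ _ _ a b hab)
    (fun x => by
      have h1 := fieldAt_add_le hJ.le hα (Λ := Λ) (S := (box n).image (minusSite m)) false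
        (pattMinus_le m) (fun y hy => by
          obtain ⟨k, hk, rfl⟩ := Finset.mem_image.1 hy
          exact ⟨minusSite_mem hm hk, isEvenSite_minusSite m k, pattMinus_minusSite m k,
            altSpin_minusSite m k⟩) x
      rw [Finset.sum_image fun _ _ _ _ h => minusSite_injective hm h] at h1
      have h2 : tiltStrength J α β m * ∑ k ∈ box n,
          2 * β * Real.exp (2 * β * totalCoupling J α) * coupling J α x (blockCenter m k)
          ≤ β * (2 * ∑ k ∈ box n, coupling J α x (minusSite m k)) := by
        rw [Finset.mul_sum, Finset.mul_sum, Finset.mul_sum]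
        refine Finset.sum_le_sum fun k _ => tilt_mul_coupling_le hJ.le (by linarith) hβ ?_ ?_
        · intro hx
          exact not_isEvenSite_of_mem_internal x.2 (hx ▸ isEvenSite_minusSite m k)
        · rw [siteDist_blockCenter_minusSite]
          linarith [siteDist_nonneg (blockCenter m 0) (plusSite m 0)]
      have h3 := mul_le_mul_of_nonneg_left h1 hβ
      linarith)
  refine h.trans ?_
  have h4 := sum_abs_field_sub hJ.le hα hβ Λ (pattMinus m) true
  rw [div_mul_eq_mul_div]
  refine div_le_div_of_nonneg_right ?_ hs.le
  rw [Bool.not_true] at h4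
  linarith

lemma sum_blockMean_plus (hJ : 0 < J) (hα : 2 < α) (hβ : 0 ≤ β) {m n : ℕ} (hm : 1 ≤ m) :
    ∑ k ∈ box n, blockMean J α β m n k (pattPlus m) false
        - ∑ k ∈ box n, blockMean J α β m n k altSpin true
      ≤ 4 * β / tiltStrength J α β m
        * ∑ x ∈ box (2 * (4 * m * n)), outerCoupling J α (box (2 * (4 * m * n))) x := by
  set Λ := box (2 * (4 * m * n)) with hΛ
  have hs := tiltStrength_pos (J := J) (α := α) (β := β) m
  have h := sum_gibbsMean_sub_le_of_le_field (K := volCoupling J α β (internal Λ))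
    (u := fun x => β * fieldAt J α (internal Λ) (withBoundary Λ (pattPlus m) false) x)
    (w := fun x => β * fieldAt J α (internal Λ) (withBoundary Λ (pattPlus m) true) x)
    (v := fun x => β * fieldAt J α (internal Λ) (withBoundary Λ altSpin true) x)
    (S := box n) (f := fun k => reversalFactor J α β (internal Λ) (blockCenter m k))
    (L := fun k x => 2 * β * Real.exp (2 * β * totalCoupling J α) * coupling J α x (blockCenter m k))
    (s := tiltStrength J α β m)
    (volCoupling_nonneg hJ.le hβ _) hs
    (fun k _ => reversalFactor_antitone hJ.le hβ _ _)
    (fun k _ a b hab => reversalFactor_sub_le hJ.le hα hβ _ _ a b hab)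
    (fun x => by
      have h1 := fieldAt_add_le hJ.le hα (Λ := Λ) (S := (box n).image (plusSite m)) true
        (le_pattPlus m) (fun y hy => by
          obtain ⟨k, hk, rfl⟩ := Finset.mem_image.1 hy
          exact ⟨plusSite_mem hm hk, isEvenSite_plusSite m k, altSpin_plusSite m k,
            pattPlus_plusSite m k⟩) x
      rw [Finset.sum_image fun _ _ _ _ h => plusSite_injective hm h] at h1
      have h2 : tiltStrength J α β m * ∑ k ∈ box n,
          2 * β * Real.exp (2 * β * totalCoupling J α) * coupling J α x (blockCenter m k)
          ≤ β * (2 * ∑ k ∈ box n, coupling J α x (plusSite m k)) := by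
        rw [Finset.mul_sum, Finset.mul_sum, Finset.mul_sum]
        refine Finset.sum_le_sum fun k _ => tilt_mul_coupling_le hJ.le (by linarith) hβ ?_ ?_
        · intro hx
          exact not_isEvenSite_of_mem_internal x.2 (hx ▸ isEvenSite_plusSite m k)
        · rw [siteDist_blockCenter_plusSite]
          linarith [siteDist_nonneg (blockCenter m 0) (minusSite m 0)]
      have h3 := mul_le_mul_of_nonneg_left h1 hβ
      linarith)
  refine h.trans ?_
  have h4 := sum_abs_field_sub hJ.le hα hβ Λ (pattPlus m) false
  rw [div_mul_eq_mul_div]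
  refine div_le_div_of_nonneg_right ?_ hs.le
  rw [Bool.not_false] at h4
  linarith

/-- In some block the dilute spins select the phase against any boundary condition. -/
theorem exists_block (hJ : 0 < J) (hα : 2 < α) (hβ : 0 < β)
    (hκ : 40 * Real.exp (-2 * (β * (J * 2 ^ (-α)))) ≤ 1) {m : ℕ} (hm : 1 ≤ m) :
    ∃ (n : ℕ) (k : Site), k ∈ box n ∧
      phaseGap J α β / 2 ≤ blockMean J α β m n k (pattMinus m) true
        - blockMean J α β m n k (pattPlus m) false
        - 4 * β * Real.exp (2 * β * totalCoupling J α)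
          * outerCoupling J α (box (2 * (4 * m * n))) (blockCenter m k) := by
  set lam := 4 * β * Real.exp (2 * β * totalCoupling J α) with hlam
  set q := 4 * β / tiltStrength J α β m with hq
  set c := phaseGap J α β with hc
  have hs := tiltStrength_pos (J := J) (α := α) (β := β) m
  have hc0 : 0 < c := phaseGap_pos hJ hβ
  have hq0 : 0 < q := by positivity
  have hlam0 : 0 < lam := by positivity
  have hm0 : (0 : ℝ) < m := by exact_mod_cast hm
  -- The box has `64 * m ^ 2 * n ^ 2` sites and `n ^ 2` blocks. The two wetting estimates cost `q`
  -- each, and the direct effect of the outside on the block centres costs `lam`; together they may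
  -- use half of the gap per block.
  obtain ⟨N₀, hN₀⟩ := exists_sum_outerCoupling_le hJ.le hα
    (ε := c / 2 / ((2 * q + lam) * 64 * m ^ 2)) (by positivity)
  set n := max N₀ 1 with hn
  have hn0 : (0 : ℝ) < n := by exact_mod_cast (lt_of_lt_of_le one_pos (le_max_right N₀ 1))
  have hS := hN₀ (2 * (4 * m * n)) (by
    have h1 : N₀ ≤ n := le_max_left _ _
    nlinarith)
  set Λ := box (2 * (4 * m * n)) with hΛ
  set S := ∑ x ∈ Λ, outerCoupling J α Λ x with hSdef
  have hS' : (2 * q + lam) * S ≤ c / 2 * n ^ 2 := by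
    have h1 := mul_le_mul_of_nonneg_left hS (by positivity : 0 ≤ 2 * q + lam)
    refine h1.trans (le_of_eq ?_)
    push_cast
    field_simp
    ring
  have hcard : ((box n).card : ℝ) = n ^ 2 := by
    rw [box, Finset.card_product, Int.card_Ico]
    simp only [sub_zero, Int.toNat_natCast]
    push_cast; ring
  have hout : ∑ k ∈ box n, outerCoupling J α Λ (blockCenter m k) ≤ S := by
    rw [← Finset.sum_image (g := blockCenter m) (f := outerCoupling J α Λ)
      fun _ _ _ _ h => blockCenter_injective hm h]
    refine Finset.sum_le_sum_of_subset_of_nonneg (fun y hy => ?_)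
      fun x _ _ => outerCoupling_nonneg hJ.le Λ x
    obtain ⟨k, hk, rfl⟩ := Finset.mem_image.1 hy
    exact blockCenter_mem hm hk
  have h1 := sum_blockMean_minus hJ hα hβ.le hm (n := n)
  have h2 := sum_blockMean_plus hJ hα hβ.le hm (n := n)
  have h3 : ∑ k ∈ box n, c ≤ ∑ k ∈ box n,
      (blockMean J α β m n k altSpin false - blockMean J α β m n k altSpin true) :=
    Finset.sum_le_sum fun k hk => phaseGap_le_blockMean_sub hJ hα hβ.le hκ hm hk
  rw [Finset.sum_const, nsmul_eq_mul, hcard, Finset.sum_sub_distrib] at h3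
  have hne : (box n).Nonempty := by
    rw [← Finset.card_pos]
    have : (0 : ℝ) < (box n).card := by rw [hcard]; positivity
    exact_mod_cast this
  -- An average over blocks: if the inequality holds for the sums, it holds in some block.
  have key : ∑ k ∈ box n, c / 2 ≤ ∑ k ∈ box n, (blockMean J α β m n k (pattMinus m) true
        - blockMean J α β m n k (pattPlus m) false - lam * outerCoupling J α Λ (blockCenter m k)) := by
    rw [Finset.sum_sub_distrib, Finset.sum_sub_distrib, ← Finset.mul_sum, Finset.sum_const,
      nsmul_eq_mul, hcard]
    have h4 := mul_le_mul_of_nonneg_left hout hlam0.le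
    linarith
  obtain ⟨k, hk, hle⟩ := Finset.exists_le_of_sum_le hne key
  exact ⟨n, k, hk, hle⟩

end Selection

/-! ### The conditional probability of a plus spin -/

section PlusProb

variable {J α β : ℝ}

variable (J α β) in
/-- The probability of a plus spin at `e` for the Gibbs distribution in `V`. -/
def plusProb (V : Finset Site) (η : Config) (e : Site) : ℝ :=
  gibbsMean (volEnergy J α β V η) fun σ => if glue V σ η e = true then 1 else 0

lemma volEnergy_update (hJ : 0 ≤ J) (hα : 2 < α) {V : Finset Site} {e : Site} (he : e ∉ V)
    (η : Config) (τ : V → Bool) :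
    volEnergy J α β V (Function.update η e false) τ
      = volEnergy J α β V (Function.update η e true) τ - 2 * β * siteInteraction J α V e τ := by
  have h : ∀ (b : Bool) (x : Site), fieldAt J α V (Function.update η e b) x
      = coupling J α x e * spin b + fieldAt J α (insert e V) η x := by
    intro b x
    rw [fieldAt_insert hJ hα he, Function.update_self]
    congr 1
    refine fieldAt_congr (fun y hy => ?_) x
    rw [Function.update_of_ne]
    rintro rfl
    exact hy (Finset.mem_insert_self _ _)
  simp only [volEnergy, pairEnergy, siteInteraction, h, Finset.mul_sum]
  rw [add_sub_assoc, ← Finset.sum_sub_distrib]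
  congr 1
  refine Finset.sum_congr rfl fun x _ => ?_
  rw [show spin false = -1 by simp [spin], show spin true = 1 by simp [spin]]
  ring

lemma fieldAt_insert_self (hJ : 0 ≤ J) (hα : 2 < α) {V : Finset Site} {e : Site} (he : e ∉ V)
    (η : Config) : fieldAt J α (insert e V) η e = fieldAt J α V η e := by
  rw [fieldAt_insert hJ hα he η e, coupling_self, zero_mul, zero_add]

lemma sum_insert_config {V : Finset Site} {e : Site} (he : e ∉ V) (η : Config)
    (F : Config → ℝ) :
    ∑ σ : ↥(insert e V) → Bool, F (glue (insert e V) σ η)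
      = ∑ b : Bool, ∑ τ : V → Bool, F (glue V τ (Function.update η e b)) := by
  rw [← Fintype.sum_prod_type' (f := fun b τ => F (glue V τ (Function.update η e b)))]
  let Φ : Bool × (V → Bool) → (↥(insert e V) → Bool) :=
    fun q i => glue V q.2 (Function.update η e q.1) i
  have hΦ : Function.Bijective Φ := by
    constructor
    · rintro ⟨b, τ⟩ ⟨b', τ'⟩ h
      have h1 := congrFun h ⟨e, Finset.mem_insert_self _ _⟩
      simp only [Φ, glue_of_notMem _ _ he, Function.update_self] at h1
      refine Prod.ext h1 (funext fun x => ?_)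
      have h2 := congrFun h ⟨x, Finset.mem_insert_of_mem x.2⟩
      simpa only [Φ, glue_coe] using h2
    · intro σ
      refine ⟨(σ ⟨e, Finset.mem_insert_self _ _⟩, fun x => σ ⟨x, Finset.mem_insert_of_mem x.2⟩), ?_⟩
      funext ⟨i, hi⟩
      simp only [Φ]
      by_cases hiV : i ∈ V
      · rw [glue_of_mem _ _ hiV]
      · rw [glue_of_notMem _ _ hiV]
        obtain rfl : i = e := (Finset.mem_insert.1 hi).resolve_right hiV
        rw [Function.update_self]
  rw [← hΦ.sum_comp]
  refine Finset.sum_congr rfl fun q _ => ?_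
  congr 1
  funext i
  by_cases hi : i ∈ insert e V
  · rw [glue_of_mem _ _ hi]
  · have hiV : i ∉ V := fun h => hi (Finset.mem_insert_of_mem h)
    rw [glue_of_notMem _ _ hi, glue_of_notMem _ _ hiV, Function.update_of_ne]
    rintro rfl
    exact hi (Finset.mem_insert_self _ _)

/-- The odds of a minus spin at a site. -/
lemma plusProb_insert (hJ : 0 ≤ J) (hα : 2 < α) {V : Finset Site} {e : Site} (he : e ∉ V)
    (η : Config) :
    plusProb J α β (insert e V) η e = 1 / (1 + Real.exp (-(2 * β * fieldAt J α V η e))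
      * gibbsMean (volEnergy J α β V (Function.update η e true)) (reversalFactor J α β V e)) := by
  set h := fieldAt J α V η e with hh
  set G := volEnergy J α β V (Function.update η e true) with hG
  have hw : ∀ (b : Bool) (τ : V → Bool),
      Real.exp (-β * hamiltonian J α (insert e V) (glue V τ (Function.update η e b)))
        = Real.exp (volEnergy J α β V (Function.update η e b) τ) * Real.exp (β * spin b * h) := by
    intro b τ
    rw [hamiltonian_insert hJ hα he, ← Real.exp_add, ← neg_mul_hamiltonian_glue,
      glue_of_notMem _ _ he, Function.update_self, fieldAt_insert_self hJ hα he]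
    have : fieldAt J α V (glue V τ (Function.update η e b)) e = h := by
      rw [hh, ← fieldAt_insert_self hJ hα he, ← fieldAt_insert_self hJ hα he]
      refine fieldAt_congr (fun y hy => ?_) e
      rw [glue_of_notMem _ _ fun h => hy (Finset.mem_insert_of_mem h), Function.update_of_ne]
      rintro rfl
      exact hy (Finset.mem_insert_self _ _)
    rw [this]
    congr 1
    ring
  have hexp : ∀ σ, Real.exp (volEnergy J α β (insert e V) η σ)
      = Real.exp (-β * hamiltonian J α (insert e V) (glue (insert e V) σ η)) := fun σ => by
    rw [neg_mul_hamiltonian_glue]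
  -- The partition function split by the spin at `e`. The minus part is expressed through the plus
  -- part by the reversal factor.
  have hZ : gibbsZ (volEnergy J α β (insert e V) η)
      = Real.exp (β * h) * gibbsZ G
        + Real.exp (-(β * h)) * ∑ τ, reversalFactor J α β V e τ * Real.exp (G τ) := by
    simp only [gibbsZ, hexp]
    rw [sum_insert_config he η fun ξ => Real.exp (-β * hamiltonian J α (insert e V) ξ)]
    rw [Fintype.sum_bool]
    simp only [hw]
    congr 1
    · rw [Finset.mul_sum]
      refine Finset.sum_congr rfl fun τ _ => ?_
      rw [mul_comm]; simp [spin, hG]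
    · rw [Finset.mul_sum]
      refine Finset.sum_congr rfl fun τ _ => ?_
      rw [volEnergy_update hJ hα he, reversalFactor, ← Real.exp_add, ← Real.exp_add,
        ← Real.exp_add, ← hG]
      congr 1
      simp only [spin]
      norm_num
      ring
  have hN : ∑ σ, (if glue (insert e V) σ η e = true then 1 else 0)
      * Real.exp (volEnergy J α β (insert e V) η σ) = Real.exp (β * h) * gibbsZ G := by
    simp only [hexp]
    rw [sum_insert_config he η fun ξ => (if ξ e = true then 1 else 0)
      * Real.exp (-β * hamiltonian J α (insert e V) ξ), Fintype.sum_bool]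
    simp only [hw, glue_of_notMem _ _ he, Function.update_self]
    simp only [if_true, one_mul, Bool.false_eq_true, if_false, zero_mul, Finset.sum_const_zero,
      add_zero, gibbsZ]
    rw [Finset.mul_sum]
    refine Finset.sum_congr rfl fun τ _ => ?_
    rw [mul_comm]; simp [spin, hG]
  have hZG := gibbsZ_pos G
  have hZ0 := gibbsZ_pos (volEnergy J α β (insert e V) η)
  rw [plusProb, gibbsMean, hN]
  have h2 : Real.exp (-(2 * β * h)) * Real.exp (β * h) = Real.exp (-(β * h)) := by
    rw [← Real.exp_add]; congr 1; ring
  have h3 : gibbsZ (volEnergy J α β (insert e V) η) = (Real.exp (β * h) * gibbsZ G)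
      * (1 + Real.exp (-(2 * β * h)) * gibbsMean G (reversalFactor J α β V e)) := by
    rw [hZ, gibbsMean]
    generalize Real.exp (-(2 * β * h)) = x at h2
    field_simp
    linear_combination -(∑ τ, reversalFactor J α β V e τ * Real.exp (G τ)) * h2
  rw [h3, div_mul_eq_div_div, div_self (by positivity)]

variable (J α β) in
/-- The jump of the conditional probability caused by the dilute spins. -/
def probGap : ℝ := Real.exp (-(2 * β * totalCoupling J α)) * (phaseGap J α β / 2)
  / (1 + Real.exp (4 * β * totalCoupling J α)) ^ 2

lemma probGap_pos (hJ : 0 < J) (hβ : 0 < β) : 0 < probGap J α β := by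
  have := phaseGap_pos (α := α) hJ hβ
  unfold probGap
  positivity

lemma gibbsMean_reversalFactor_le (hJ : 0 ≤ J) (hα : 2 < α) (hβ : 0 ≤ β) (V : Finset Site)
    (e : Site) (G : (V → Bool) → ℝ) :
    gibbsMean G (reversalFactor J α β V e) ≤ Real.exp (2 * β * totalCoupling J α) := by
  rw [← gibbsMean_const G (Real.exp (2 * β * totalCoupling J α))]
  exact gibbsMean_mono G fun σ => reversalFactor_le hJ hα hβ V e σ

lemma gibbsMean_reversalFactor_nonneg (V : Finset Site)
    (e : Site) (G : (V → Bool) → ℝ) : 0 ≤ gibbsMean G (reversalFactor J α β V e) := by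
  rw [← gibbsMean_const G 0]
  exact gibbsMean_mono G fun σ => (Real.exp_pos _).le

/-- Here `a` and `b` are expected reversal factors, `hm` and `hp` direct fields at the site, and `o`
the coupling to the outside. The outside can work against the patterns by shifting the direct field
by `2 * o`, which costs at most `4 * β * o * a` in the odds; the term subtracted in `hgap`
compensates for this. -/
lemma one_div_gap {T hm hp a b o g : ℝ} (hβ : 0 < β) (hhm : |hm| ≤ T) (hhp : |hp| ≤ T)
    (ha0 : 0 ≤ a) (hb0 : 0 ≤ b) (haT : a ≤ Real.exp (2 * β * T)) (hbT : b ≤ Real.exp (2 * β * T))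
    (ho0 : 0 ≤ o) (hmp : hm ≤ hp + 2 * o) (hg0 : 0 ≤ g)
    (hgap : g / 2 ≤ a - b - 4 * β * Real.exp (2 * β * T) * o) :
    1 / (1 + Real.exp (-(2 * β * hm)) * a)
        + Real.exp (-(2 * β * T)) * (g / 2) / (1 + Real.exp (4 * β * T)) ^ 2
      ≤ 1 / (1 + Real.exp (-(2 * β * hp)) * b) := by
  have hE4 : Real.exp (2 * β * T) * Real.exp (2 * β * T) = Real.exp (4 * β * T) := by
    rw [← Real.exp_add]; congr 1; ring
  have hexpb : ∀ h : ℝ, |h| ≤ T → Real.exp (-(2 * β * h)) ≤ Real.exp (2 * β * T) := fun h hh => by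
    refine Real.exp_le_exp.2 ?_
    nlinarith [(abs_le.1 hh).1]
  have hdiff : Real.exp (-(2 * β * T)) * (g / 2)
      ≤ Real.exp (-(2 * β * hm)) * a - Real.exp (-(2 * β * hp)) * b := by
    have h1 : Real.exp (-(2 * β * hp)) * (1 - 4 * β * o) ≤ Real.exp (-(2 * β * hm)) := by
      calc Real.exp (-(2 * β * hp)) * (1 - 4 * β * o)
          ≤ Real.exp (-(2 * β * hp)) * Real.exp (-(4 * β * o)) := by
            refine mul_le_mul_of_nonneg_left ?_ (Real.exp_pos _).le
            linarith [Real.add_one_le_exp (-(4 * β * o))]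
        _ = Real.exp (-(2 * β * (hp + 2 * o))) := by rw [← Real.exp_add]; congr 1; ring
        _ ≤ Real.exp (-(2 * β * hm)) := by
            refine Real.exp_le_exp.2 (neg_le_neg ?_)
            exact mul_le_mul_of_nonneg_left hmp (by positivity)
    have h2 : Real.exp (-(2 * β * hp)) * (g / 2)
        ≤ Real.exp (-(2 * β * hm)) * a - Real.exp (-(2 * β * hp)) * b := by
      have h3 := mul_le_mul_of_nonneg_right h1 ha0
      have h4 : 4 * β * o * a ≤ 4 * β * o * Real.exp (2 * β * T) :=
        mul_le_mul_of_nonneg_left haT (by positivity)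
      have h5 : g / 2 ≤ a - b - 4 * β * o * a := by linarith
      have h6 := mul_le_mul_of_nonneg_left h5 (Real.exp_pos (-(2 * β * hp))).le
      linarith
    refine le_trans ?_ h2
    refine mul_le_mul_of_nonneg_right (Real.exp_le_exp.2 (neg_le_neg ?_)) (by positivity)
    exact mul_le_mul_of_nonneg_left (abs_le.1 hhp).2 (by positivity)
  have hrmT : Real.exp (-(2 * β * hm)) * a ≤ Real.exp (4 * β * T) := by
    rw [← hE4]
    exact mul_le_mul (hexpb _ hhm) haT ha0 (Real.exp_pos _).le
  have hrpT : Real.exp (-(2 * β * hp)) * b ≤ Real.exp (4 * β * T) := by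
    rw [← hE4]
    exact mul_le_mul (hexpb _ hhp) hbT hb0 (Real.exp_pos _).le
  have hrm0 : 0 ≤ Real.exp (-(2 * β * hm)) * a := mul_nonneg (Real.exp_pos _).le ha0
  have hrp0 : 0 ≤ Real.exp (-(2 * β * hp)) * b := mul_nonneg (Real.exp_pos _).le hb0
  have hd0 : 0 ≤ Real.exp (-(2 * β * T)) * (g / 2) := by positivity
  generalize Real.exp (-(2 * β * hm)) * a = rm at *
  generalize Real.exp (-(2 * β * hp)) * b = rp at *
  have h1 : 1 / (1 + rp) - 1 / (1 + rm) = (rm - rp) / ((1 + rp) * (1 + rm)) := by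
    field_simp
    ring
  have h2 : Real.exp (-(2 * β * T)) * (g / 2) / (1 + Real.exp (4 * β * T)) ^ 2
      ≤ (rm - rp) / ((1 + rp) * (1 + rm)) := by
    rw [sq]
    refine div_le_div₀ (hd0.trans hdiff) hdiff (by positivity) ?_
    exact mul_le_mul (by linarith) (by linarith) (by linarith) (by positivity)
  linarith

/-- If the expected reversal factors are separated by more than the influence of the outside, then
the conditional probabilities of a plus spin are separated. -/
lemma plusProb_separated (hJ : 0 < J) (hα : 2 < α) (hβ : 0 < β) {Λ : Finset Site} {e : Site}
    (heven : IsEvenSite e) {pm pp : Config} (hpm : pm e = true) (hpp : pp e = true)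
    (hle : pm ≤ pp)
    (hgap : phaseGap J α β / 2
      ≤ gibbsMean (volEnergy J α β (internal Λ) (withBoundary Λ pm true))
          (reversalFactor J α β (internal Λ) e)
        - gibbsMean (volEnergy J α β (internal Λ) (withBoundary Λ pp false))
          (reversalFactor J α β (internal Λ) e)
        - 4 * β * Real.exp (2 * β * totalCoupling J α) * outerCoupling J α Λ e) :
    ∃ c : ℝ, ∀ η : Config,
      ((∀ y ∈ Λ, IsEvenSite y → y ≠ e → η y = pm y) →
        plusProb J α β (insert e (internal Λ)) η e ≤ c) ∧
      ((∀ y ∈ Λ, IsEvenSite y → y ≠ e → η y = pp y) →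
        c + probGap J α β ≤ plusProb J α β (insert e (internal Λ)) η e) := by
  set V := internal Λ with hV
  have he : e ∉ V := fun h => not_isEvenSite_of_mem_internal h heven
  set T := totalCoupling J α with hT
  set a := gibbsMean (volEnergy J α β V (withBoundary Λ pm true)) (reversalFactor J α β V e) with ha
  set b := gibbsMean (volEnergy J α β V (withBoundary Λ pp false)) (reversalFactor J α β V e) with hb
  set o := outerCoupling J α Λ e with ho
  set hm := fieldAt J α V (withBoundary Λ pm true) e with hhm
  set hp := fieldAt J α V (withBoundary Λ pp false) e with hhp
  have ha0 : 0 ≤ a := gibbsMean_reversalFactor_nonneg _ _ _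
  have hb0 : 0 ≤ b := gibbsMean_reversalFactor_nonneg _ _ _
  have haT : a ≤ Real.exp (2 * β * T) := gibbsMean_reversalFactor_le hJ.le hα hβ.le _ _ _
  have hbT : b ≤ Real.exp (2 * β * T) := gibbsMean_reversalFactor_le hJ.le hα hβ.le _ _ _
  have ho0 : 0 ≤ o := outerCoupling_nonneg hJ.le _ _
  have hc0 := phaseGap_pos (α := α) hJ hβ
  have hmp : hm ≤ hp + 2 * o := by
    have h1 : hm ≤ fieldAt J α V (withBoundary Λ pp true) e := fieldAt_mono hJ.le hα (fun y _ => by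
      unfold withBoundary
      split_ifs
      · exact hle y
      · exact le_rfl) e
    have h2 := fieldAt_boundary_sub hJ.le hα Λ pp e
    linarith
  have key := one_div_gap hβ (abs_fieldAt_le hJ.le hα _ _ _) (abs_fieldAt_le hJ.le hα _ _ _)
    ha0 hb0 haT hbT ho0 hmp hc0.le hgap
  rw [← hhm, ← hhp] at key
  set rm := Real.exp (-(2 * β * hm)) * a with hrm
  set rp := Real.exp (-(2 * β * hp)) * b with hrp
  have hrm0 : 0 ≤ rm := mul_nonneg (Real.exp_pos _).le ha0
  have hrp0 : 0 ≤ rp := mul_nonneg (Real.exp_pos _).le hb0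
  -- The value for `pm` with an all-plus outside, the worst case for the upper bound. The other
  -- bound uses `pp` with an all-minus outside.
  refine ⟨1 / (1 + rm), fun η => ⟨fun hη => ?_, fun hη => ?_⟩⟩
  · rw [plusProb_insert hJ.le hα he]
    -- The odds formula fixes a plus spin at `e`, where both patterns are plus too, so a pointwise
    -- comparison off `V` is possible.
    have hupd : ∀ y ∉ V, Function.update η e true y ≤ withBoundary Λ pm true y := by
      intro y hy
      unfold withBoundary
      split_ifs with hyΛ
      · by_cases hye : y = e
        · subst hye; rw [hpm]; exact Bool.le_true _
        · have hyev : IsEvenSite y := by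
            by_contra h
            exact hy (Finset.mem_filter.2 ⟨hyΛ, h⟩)
          rw [Function.update_of_ne hye, hη y hyΛ hyev hye]
      · exact Bool.le_true _
    have h1 : a ≤ _ := gibbsMean_reversalFactor_anti hJ.le hα hβ.le V e hupd
    have h2 : fieldAt J α V η e ≤ hm := by
      have h3 : fieldAt J α V η e = fieldAt J α V (Function.update η e true) e := by
        rw [← fieldAt_insert_self hJ.le hα he, ← fieldAt_insert_self hJ.le hα he]
        refine fieldAt_congr (fun y hy => ?_) e
        rw [Function.update_of_ne]
        rintro rfl
        exact hy (Finset.mem_insert_self _ _)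
      rw [h3]
      exact fieldAt_mono hJ.le hα hupd e
    have h4 : Real.exp (-(2 * β * hm)) ≤ Real.exp (-(2 * β * fieldAt J α V η e)) := by
      refine Real.exp_le_exp.2 ?_
      nlinarith
    refine one_div_le_one_div_of_le (add_pos_of_pos_of_nonneg one_pos hrm0) ?_
    exact add_le_add le_rfl (mul_le_mul h4 h1 ha0 (Real.exp_pos _).le)
  · rw [plusProb_insert hJ.le hα he]
    refine le_trans key ?_
    have hupd : ∀ y ∉ V, withBoundary Λ pp false y ≤ Function.update η e true y := by
      intro y hy
      unfold withBoundary
      split_ifs with hyΛ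
      · by_cases hye : y = e
        · subst hye; rw [hpp, Function.update_self]
        · have hyev : IsEvenSite y := by
            by_contra h
            exact hy (Finset.mem_filter.2 ⟨hyΛ, h⟩)
          rw [Function.update_of_ne hye, hη y hyΛ hyev hye]
      · exact Bool.false_le _
    have h1 : _ ≤ b := gibbsMean_reversalFactor_anti hJ.le hα hβ.le V e hupd
    have h2 : hp ≤ fieldAt J α V η e := by
      have h3 : fieldAt J α V η e = fieldAt J α V (Function.update η e true) e := by
        rw [← fieldAt_insert_self hJ.le hα he, ← fieldAt_insert_self hJ.le hα he]
        refine fieldAt_congr (fun y hy => ?_) e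
        rw [Function.update_of_ne]
        rintro rfl
        exact hy (Finset.mem_insert_self _ _)
      rw [h3]
      exact fieldAt_mono hJ.le hα hupd e
    have h4 : Real.exp (-(2 * β * fieldAt J α V η e)) ≤ Real.exp (-(2 * β * hp)) := by
      refine Real.exp_le_exp.2 ?_
      nlinarith
    have h5 := gibbsMean_reversalFactor_nonneg (J := J) (α := α) (β := β) V e
      (volEnergy J α β V (Function.update η e true))
    refine one_div_le_one_div_of_le
      (add_pos_of_pos_of_nonneg one_pos (mul_nonneg (Real.exp_pos _).le h5)) ?_
    exact add_le_add le_rfl (mul_le_mul h4 h1 h5 (Real.exp_pos _).le)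

end PlusProb

/-! ### Translations -/

section Translation

variable {J α β : ℝ}

/-- The translate of a finite set of sites. -/
def translate (t : Site) (V : Finset Site) : Finset Site := V.map (addRightEmbedding t)

lemma mem_translate {t : Site} {V : Finset Site} {y : Site} : y ∈ translate t V ↔ y - t ∈ V := by
  simp only [translate, Finset.mem_map, addRightEmbedding_apply]
  constructor
  · rintro ⟨a, ha, rfl⟩
    rwa [add_sub_cancel_right]
  · intro h
    exact ⟨_, h, sub_add_cancel _ _⟩

lemma add_mem_translate {t : Site} {V : Finset Site} {y : Site} : y + t ∈ translate t V ↔ y ∈ V := by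
  rw [mem_translate, add_sub_cancel_right]

lemma fieldAt_translate (t : Site) (V : Finset Site) (η : Config) (x : Site) :
    fieldAt J α (translate t V) η (x + t) = fieldAt J α V (fun y => η (y + t)) x := by
  rw [fieldAt, ← (Equiv.addRight t).tsum_eq]
  refine tsum_congr fun y => ?_
  simp only [Equiv.coe_addRight, coupling_add, offSpin, add_mem_translate]

lemma hamiltonian_translate (t : Site) (V : Finset Site) (η : Config) :
    hamiltonian J α (translate t V) η = hamiltonian J α V (fun y => η (y + t)) := by
  simp only [hamiltonian_eq]
  rw [translate]
  simp only [Finset.sum_map, addRightEmbedding_apply, coupling_add]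
  rw [← translate]
  simp only [fieldAt_translate]

lemma plusProb_translate (t : Site) (V : Finset Site) (η : Config) (x : Site) :
    plusProb J α β (translate t V) η (x + t) = plusProb J α β V (fun y => η (y + t)) x := by
  let Φ : (translate t V → Bool) → (V → Bool) := fun σ i => σ ⟨i + t, add_mem_translate.2 i.2⟩
  have hΦ : Function.Bijective Φ := by
    constructor
    · intro σ σ' h
      funext ⟨i, hi⟩
      have := congrFun h ⟨i - t, mem_translate.1 hi⟩
      simpa only [Φ, sub_add_cancel] using this
    · intro τ
      refine ⟨fun i => τ ⟨i - t, mem_translate.1 i.2⟩, ?_⟩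
      funext i
      simp only [Φ, add_sub_cancel_right]
  have hg : ∀ σ : translate t V → Bool,
      (fun y => glue (translate t V) σ η (y + t)) = glue V (Φ σ) (fun y => η (y + t)) := by
    intro σ
    funext y
    by_cases hy : y ∈ V
    · rw [glue_of_mem _ _ hy, glue_of_mem _ _ (add_mem_translate.2 hy)]
    · rw [glue_of_notMem _ _ hy, glue_of_notMem _ _ (mt add_mem_translate.1 hy)]
  have hE : ∀ σ : translate t V → Bool, volEnergy J α β (translate t V) η σ
      = volEnergy J α β V (fun y => η (y + t)) (Φ σ) := by
    intro σ
    rw [← neg_mul_hamiltonian_glue, hamiltonian_translate, hg, neg_mul_hamiltonian_glue]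
  have hx : ∀ σ : translate t V → Bool, glue (translate t V) σ η (x + t)
      = glue V (Φ σ) (fun y => η (y + t)) x := fun σ => congrFun (hg σ) x
  unfold plusProb gibbsMean gibbsZ
  rw [← hΦ.sum_comp, ← hΦ.sum_comp (fun σ => Real.exp (volEnergy J α β V (fun y => η (y + t)) σ))]
  simp only [hE, hx]

lemma not_dvd_blockCenter {m : ℕ} {i j : ℤ} (h : |j| < 4 * m) :
    ¬ (8 * m : ℤ) ∣ j + (8 * m * i + 4 * m) := by
  intro hd
  have h1 : (8 * m : ℤ) ∣ j + 4 * m := by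
    have e : j + 4 * m = j + (8 * m * i + 4 * m) - 8 * m * i := by ring
    rw [e]
    exact dvd_sub hd (dvd_mul_right _ _)
  rw [abs_lt] at h
  have := Int.le_of_dvd (by omega) h1
  omega

lemma altSpin_blockCenter (m : ℕ) (k : Site) : altSpin (blockCenter m k) = true := by
  have h1 : (8 * (m : ℤ) * k.1 + 4 * m) / 2 = 2 * (2 * m * k.1 + m) := by
    rw [show 8 * (m : ℤ) * k.1 + 4 * m = 2 * (2 * (2 * m * k.1 + m)) by ring]; omega
  have h2 : (8 * (m : ℤ) * k.2 + 4 * m) / 2 = 2 * (2 * m * k.2 + m) := by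
    rw [show 8 * (m : ℤ) * k.2 + 4 * m = 2 * (2 * (2 * m * k.2 + m)) by ring]; omega
  simp only [altSpin, blockCenter, h1, h2, decide_eq_true_eq, Int.even_iff]
  omega

/-- All reversed spins lie in rows whose index is divisible by `8 * m`, and such rows are at
vertical distance at least `4 * m` from a block centre. -/
lemma patt_add_blockCenter {m : ℕ} (k : Site) {y : Site} (h : |y.2| < 4 * m) :
    pattMinus m (y + blockCenter m k) = altSpin (y + blockCenter m k) ∧
      pattPlus m (y + blockCenter m k) = altSpin (y + blockCenter m k) := by
  have hnd := not_dvd_blockCenter (i := k.2) h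
  exact ⟨if_neg fun h => hnd h.2, if_neg fun h => hnd h.2⟩

lemma isEvenSite_add_iff {e : Site} (he : IsEvenSite e) (y : Site) :
    IsEvenSite (y + e) ↔ IsEvenSite y := by
  obtain ⟨h1, h2⟩ := he
  simp only [IsEvenSite, Prod.fst_add, Prod.snd_add, Int.even_add, h1, h2, iff_true]

/-- The conditional probability of a plus spin at the origin, given the even spins, depends on
arbitrarily distant even spins, uniformly in the spins outside a finite volume. -/
theorem exists_selecting_patterns (hJ : 0 < J) (hα : 2 < α) (hβ : 0 < β)
    (hκ : 40 * Real.exp (-2 * (β * (J * 2 ^ (-α)))) ≤ 1) (L : ℕ) :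
    ∃ (V Λ : Finset Site) (pm pp : Config) (c : ℝ), V ⊆ Λ ∧
      (∀ y ∈ Λ, y ∉ V ↔ IsEvenSite y ∧ y ≠ 0) ∧
      (∀ y : Site, |y.1| ≤ L → |y.2| ≤ L → y ∈ Λ ∧ pm y = pp y) ∧
      ∀ η : Config, ((∀ y ∈ Λ \ V, η y = pm y) → plusProb J α β V η 0 ≤ c) ∧
        ((∀ y ∈ Λ \ V, η y = pp y) → c + probGap J α β ≤ plusProb J α β V η 0) := by
  -- With `m = L + 1` the half side `4 * m` of a block exceeds `L`, so the square of radius `L`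
  -- about the centre stays inside the block.
  obtain ⟨n, k, hk, hgap⟩ := exists_block hJ hα hβ hκ (m := L + 1) (by omega)
  set m := L + 1 with hm
  set e := blockCenter m k with he
  set B := box (2 * (4 * m * n)) with hB
  have heB : e ∈ B := blockCenter_mem (by omega) hk
  have heven : IsEvenSite e := isEvenSite_blockCenter m k
  have h0 : |(0 : Site).2| < 4 * m := by simp [hm]
  have halt : altSpin e = true := altSpin_blockCenter m k
  obtain ⟨hpe1, hpe2⟩ := patt_add_blockCenter (m := m) k (y := 0) h0
  rw [zero_add, ← he, halt] at hpe1 hpe2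
  obtain ⟨c, hc⟩ := plusProb_separated hJ hα hβ (Λ := B) heven hpe1 hpe2
    ((pattMinus_le m).trans (le_pattPlus m)) hgap
  have hmemV : ∀ y ∈ translate (-e) B, y ∉ translate (-e) (insert e (internal B)) ↔
      IsEvenSite y ∧ y ≠ 0 := by
    intro y hy
    rw [mem_translate, sub_neg_eq_add] at hy ⊢
    rw [Finset.mem_insert, internal, Finset.mem_filter, isEvenSite_add_iff heven]
    simp only [hy, true_and, not_or, not_not, add_eq_right]
    tauto
  refine ⟨translate (-e) (insert e (internal B)), translate (-e) B, fun y => pattMinus m (y + e),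
    fun y => pattPlus m (y + e), c, ?_, hmemV, ?_, ?_⟩
  · intro y hy
    rw [mem_translate] at hy ⊢
    rcases Finset.mem_insert.1 hy with h | h
    · rwa [h]
    · exact (Finset.mem_filter.1 h).1
  · intro y hy1 hy2
    constructor
    · rw [mem_translate, sub_neg_eq_add]
      have := block_site_mem (m := m) (j := (y.1 + 4 * m, y.2 + 4 * m)) hk (by
        rw [abs_le] at hy1 hy2
        simp only [mem_box, InBox, hm]
        push_cast
        omega)
      convert this using 1
      simp only [he, blockCenter, Prod.ext_iff, Prod.fst_add, Prod.snd_add]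
      constructor <;> ring
    · obtain ⟨h1, h2⟩ := patt_add_blockCenter (m := m) k (y := y) (by push_cast [hm]; omega)
      simp only [he]
      rw [h1, h2]
  · intro η
    have htr : plusProb J α β (translate (-e) (insert e (internal B))) η 0
        = plusProb J α β (insert e (internal B)) (fun y => η (y + -e)) e := by
      rw [← plusProb_translate, add_neg_cancel]
    have hpat : ∀ p : Config, (∀ y ∈ translate (-e) B \ translate (-e) (insert e (internal B)),
        η y = p (y + e)) → ∀ y ∈ B, IsEvenSite y → y ≠ e → η (y + -e) = p y := by
      intro p h y hyB hyev hye
      have h1 : y + -e ∈ translate (-e) B := by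
        rw [mem_translate]; simpa using hyB
      have h2 := h (y + -e) (Finset.mem_sdiff.2 ⟨h1, (hmemV _ h1).2 ⟨?_, ?_⟩⟩)
      · rw [h2, neg_add_cancel_right]
      · rw [← isEvenSite_add_iff heven, neg_add_cancel_right]; exact hyev
      · rw [← sub_eq_add_neg, sub_ne_zero]; exact hye
    rw [htr]
    exact ⟨fun h => (hc _).1 (hpat _ h), fun h => (hc _).2 (hpat _ h)⟩

end Translation

/-! ### Non-quasilocality of the decimated measures -/

section NonQuasilocal

/-- Every event of this σ-algebra is a preimage under restriction to `S`. This makes measurability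
with respect to the outside a pointwise statement. -/
lemma mem_iff_of_measurableSet_cylinderEvents {S : Set Site} {A : Set Config}
    (hA : MeasurableSet[cylinderEvents S] A) {σ ω : Config} (h : ∀ i ∈ S, σ i = ω i) :
    σ ∈ A ↔ ω ∈ A := by
  have hle : cylinderEvents (X := fun _ : Site => Bool) S
      ≤ MeasurableSpace.comap (fun (σ : Config) (i : S) => σ i) ⊤ := by
    refine iSup₂_le fun i hi => ?_
    rintro _ ⟨B, _, rfl⟩
    exact ⟨{τ | τ ⟨i, hi⟩ ∈ B}, trivial, rfl⟩
  obtain ⟨B, _, rfl⟩ := hle A hA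
  simp only [Set.mem_preimage]
  rw [show (fun i : S => σ i) = fun i : S => ω i from funext fun i => h i i.2]

lemma eq_of_measurable_cylinderEvents {S : Set Site} {f : Config → ENNReal}
    (hf : Measurable[cylinderEvents S] f) {σ ω : Config} (h : ∀ i ∈ S, σ i = ω i) : f σ = f ω := by
  have := mem_iff_of_measurableSet_cylinderEvents (hf (measurableSet_singleton (f ω))) h
  exact this.2 rfl

/-- Cylinder events are measurable. -/
lemma measurableSet_cylinder {S : Set Site} (D : Finset Site) (hD : ∀ i ∈ D, i ∈ S) (p : Config) :
    MeasurableSet[cylinderEvents S] {ω : Config | ∀ i ∈ D, ω i = p i} := by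
  have e : {ω : Config | ∀ i ∈ D, ω i = p i} = ⋂ i ∈ D, (fun ω : Config => ω i) ⁻¹' {p i} := by
    ext ω; simp
  rw [e]
  refine Finset.measurableSet_biInter _ fun i hi => ?_
  exact measurable_cylinderEvent_apply (hD i hi) (measurableSet_singleton _)

lemma measurableSet_plus (i : Site) : MeasurableSet {ω : Config | ω i = true} := by
  have h : Measurable fun ω : Config => ω i := measurable_pi_apply i
  exact h (measurableSet_singleton true)

lemma measurable_decimate : Measurable decimate :=
  measurable_pi_lambda _ fun _ => measurable_pi_apply _

variable {γ : Finset Site → Config → Measure Config} {μ : Measure Config}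

lemma IsDLR.integrable (h : IsDLR γ μ) (Λ : Finset Site) {A : Set Config} (hA : MeasurableSet A) :
    Integrable (fun ω => (γ Λ ω).real A) μ :=
  (integrable_congr (h.condExp_eq Λ A hA)).1 integrable_condExp

lemma IsDLR.setIntegral_eq (h : IsDLR γ μ) (Λ : Finset Site) {A B : Set Config}
    (hA : MeasurableSet A) (hB : MeasurableSet[cylinderEvents ((Λ : Set Site)ᶜ)] B) :
    ∫ ω in B, (γ Λ ω).real A ∂μ = μ.real (B ∩ A) := by
  have := h.isProbabilityMeasure
  have h1 : ∫ ω in B, (γ Λ ω).real A ∂μ = ∫ ω in B,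
      (μ[A.indicator (fun _ => (1 : ℝ)) | cylinderEvents ((Λ : Set Site)ᶜ)]) ω ∂μ :=
    integral_congr_ae (ae_restrict_of_ae (h.condExp_eq Λ A hA).symm)
  rw [h1, setIntegral_condExp cylinderEvents_le_pi ((integrable_const 1).indicator hA) hB,
    setIntegral_indicator hA]
  simp

/-- Lower bounds of conditional probabilities. -/
lemma IsDLR.exists_ge (h : IsDLR γ μ) (Λ : Finset Site) {A B : Set Config} (hA : MeasurableSet A)
    (hB : MeasurableSet[cylinderEvents ((Λ : Set Site)ᶜ)] B) {a b : ℝ} (hab : a < b)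
    (hpos : 0 < μ.real B) (hle : b * μ.real B ≤ μ.real (B ∩ A)) :
    ∃ ω ∈ B, a ≤ (γ Λ ω).real A := by
  have := h.isProbabilityMeasure
  by_contra hcon
  push Not at hcon
  have h1 : ∫ ω in B, (γ Λ ω).real A ∂μ ≤ ∫ _ in B, a ∂μ :=
    setIntegral_mono_on (h.integrable Λ hA).integrableOn (integrable_const a).integrableOn
      (cylinderEvents_le_pi _ hB) fun ω hω => (hcon ω hω).le
  rw [h.setIntegral_eq Λ hA hB, setIntegral_const, smul_eq_mul] at h1
  nlinarith

lemma IsDLR.exists_le (h : IsDLR γ μ) (Λ : Finset Site) {A B : Set Config} (hA : MeasurableSet A)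
    (hB : MeasurableSet[cylinderEvents ((Λ : Set Site)ᶜ)] B) {a b : ℝ} (hab : a < b)
    (hpos : 0 < μ.real B) (hle : μ.real (B ∩ A) ≤ a * μ.real B) :
    ∃ ω ∈ B, (γ Λ ω).real A ≤ b := by
  have := h.isProbabilityMeasure
  by_contra hcon
  push Not at hcon
  have h1 : ∫ _ in B, b ∂μ ≤ ∫ ω in B, (γ Λ ω).real A ∂μ :=
    setIntegral_mono_on (integrable_const b).integrableOn (h.integrable Λ hA).integrableOn
      (cylinderEvents_le_pi _ hB) fun ω hω => (hcon ω hω).le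
  rw [h.setIntegral_eq Λ hA hB, setIntegral_const, smul_eq_mul] at h1
  nlinarith

variable {J α β : ℝ}

lemma isingSpec_real_plus (V : Finset Site) (η : Config) (e : Site) :
    (isingSpec J α β V η).real {ω | ω e = true} = plusProb J α β V η e := by
  rw [← integral_indicator_one (measurableSet_plus e), integral_isingSpec, plusProb]
  congr 1
  funext σ
  simp only [Set.indicator, Set.mem_ofPred_eq, Pi.one_apply]

lemma isingSpec_cylinder_pos (Λ : Finset Site) (η : Config) {D : Finset Site} (hD : D ⊆ Λ)
    (p : Config) : 0 < (isingSpec J α β Λ η).real {ω | ∀ i ∈ D, ω i = p i} := by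
  have hm : MeasurableSet {ω : Config | ∀ i ∈ D, ω i = p i} :=
    cylinderEvents_le_pi _ (measurableSet_cylinder (S := Set.univ) D (fun _ _ => Set.mem_univ _) p)
  rw [← integral_indicator_one hm, integral_isingSpec, gibbsMean]
  refine div_pos (Finset.sum_pos' (fun σ _ => ?_) ⟨fun i => p i, Finset.mem_univ _, ?_⟩)
    (gibbsZ_pos _)
  · exact mul_nonneg (Set.indicator_nonneg (fun _ _ => zero_le_one) _) (Real.exp_pos _).le
  · rw [Set.indicator_of_mem]
    · simpa using Real.exp_pos _
    · intro i hi
      rw [glue_of_mem _ _ (hD hi)]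

/-- Under every boundary condition the Gibbs distribution in `D` charges all configurations; its
positive values are integrated. -/
lemma IsDLR.cylinder_pos (h : IsDLR (isingSpec J α β) μ) (D : Finset Site) (p : Config) :
    0 < μ.real {ω | ∀ i ∈ D, ω i = p i} := by
  have := h.isProbabilityMeasure
  have hm : MeasurableSet {ω : Config | ∀ i ∈ D, ω i = p i} :=
    cylinderEvents_le_pi _ (measurableSet_cylinder (S := Set.univ) D (fun _ _ => Set.mem_univ _) p)
  have h1 := h.setIntegral_eq D hm (B := Set.univ) MeasurableSet.univ
  rw [Set.univ_inter] at h1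
  rw [← h1, setIntegral_univ]
  refine (integral_pos_iff_support_of_nonneg (fun ω => measureReal_nonneg)
    (h.integrable D hm)).2 ?_
  have : Function.support (fun ω => (isingSpec J α β D ω).real {ω | ∀ i ∈ D, ω i = p i})
      = Set.univ := by
    ext ω
    simp only [Function.mem_support, Set.mem_univ, iff_true]
    exact (isingSpec_cylinder_pos D ω (Finset.Subset.refl D) p).ne'
  rw [this, measure_univ]
  exact one_pos

/-- The decimated even sites. -/
def halfSites (D : Finset Site) : Finset Site := D.image fun y => (y.1 / 2, y.2 / 2)

lemma decimate_mem_iff {D : Finset Site} (hD : ∀ y ∈ D, IsEvenSite y) (p ω : Config) :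
    (∀ i ∈ halfSites D, decimate ω i = p (2 * i.1, 2 * i.2)) ↔ ∀ y ∈ D, ω y = p y := by
  simp only [halfSites, Finset.forall_mem_image, decimate]
  refine forall₂_congr fun y hy => ?_
  obtain ⟨h1, h2⟩ := hD y hy
  rw [Int.two_mul_ediv_two_of_even h1, Int.two_mul_ediv_two_of_even h2]

/-- A contradiction at a single site: the kernel at the origin would have to be nearly constant on
configurations that agree near the origin, while the selecting patterns force values on either side
of a fixed gap. Only averages over the two cylinders are compared, which avoids any choice of
versions of conditional probabilities. -/
theorem not_isQuasilocalMeasure_decimated (hJ : 0 < J) (hα : 2 < α) (hβ : 0 < β)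
    (hκ : 40 * Real.exp (-2 * (β * (J * 2 ^ (-α)))) ≤ 1) (hμ : IsDLR (isingSpec J α β) μ) :
    ¬ IsQuasilocalMeasure (decimated μ) := by
  rintro ⟨γ, hγ, hq, hdlr⟩
  have := hμ.isProbabilityMeasure
  set δ := probGap J α β with hδ
  have hδ0 : 0 < δ := probGap_pos hJ hβ
  set A : Set Config := {ω | ω 0 = true} with hA
  have hAm : MeasurableSet A := measurableSet_plus 0
  set g : Config → ℝ := fun ω => (γ {0} ω).real A with hg
  have hgq : IsQuasilocalFun g := by
    have h1 := hq {0} (A.indicator 1) ⟨{0}, by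
      have h2 : Measurable[cylinderEvents ((({0} : Finset Site)) : Set Site)]
          fun ω : Config => ω 0 := measurable_cylinderEvent_apply (by simp)
      exact Measurable.indicator measurable_const (h2 (measurableSet_singleton true))⟩
    simpa only [integral_indicator_one hAm] using h1
  have hgout : ∀ σ ω : Config, (∀ i, i ≠ 0 → σ i = ω i) → g σ = g ω := by
    intro σ ω h
    simp only [hg, Measure.real]
    congr 1
    exact eq_of_measurable_cylinderEvents (hγ.measurable_outside {0} A hAm) fun i hi =>
      h i (by simpa using hi)
  obtain ⟨Δ, hΔ⟩ := hgq (δ / 4) (by positivity)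
  -- Large enough for the square of radius `L` to contain the doubled sites of `Δ`, where the
  -- patterns must agree.
  set L : ℕ := ∑ i ∈ Δ, (2 * i.1.natAbs + 2 * i.2.natAbs) with hL
  have hΔL : ∀ i ∈ Δ, |2 * i.1| ≤ L ∧ |2 * i.2| ≤ L := by
    intro i hi
    have := Finset.single_le_sum (f := fun i : Site => 2 * i.1.natAbs + 2 * i.2.natAbs)
      (fun _ _ => Nat.zero_le _) hi
    rw [abs_le, abs_le]
    omega
  obtain ⟨V, Λ, pm, pp, c, hVΛ, hmem, hpatt, hprob⟩ := exists_selecting_patterns hJ hα hβ hκ L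
  set D := Λ \ V with hD
  have hDeven : ∀ y ∈ D, IsEvenSite y ∧ y ≠ 0 := fun y hy =>
    (hmem y (Finset.mem_sdiff.1 hy).1).1 (Finset.mem_sdiff.1 hy).2
  let N : Config → Set Config := fun p => {η | ∀ y ∈ D, η y = p y}
  let M : Config → Set Config := fun p => {ω | ∀ i ∈ halfSites D, ω i = p (2 * i.1, 2 * i.2)}
  have hMm : ∀ p, MeasurableSet[cylinderEvents (((({0} : Finset Site)) : Set Site)ᶜ)] (M p) := by
    intro p
    refine measurableSet_cylinder (halfSites D) (fun i hi => ?_) (fun i => p (2 * i.1, 2 * i.2))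
    obtain ⟨y, hy, rfl⟩ := Finset.mem_image.1 hi
    obtain ⟨⟨h1, h2⟩, h3⟩ := hDeven y hy
    simp only [Finset.coe_singleton, Set.mem_compl_iff, Set.mem_singleton_iff]
    intro h4
    apply h3
    have h5 := congrArg Prod.fst h4
    have h6 := congrArg Prod.snd h4
    simp only [Prod.fst_zero, Prod.snd_zero] at h5 h6
    rw [Int.even_iff] at h1 h2
    exact Prod.ext (by rw [Prod.fst_zero]; omega) (by rw [Prod.snd_zero]; omega)
  have hNm : ∀ p, MeasurableSet[cylinderEvents ((V : Set Site)ᶜ)] (N p) := fun p =>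
    measurableSet_cylinder D (fun i hi => (Finset.mem_sdiff.1 hi).2) p
  have hpre : ∀ p, decimate ⁻¹' (M p) = N p := fun p => by
    ext ω
    exact decimate_mem_iff (fun y hy => (hDeven y hy).1) p ω
  have hpreA : decimate ⁻¹' A = A := rfl
  have hν : ∀ B : Set Config, MeasurableSet B →
      (decimated μ).real B = μ.real (decimate ⁻¹' B) := fun B hB => by
    simp only [Measure.real, decimated, Measure.map_apply measurable_decimate hB]
  have hνM : ∀ p, (decimated μ).real (M p) = μ.real (N p) := fun p => by
    rw [hν _ (cylinderEvents_le_pi _ (hMm p)), hpre]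
  -- The cylinder fixes spins outside `V` only, so the DLR equation of the original measure in `V`
  -- applies. All remaining spins are averaged, which is harmless because the bounds on `plusProb`
  -- are uniform in them.
  have hνMA : ∀ p, (decimated μ).real (M p ∩ A) = ∫ η in N p, plusProb J α β V η 0 ∂μ := fun p => by
    rw [hν _ ((cylinderEvents_le_pi _ (hMm p)).inter hAm), Set.preimage_inter, hpre, hpreA,
      ← hμ.setIntegral_eq V hAm (hNm p)]
    simp only [hA, isingSpec_real_plus]
  have hpos : ∀ p, 0 < μ.real (N p) := fun p => hμ.cylinder_pos D p
  have hint : Integrable (fun η => plusProb J α β V η 0) μ := by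
    have := hμ.integrable V hAm
    simpa only [hA, isingSpec_real_plus] using this
  -- Values at most `c + δ / 4` and at least `c + 3 / 4 * δ` are further apart than the oscillation
  -- `δ / 4` allowed by quasilocality.
  obtain ⟨ωm, hωm, hgm⟩ := hdlr.exists_le {0} hAm (hMm pm) (a := c) (b := c + δ / 4)
    (by linarith) (by rw [hνM]; exact hpos pm) (by
      rw [hνM, hνMA]
      have h1 := setIntegral_mono_on hint.integrableOn (integrable_const c).integrableOn
        (cylinderEvents_le_pi _ (hNm pm)) fun η hη => (hprob η).1 hη
      rw [setIntegral_const, smul_eq_mul] at h1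
      linarith)
  obtain ⟨ωp, hωp, hgp⟩ := hdlr.exists_ge {0} hAm (hMm pp) (a := c + 3 / 4 * δ) (b := c + δ)
    (by linarith) (by rw [hνM]; exact hpos pp) (by
      rw [hνM, hνMA]
      have h1 := setIntegral_mono_on (integrable_const (c + δ)).integrableOn hint.integrableOn
        (cylinderEvents_le_pi _ (hNm pp)) fun η hη => (hprob η).2 hη
      rw [setIntegral_const, smul_eq_mul] at h1
      linarith)
  -- The cylinders say nothing about the origin itself, so the two spins there are made equal; the
  -- kernel at the origin does not see this spin.
  have h1 := hΔ ωp (Function.update ωm 0 (ωp 0)) (fun i hi => by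
    by_cases hi0 : i = 0
    · rw [hi0, Function.update_self]
    · rw [Function.update_of_ne hi0]
      obtain ⟨hb1, hb2⟩ := hΔL i hi
      obtain ⟨h2, h3⟩ := hpatt (2 * i.1, 2 * i.2) hb1 hb2
      have h4 : ((2 * i.1, 2 * i.2) : Site) ∈ D := by
        refine Finset.mem_sdiff.2 ⟨h2, (hmem _ h2).2 ⟨⟨even_two_mul _, even_two_mul _⟩, ?_⟩⟩
        intro h5
        apply hi0
        simp only [Prod.ext_iff, Prod.fst_zero, Prod.snd_zero] at h5 ⊢
        omega
      have h5 : i ∈ halfSites D := Finset.mem_image.2 ⟨_, h4, by simp⟩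
      rw [hωp i h5, hωm i h5, h3])
  rw [hgout (Function.update ωm 0 (ωp 0)) ωm fun i hi => Function.update_of_ne hi _ _] at h1
  have h2 := (abs_le.1 h1).2
  have h3 : g ωm ≤ c + δ / 4 := hgm
  have h4 : c + 3 / 4 * δ ≤ g ωp := hgp
  linarith

lemma IsGibbsMeasure.isQuasilocalMeasure {ν : Measure Config} (h : IsGibbsMeasure ν) :
    IsQuasilocalMeasure ν := by
  obtain ⟨γ, h1, -, h3, h4⟩ := h
  exact ⟨γ, h1, h3, h4⟩

end NonQuasilocal

/-! ### The plus phase -/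

section PlusPhase

variable {J α β : ℝ}

lemma integral_isingSpec_mono (hJ : 0 ≤ J) (hα : 2 < α) (hβ : 0 ≤ β) (V : Finset Site)
    {f : Config → ℝ} (hf : Monotone f) {ω ω' : Config} (h : ω ≤ ω') :
    ∫ σ, f σ ∂(isingSpec J α β V ω) ≤ ∫ σ, f σ ∂(isingSpec J α β V ω') := by
  rw [integral_isingSpec, integral_isingSpec]
  have hg : ∀ (σ σ' : V → Bool), σ ≤ σ' → ∀ ξ ξ' : Config, ξ ≤ ξ' → glue V σ ξ ≤ glue V σ' ξ' := by
    intro σ σ' hσ ξ ξ' hξ i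
    unfold glue
    split_ifs
    · exact hσ _
    · exact hξ _
  refine (gibbsMean_mono _ fun σ => hf (hg σ σ le_rfl ω ω' h)).trans ?_
  exact gibbsMean_pairEnergy_mono (volCoupling_nonneg hJ hβ V)
    (fun x => mul_le_mul_of_nonneg_left (fieldAt_mono hJ hα (fun y _ => h y) _) hβ)
    fun σ σ' hσ => hf (hg σ σ' hσ ω' ω' le_rfl)

lemma integral_integral_isingSpec (hJ : 0 ≤ J) (hα : 2 < α) {V Λ : Finset Site} (hV : V ⊆ Λ)
    (ω : Config) (f : Config → ℝ) :
    ∫ η, ∫ σ, f σ ∂(isingSpec J α β V η) ∂(isingSpec J α β Λ ω)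
      = ∫ σ, f σ ∂(isingSpec J α β Λ ω) := by
  simp only [integral_isingSpec]
  exact gibbsMean_gibbsMean hJ hα β hV ω f

lemma integrable_isingSpec (V : Finset Site) (ω : Config) (f : Config → ℝ) :
    Integrable f (isingSpec J α β V ω) := by
  unfold isingSpec
  refine integrable_finsetSum_measure.2 fun σ _ => ?_
  exact (integrable_dirac (by simp)).smul_measure ENNReal.ofReal_ne_top

lemma le_allPlus (ω : Config) : ω ≤ allPlus := fun _ => Bool.le_true _

/-- By consistency a larger volume gives a mixture over boundary conditions of the smaller one, and
all plus is the largest of these. -/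
lemma antitone_integral_plus (hJ : 0 ≤ J) (hα : 2 < α) (hβ : 0 ≤ β) {f : Config → ℝ}
    (hf : Monotone f) : Antitone fun Λ => ∫ σ, f σ ∂(isingSpec J α β Λ allPlus) := by
  intro V Λ hV
  simp only
  rw [← integral_integral_isingSpec hJ hα hV]
  have h : ∀ η, ∫ σ, f σ ∂(isingSpec J α β V η) ≤ ∫ σ, f σ ∂(isingSpec J α β V allPlus) :=
    fun η => integral_isingSpec_mono hJ hα hβ V hf (le_allPlus η)
  refine (integral_mono (integrable_isingSpec _ _ _) (integrable_const _) h).trans ?_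
  simp

lemma exists_tendsto_integral_plus (hJ : 0 ≤ J) (hα : 2 < α) (hβ : 0 ≤ β) {f : Config → ℝ}
    (hf : Monotone f) :
    ∃ a, Tendsto (fun Λ => ∫ σ, f σ ∂(isingSpec J α β Λ allPlus)) atTop (𝓝 a) := by
  refine ⟨_, tendsto_atTop_ciInf (antitone_integral_plus hJ hα hβ hf) ⟨f ⊥, ?_⟩⟩
  rintro _ ⟨Λ, rfl⟩
  have h := integral_mono (integrable_const (f ⊥))
    (integrable_isingSpec (J := J) (α := α) (β := β) Λ allPlus f) fun σ => hf (bot_le (a := σ))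
  simpa using h

lemma IsQuasilocalFun.continuous {f : Config → ℝ} (hf : IsQuasilocalFun f) : Continuous f := by
  rw [continuous_iff_continuousAt]
  intro σ
  rw [ContinuousAt, Metric.tendsto_nhds]
  intro ε hε
  obtain ⟨Λ, hΛ⟩ := hf (ε / 2) (half_pos hε)
  have hev : ∀ᶠ ω : Config in 𝓝 σ, ∀ i ∈ Λ, ω i = σ i := by
    rw [Finset.eventually_all]
    intro i _
    exact (continuous_apply i).continuousAt.eventually_mem
      ((isOpen_discrete {σ i}).mem_nhds rfl)
  filter_upwards [hev] with ω hω
  rw [Real.dist_eq]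
  exact (hΛ ω σ hω).trans_lt (half_lt_self hε)

/-- A limit point of the finite-volume Gibbs measures with plus boundary condition. -/
lemma exists_clusterPoint_plus (J α β : ℝ) :
    ∃ (μ : Measure Config) (U : Filter (Finset Site)), IsProbabilityMeasure μ ∧ U.NeBot ∧
      U ≤ atTop ∧ ∀ f : Config → ℝ, Continuous f →
        Tendsto (fun Λ => ∫ σ, f σ ∂(isingSpec J α β Λ allPlus)) U (𝓝 (∫ σ, f σ ∂μ)) := by
  let P : Finset Site → ProbabilityMeasure Config := fun Λ =>
    ⟨isingSpec J α β Λ allPlus, isProbabilityMeasure_isingSpec β Λ allPlus⟩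
  -- An ultrafilter below `atTop` converges by compactness of the space of probability measures.
  let U : Ultrafilter (Finset Site) := Ultrafilter.of atTop
  obtain ⟨μ, -, hμ⟩ := isCompact_univ.ultrafilter_le_nhds (U.map P) (by simp)
  refine ⟨μ, U, inferInstance, inferInstance, Ultrafilter.of_le _, fun f hf => ?_⟩
  have h : Tendsto P U (𝓝 μ) := hμ
  rw [ProbabilityMeasure.tendsto_iff_forall_integral_tendsto] at h
  exact h (BoundedContinuousFunction.mkOfCompact ⟨f, hf⟩)

/-- A function of finitely many spins becomes increasing when a multiple of the number of plus
spins is added. -/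
lemma monotone_add_card {f : Config → ℝ} {Λ : Finset Site} {C : ℝ} (hC : ∀ σ, |f σ| ≤ C)
    (hf : ∀ σ ω : Config, (∀ i ∈ Λ, σ i = ω i) → f σ = f ω) :
    Monotone fun σ => f σ + C * ∑ i ∈ Λ, spin (σ i) := by
  intro σ ω h
  have hC0 : 0 ≤ C := (abs_nonneg _).trans (hC σ)
  simp only
  by_cases heq : ∀ i ∈ Λ, σ i = ω i
  · rw [hf σ ω heq, Finset.sum_congr rfl fun i hi => by rw [heq i hi]]
  · push Not at heq
    obtain ⟨i, hi, hne⟩ := heq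
    have h1 : ∑ i ∈ Λ, spin (σ i) + 2 ≤ ∑ i ∈ Λ, spin (ω i) := by
      have h2 : spin (ω i) - spin (σ i) ≤ ∑ i ∈ Λ, (spin (ω i) - spin (σ i)) :=
        Finset.single_le_sum (f := fun i => spin (ω i) - spin (σ i))
          (fun j _ => sub_nonneg.2 (spin_mono (h j))) hi
      have h3 : spin (ω i) - spin (σ i) = 2 := by
        have h4 := h i
        revert hne h4
        cases σ i <;> cases ω i <;> norm_num [spin]
      rw [Finset.sum_sub_distrib] at h2
      linarith
    have h2 := mul_le_mul_of_nonneg_left h1 hC0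
    have h3 := (abs_le.1 (hC σ)).2
    have h4 := (abs_le.1 (hC ω)).1
    linarith

lemma continuous_spin_apply (i : Site) : Continuous fun σ : Config => spin (σ i) :=
  (continuous_of_discreteTopology (f := spin)).comp (continuous_apply i)

lemma monotone_sum_spin (Λ : Finset Site) : Monotone fun σ : Config => ∑ i ∈ Λ, spin (σ i) :=
  fun _ _ h => Finset.sum_le_sum fun i _ => spin_mono (h i)

variable {μ : Measure Config} {U : Filter (Finset Site)}

/-- Integrals of increasing functions converge along the whole net, and the limit is identified
along `U`. A function of finitely many spins is a difference of two increasing ones. -/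
lemma tendsto_plus_of_local (hJ : 0 ≤ J) (hα : 2 < α) (hβ : 0 ≤ β) [IsProbabilityMeasure μ]
    [U.NeBot] (hU : U ≤ atTop) (hμ : ∀ f : Config → ℝ, Continuous f →
        Tendsto (fun Λ => ∫ σ, f σ ∂(isingSpec J α β Λ allPlus)) U (𝓝 (∫ σ, f σ ∂μ)))
    {f : Config → ℝ} (hfc : Continuous f) {Λ : Finset Site}
    (hf : ∀ σ ω : Config, (∀ i ∈ Λ, σ i = ω i) → f σ = f ω) :
    Tendsto (fun Λ => ∫ σ, f σ ∂(isingSpec J α β Λ allPlus)) atTop (𝓝 (∫ σ, f σ ∂μ)) := by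
  obtain ⟨C, hC⟩ : ∃ C, ∀ σ, |f σ| ≤ C := by
    obtain ⟨C, hC⟩ := (isCompact_range hfc).isBounded.exists_norm_le
    exact ⟨C, fun σ => hC _ ⟨σ, rfl⟩⟩
  have hmono : ∀ g : Config → ℝ, Continuous g → Monotone g →
      Tendsto (fun Λ => ∫ σ, g σ ∂(isingSpec J α β Λ allPlus)) atTop (𝓝 (∫ σ, g σ ∂μ)) := by
    intro g hgc hgm
    obtain ⟨a, ha⟩ := exists_tendsto_integral_plus (J := J) hJ hα hβ hgm
    rwa [tendsto_nhds_unique (hμ g hgc) (ha.mono_left hU)]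
  have hint : ∀ g : Config → ℝ, Continuous g → Integrable g μ := fun g hg =>
    (BoundedContinuousFunction.mkOfCompact ⟨g, hg⟩).integrable μ
  set s : Config → ℝ := fun σ => C * ∑ i ∈ Λ, spin (σ i) with hs
  have hsc : Continuous s :=
    continuous_const.mul (continuous_finsetSum _ fun i _ => continuous_spin_apply i)
  have hC0 : 0 ≤ C := (abs_nonneg _).trans (hC allPlus)
  have h1 := hmono _ (hfc.add hsc) (monotone_add_card hC hf)
  have h2 := hmono s hsc ((monotone_sum_spin Λ).const_mul hC0)
  have h3 := h1.sub h2
  have e1 : ∀ Λ', ∫ σ, (f σ + s σ) ∂(isingSpec J α β Λ' allPlus)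
      - ∫ σ, s σ ∂(isingSpec J α β Λ' allPlus) = ∫ σ, f σ ∂(isingSpec J α β Λ' allPlus) := fun Λ' => by
    rw [integral_add (integrable_isingSpec _ _ _) (integrable_isingSpec _ _ _), add_sub_cancel_right]
  have e2 : ∫ σ, (f σ + s σ) ∂μ - ∫ σ, s σ ∂μ = ∫ σ, f σ ∂μ := by
    rw [integral_add (hint f hfc) (hint s hsc), add_sub_cancel_right]
  simp only [Pi.add_apply] at h3
  rw [e2] at h3
  exact h3.congr e1

lemma tendsto_plus_of_quasilocal (hJ : 0 ≤ J) (hα : 2 < α) (hβ : 0 ≤ β) [IsProbabilityMeasure μ]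
    [U.NeBot] (hU : U ≤ atTop) (hμ : ∀ f : Config → ℝ, Continuous f →
        Tendsto (fun Λ => ∫ σ, f σ ∂(isingSpec J α β Λ allPlus)) U (𝓝 (∫ σ, f σ ∂μ)))
    {f : Config → ℝ} (hf : IsQuasilocalFun f) :
    Tendsto (fun Λ => ∫ σ, f σ ∂(isingSpec J α β Λ allPlus)) atTop (𝓝 (∫ σ, f σ ∂μ)) := by
  rw [Metric.tendsto_nhds]
  intro ε hε
  obtain ⟨Δ, hΔ⟩ := hf (ε / 4) (by positivity)
  -- Setting the spins off `Δ` to plus turns `f` into a function of finitely many spins that is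
  -- uniformly close to it.
  set r : Config → Config := fun σ i => if i ∈ Δ then σ i else true with hr
  have hrc : Continuous r := by
    refine continuous_pi fun i => ?_
    by_cases hi : i ∈ Δ
    · simpa [hr, hi] using continuous_apply i
    · simpa [hr, hi] using continuous_const
  have hfc := hf.continuous
  set g : Config → ℝ := fun σ => f (r σ) with hg
  have hgc : Continuous g := hfc.comp hrc
  have hfg : ∀ σ, |f σ - g σ| ≤ ε / 4 := fun σ => hΔ σ (r σ) fun i hi => by simp [hr, hi]
  have hloc : ∀ σ ω : Config, (∀ i ∈ Δ, σ i = ω i) → g σ = g ω := fun σ ω h => by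
    simp only [hg]
    congr 1
    funext i
    simp only [hr]
    split_ifs with hi
    · exact h i hi
    · rfl
  have hlim := tendsto_plus_of_local hJ hα hβ hU hμ hgc hloc
  rw [Metric.tendsto_nhds] at hlim
  have hint : ∀ g : Config → ℝ, Continuous g → Integrable g μ := fun g hg =>
    (BoundedContinuousFunction.mkOfCompact ⟨g, hg⟩).integrable μ
  have hclose : ∀ (P : Measure Config) [IsProbabilityMeasure P], Integrable f P → Integrable g P →
      |∫ σ, f σ ∂P - ∫ σ, g σ ∂P| ≤ ε / 4 := by
    intro P _ h1 h2
    rw [← integral_sub h1 h2]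
    have := norm_integral_le_of_norm_le_const (μ := P) (f := fun σ => f σ - g σ)
      (C := ε / 4) (Eventually.of_forall hfg)
    simpa using this
  filter_upwards [hlim (ε / 4) (by positivity)] with Λ hΛ
  rw [Real.dist_eq] at hΛ ⊢
  have h1 := hclose (isingSpec J α β Λ allPlus) (integrable_isingSpec _ _ _)
    (integrable_isingSpec _ _ _)
  have h2 := hclose μ (hint f hfc) (hint g hgc)
  rw [abs_le] at h1 h2
  rw [abs_lt] at hΛ ⊢
  constructor <;> linarith

end PlusPhase

/-! ### Limit points satisfy the DLR equations -/

section DLR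

variable {J α β : ℝ}

lemma continuous_fieldAt (hJ : 0 ≤ J) (hα : 2 < α) (V : Finset Site) (x : Site) :
    Continuous fun η => fieldAt J α V η x := by
  refine continuous_tsum (fun y => ?_) (summable_coupling hJ hα x) fun y η => ?_
  · refine continuous_const.mul ?_
    unfold offSpin
    split_ifs
    · exact continuous_const
    · exact continuous_spin_apply y
  · rw [Real.norm_eq_abs, abs_mul, abs_of_nonneg (coupling_nonneg hJ x y)]
    exact mul_le_of_le_one_right (coupling_nonneg hJ x y) (abs_offSpin_le V η y)

lemma continuous_volEnergy (hJ : 0 ≤ J) (hα : 2 < α) (V : Finset Site) (σ : V → Bool) :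
    Continuous fun η => volEnergy J α β V η σ := by
  unfold volEnergy pairEnergy
  refine continuous_const.add (continuous_finsetSum _ fun x _ => ?_)
  exact (continuous_const.mul (continuous_fieldAt hJ hα V x)).mul continuous_const

lemma continuous_glue (V : Finset Site) (σ : V → Bool) : Continuous (glue V σ) := by
  refine continuous_pi fun i => ?_
  unfold glue
  split_ifs
  · exact continuous_const
  · exact continuous_apply i

lemma continuous_integral_isingSpec (hJ : 0 ≤ J) (hα : 2 < α) (V : Finset Site) {f : Config → ℝ}
    (hf : Continuous f) : Continuous fun ω => ∫ σ, f σ ∂(isingSpec J α β V ω) := by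
  simp only [integral_isingSpec]
  unfold gibbsMean gibbsZ
  refine Continuous.div ?_ ?_ fun ω => (gibbsZ_pos (volEnergy J α β V ω)).ne'
  · exact continuous_finsetSum _ fun σ _ => (hf.comp (continuous_glue V σ)).mul
      (Real.continuous_exp.comp (continuous_volEnergy hJ hα V σ))
  · exact continuous_finsetSum _ fun σ _ =>
      Real.continuous_exp.comp (continuous_volEnergy hJ hα V σ)

lemma measurable_integral_isingSpec (hJ : 0 ≤ J) (hα : 2 < α) (V : Finset Site) {f : Config → ℝ}
    (hf : Measurable f) : Measurable fun ω => ∫ σ, f σ ∂(isingSpec J α β V ω) := by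
  simp only [integral_isingSpec]
  unfold gibbsMean gibbsZ
  refine Measurable.div ?_ ?_
  · exact Finset.measurable_sum _ fun σ _ => (hf.comp (continuous_glue V σ).measurable).mul
      (Real.continuous_exp.comp (continuous_volEnergy hJ hα V σ)).measurable
  · exact Finset.measurable_sum _ fun σ _ =>
      (Real.continuous_exp.comp (continuous_volEnergy hJ hα V σ)).measurable

lemma integral_isingSpec_glue (V : Finset Site) (τ : V → Bool) (ω : Config) (f : Config → ℝ) :
    ∫ σ, f σ ∂(isingSpec J α β V (glue V τ ω)) = ∫ σ, f σ ∂(isingSpec J α β V ω) := by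
  rw [integral_isingSpec, integral_isingSpec]
  congr 1
  · unfold volEnergy
    congr 1
    funext x
    rw [fieldAt_congr fun y hy => glue_of_notMem τ ω hy]
  · funext σ
    congr 1
    funext i
    by_cases hi : i ∈ V
    · rw [glue_of_mem _ _ hi, glue_of_mem _ _ hi]
    · rw [glue_of_notMem _ _ hi, glue_of_notMem _ _ hi, glue_of_notMem _ _ hi]

/-- The kernel ignores the spins in `V`, so it factors through the map that sets them to plus, which
is measurable with respect to the outside. -/
lemma measurable_outside_isingSpec (hJ : 0 ≤ J) (hα : 2 < α) (V : Finset Site) {A : Set Config}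
    (hA : MeasurableSet A) :
    Measurable[cylinderEvents ((V : Set Site)ᶜ)] fun ω => (isingSpec J α β V ω).real A := by
  have h1 : ∀ ω, (isingSpec J α β V ω).real A = ∫ σ, A.indicator 1 σ ∂(isingSpec J α β V ω) :=
    fun ω => (integral_indicator_one hA).symm
  have h2 : (fun ω => (isingSpec J α β V ω).real A)
      = (fun ω => ∫ σ, A.indicator 1 σ ∂(isingSpec J α β V ω)) ∘ glue V (fun _ => true) := by
    funext ω
    rw [h1, Function.comp_apply, integral_isingSpec_glue]
  rw [h2]
  refine (measurable_integral_isingSpec hJ hα V (measurable_one.indicator hA)).comp ?_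
  refine @measurable_pi_lambda Config Site (fun _ => Bool) (cylinderEvents ((V : Set Site)ᶜ)) _ _
    fun i => ?_
  by_cases hi : i ∈ V
  · simp only [glue_of_mem _ _ hi]
    exact measurable_const
  · simp only [glue_of_notMem _ _ hi]
    exact measurable_cylinderEvent_apply (by simpa using hi)

lemma measurable_isingSpec (hJ : 0 ≤ J) (hα : 2 < α) (V : Finset Site) :
    Measurable (isingSpec J α β V) := by
  refine Measure.measurable_of_measurable_coe _ fun A hA => ?_
  have h := ((measurable_outside_isingSpec (β := β) hJ hα V hA).mono
    cylinderEvents_le_pi le_rfl).ennreal_ofReal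
  simpa only [Measure.real, ENNReal.ofReal_toReal (measure_ne_top _ _)] using h

variable {μ : Measure Config}

/-- Integrals of continuous functions determine a finite measure, which extends the invariance to
all events. -/
lemma bind_isingSpec (hJ : 0 ≤ J) (hα : 2 < α) (V : Finset Site) [IsProbabilityMeasure μ]
    (h : ∀ f : Config → ℝ, Continuous f →
      ∫ ω, ∫ σ, f σ ∂(isingSpec J α β V ω) ∂μ = ∫ σ, f σ ∂μ) :
    μ.bind (isingSpec J α β V) = μ := by
  have hm := measurable_isingSpec (β := β) hJ hα V
  have hint : ∀ (P : Measure Config) [IsProbabilityMeasure P] (g : Config → ℝ), Continuous g →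
      Integrable g P := fun P _ g hg =>
    (BoundedContinuousFunction.mkOfCompact ⟨g, hg⟩).integrable P
  refine (ext_of_forall_lintegral_eq_of_IsFiniteMeasure fun f => ?_).symm
  have hfc : Continuous fun σ => (f σ : ℝ) := NNReal.continuous_coe.comp f.continuous
  have key : ∀ (P : Measure Config) [IsProbabilityMeasure P],
      ∫⁻ σ, (f σ : ENNReal) ∂P = ENNReal.ofReal (∫ σ, (f σ : ℝ) ∂P) := fun P _ => by
    rw [ofReal_integral_eq_lintegral_ofReal (hint P _ hfc)
      (Eventually.of_forall fun σ => NNReal.coe_nonneg _)]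
    simp only [ENNReal.ofReal_coe_nnreal]
  rw [Measure.lintegral_bind hm.aemeasurable
    (f.continuous.measurable.coe_nnreal_ennreal).aemeasurable, key μ, ← h _ hfc,
    ofReal_integral_eq_lintegral_ofReal (hint μ _ (continuous_integral_isingSpec hJ hα V hfc))
      (Eventually.of_forall fun ω => integral_nonneg fun σ => NNReal.coe_nonneg _)]
  exact lintegral_congr fun ω => (key _).symm

/-- Invariance under the kernels suffices for the DLR equations: properness lets an outside event
`B` be moved into the kernel, after which invariance is applied to `B ∩ A`. -/
lemma isDLR_of_integral_eq (hJ : 0 ≤ J) (hα : 2 < α) [IsProbabilityMeasure μ]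
    (h : ∀ (V : Finset Site) (f : Config → ℝ), Continuous f →
      ∫ ω, ∫ σ, f σ ∂(isingSpec J α β V ω) ∂μ = ∫ σ, f σ ∂μ) :
    IsDLR (isingSpec J α β) μ := by
  refine ⟨inferInstance, fun V A hA => ?_⟩
  have hm := measurable_outside_isingSpec (β := β) hJ hα V hA
  have hint : Integrable (fun ω => (isingSpec J α β V ω).real A) μ := by
    refine Integrable.of_bound (hm.mono cylinderEvents_le_pi le_rfl).aestronglyMeasurable 1
      (Eventually.of_forall fun ω => ?_)
    rw [Real.norm_eq_abs, abs_of_nonneg measureReal_nonneg]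
    exact measureReal_le_one
  refine (ae_eq_condExp_of_forall_setIntegral_eq cylinderEvents_le_pi
    ((integrable_const 1).indicator hA) (fun s _ _ => hint.integrableOn) (fun B hB _ => ?_)
    hm.stronglyMeasurable.aestronglyMeasurable).symm
  have hBm : MeasurableSet B := cylinderEvents_le_pi _ hB
  have hprop : ∀ ω, B.indicator (fun ω => (isingSpec J α β V ω).real A) ω
      = (isingSpec J α β V ω).real (B ∩ A) := by
    intro ω
    have hg : ∀ σ : V → Bool, glue V σ ω ∈ B ↔ ω ∈ B := fun σ =>
      mem_iff_of_measurableSet_cylinderEvents hB fun i hi => glue_of_notMem _ _ hi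
    rw [← integral_indicator_one (hBm.inter hA), integral_isingSpec]
    by_cases hω : ω ∈ B
    · rw [Set.indicator_of_mem hω, ← integral_indicator_one hA, integral_isingSpec]
      congr 1
      funext σ
      by_cases hσ : glue V σ ω ∈ A
      · rw [Set.indicator_of_mem hσ, Set.indicator_of_mem (Set.mem_inter ((hg σ).2 hω) hσ)]
      · rw [Set.indicator_of_notMem hσ, Set.indicator_of_notMem fun h' => hσ h'.2]
    · rw [Set.indicator_of_notMem hω, ← gibbsMean_const (volEnergy J α β V ω) 0]
      congr 1
      funext σ
      rw [Set.indicator_of_notMem fun h' => hω ((hg σ).1 h'.1)]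
  rw [setIntegral_indicator hA, ← integral_indicator hBm, integral_congr_ae
    (Eventually.of_forall hprop), setIntegral_const, smul_eq_mul, mul_one]
  have hbind : μ.bind (isingSpec J α β V) (B ∩ A) = μ (B ∩ A) := by
    rw [bind_isingSpec hJ hα V (h V)]
  rw [Measure.bind_apply (hBm.inter hA) (measurable_isingSpec hJ hα V).aemeasurable] at hbind
  rw [Measure.real, ← hbind]
  simp only [Measure.real]
  refine integral_toReal ?_ (Eventually.of_forall fun ω => measure_lt_top _ _)
  exact ((Measure.measurable_coe (hBm.inter hA)).comp (measurable_isingSpec hJ hα V)).aemeasurable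

/-- The plus phase exists and satisfies the DLR equations. -/
theorem exists_isPlusPhase (hJ : 0 ≤ J) (hα : 2 < α) (hβ : 0 ≤ β) :
    ∃ μ, IsPlusPhase J α β μ ∧ IsDLR (isingSpec J α β) μ := by
  obtain ⟨μ, U, hμ, hU, hle, hlim⟩ := exists_clusterPoint_plus J α β
  refine ⟨μ, ⟨hμ, fun f hf => tendsto_plus_of_quasilocal hJ hα hβ hle hlim hf⟩,
    isDLR_of_integral_eq hJ hα fun V f hf => ?_⟩
  -- The kernel maps continuous functions to continuous functions, so both sides of the
  -- finite-volume consistency relation converge along `U`.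
  have h1 := hlim _ (continuous_integral_isingSpec (β := β) hJ hα V hf)
  refine tendsto_nhds_unique h1 ((hlim f hf).congr' ?_)
  filter_upwards [hle (eventually_ge_atTop V)] with Λ hΛ
  exact (integral_integral_isingSpec hJ hα hΛ allPlus f).symm

/-- The low-temperature condition holds for large inverse temperatures. -/
lemma exists_threshold (hJ : 0 < J) (α : ℝ) :
    ∃ β₀ : ℝ, 0 < β₀ ∧ ∀ β, β₀ < β → 40 * Real.exp (-2 * (β * (J * 2 ^ (-α)))) ≤ 1 := by
  have hc : 0 < J * (2 : ℝ) ^ (-α) := by positivity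
  -- Beyond this threshold the exponent exceeds 40 in absolute value, and `x + 1 ≤ exp x` is already
  -- enough.
  refine ⟨20 / (J * 2 ^ (-α)), by positivity, fun β hβ => ?_⟩
  rw [div_lt_iff₀ hc] at hβ
  have h1 := Real.add_one_le_exp (2 * (β * (J * 2 ^ (-α))))
  rw [neg_mul, Real.exp_neg, ← div_eq_mul_inv, div_le_one (Real.exp_pos _)]
  linarith

end DLR

end LongRangeIsing

end

theorem mainTheorem4 (J α : ℝ) (hJ : 0 < J) (hα : 2 < α) :
    ∃ β₀ : ℝ, 0 < β₀ ∧ ∀ β : ℝ, β₀ < β →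
      (∃ μplus : Measure LongRangeIsing.Config,
        LongRangeIsing.IsPlusPhase J α β μplus ∧
        LongRangeIsing.IsDLR (LongRangeIsing.isingSpec J α β) μplus ∧
        ¬ LongRangeIsing.IsQuasilocalMeasure (LongRangeIsing.decimated μplus) ∧
        ¬ LongRangeIsing.IsGibbsMeasure (LongRangeIsing.decimated μplus)) ∧
      ∀ μ : Measure LongRangeIsing.Config,
        LongRangeIsing.IsDLR (LongRangeIsing.isingSpec J α β) μ →
        ¬ LongRangeIsing.IsQuasilocalMeasure (LongRangeIsing.decimated μ) ∧
        ¬ LongRangeIsing.IsGibbsMeasure (LongRangeIsing.decimated μ) := by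
  obtain ⟨β₀, hβ₀, hlow⟩ := LongRangeIsing.exists_threshold hJ α
  refine ⟨β₀, hβ₀, fun β hβ => ?_⟩
  have hβ0 : 0 < β := hβ₀.trans hβ
  have hnot : ∀ μ : MeasureTheory.Measure LongRangeIsing.Config,
      LongRangeIsing.IsDLR (LongRangeIsing.isingSpec J α β) μ →
        ¬ LongRangeIsing.IsQuasilocalMeasure (LongRangeIsing.decimated μ) ∧
        ¬ LongRangeIsing.IsGibbsMeasure (LongRangeIsing.decimated μ) := fun μ hμ => by
    have h := LongRangeIsing.not_isQuasilocalMeasure_decimated hJ hα hβ0 (hlow β hβ) hμ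
    exact ⟨h, fun hG => h hG.isQuasilocalMeasure⟩
  obtain ⟨μ, hplus, hdlr⟩ := LongRangeIsing.exists_isPlusPhase hJ.le hα hβ0.le
  exact ⟨⟨μ, hplus, hdlr, hnot μ hdlr⟩, hnot⟩
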